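/- **Setting.** Let $\mathbb M=\mathbb R^d$ and let $\mathcal P_2(\mathbb M)$ be the set of Borel probability measures on $\mathbb M$ with finite second moment, with the quadratic Wasserstein distance $W_2$; $\Gamma_0(m,\nu)$ is the set of optimal plans between $m$ and $\nu$. $T_m$ is the closure of $\nabla C_c^\infty(\mathbb M)$ in $L^2(m)=L^2(m;\mathbb R^d)$. *First order.* For $U:\mathcal P_2(\mathbb M)\to\mathbb R$, $\zeta\in L^2(m)$ is a subgradient of $U$ at $m$ if $U[\nu]-U[m]\ge\inf_{\gamma\in\Gamma_0(m,\nu)}\int\zeta(x)\cdot(y-x)\,\gamma(dx,dy)+o(W_2(m,\nu))$, and a supergradient if $-\zeta$ is a subgradient of $-U$. $U$ is differentiable at $m$ if it has both; $\nabla_wU[m]$ is then its subgradient of minimal norm, and $\zeta\cdot(U[m]):=\langle\nabla_wU[m],\zeta\rangle_{L^2(m)}$. *Second order.* $U$ is twice differentiable at $m$ if, for $\nu$ near $m$, $U$ is differentiable at $\nu$ with $\nabla_wU[\nu](x)$ continuous in $x$ and $|\nabla_wU[\nu](x)|\le C_m(1+|x|)$, and if there are bounded Borel matrix fields $\tilde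 A[m](x)$, $A_{mm}(x,a)$, a concave modulus $\rho$ and $\epsilon_2\ge0$ with $\epsilon_2(\tau)\to0$ as $\tau\to0^+$, such that for all $\nu\in\mathcal P_2(\mathbb M)$, $\gamma\in\Gamma_0(m,\nu)$, $x,y\in\mathbb M$, $$\Big|\nabla_wU[\nu](y)-\nabla_wU[m](x)-\tilde A[m](x)(y-x)-\int A_{mm}(x,a)(b-a)\,\gamma(da,db)\Big|\le|x-y|\rho(|x-y|)+W_2(m,\nu)\,\epsilon_2(W_2(m,\nu)).$$ $A_{mm}$ is normalised so that the rows of $A_{mm}(x,\cdot)$ lie in $T_m$. $U$ is twice continuously differentiable if this holds at every $m$ with $(x,m)\mapsto\tilde A[m](x)$ and $(x,a,m)\mapsto A_{mm}(x,a)$ continuous. The Hessian $\mathrm{Hess}\,U[m]$ is the bounded bilinear extension to $T_m\times T_m$ of $$(\zeta_1,\zeta_2)\mapsto\zeta_1\cdot\big(\zeta_2\cdot(U[m])\big)-(\nabla\zeta_2\,\zeta_1)\cdot(U[m]),\qquad\zeta_1,\zeta_2\in\nabla C_c^\infty(\mathbb M),$$ and, with $e_1,\dots,e_d$ the constant unit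 vector fields, for $\eta\ge0$, $$\triangle_{w,\eta}U[m]=\sum_{i=1}^d\Big(\mathrm{Hess}\,U[m](e_i,e_i)+\eta\int\langle\tilde A[m](x)e_i,e_i\rangle\,m(dx)\Big).$$ For complex-valued $U$ all this is applied to the real and imaginary parts. *Fourier data.* For $\xi\in\mathbb M^k$ put $$F^k_\xi[m]=\frac1k\int_{\mathbb M^k}\frac1{k!}\sum_{\sigma}e^{-2\pi i\sum_j\langle\xi_{\sigma(j)},x_j\rangle}\,m(dx_1)\cdots m(dx_k),\qquad\lambda^2_{k,\eta}(\xi)=4\pi^2\Big(\Big|\sum_{j=1}^k\xi_j\Big|^2+\eta\sum_{j=1}^k|\xi_j|^2\Big).$$ $\mathcal A^s$ is the set of sequences $(a_k)_{k\ge1}$ of permutation-symmetric Borel functions $a_k:\mathbb M^k\to\mathbb C$ with $\sum_{k\ge1}\frac1{k!}\int|a_k|^2(1+\lambda^2_{k,0})^s\,d\xi<\infty$. **Statement.** Let $\beta,\epsilon,s,\delta>0$, $C\in\mathbb R$, and let $(a_k)_{k\ge1}\in\mathcal A^s$ satisfy $\int_{\mathbb M^k}|a_k(\xi)|\,d\xi\le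 C\,k!/k^{3+\delta}$ for every $k\ge1$. Then the series $$U_0[m]=\sum_{k\ge1}\frac1{k!}\int_{\mathbb M^k}a_k(\xi)F^k_\xi[m]\,d\xi,\qquad V(t,m)=\sum_{k\ge1}\frac1{k!}\int_{\mathbb M^k}a_k(\xi)\,e^{-\beta\lambda^2_{k,\epsilon/\beta}(\xi)t}F^k_\xi[m]\,d\xi$$ converge uniformly on $\mathcal P_2(\mathbb M)$, for every $t>0$ in the case of $V(t,\cdot)$. For every $t>0$ and every integer $r\ge0$, $(\beta\triangle_{w,\epsilon/\beta})^rV(t,\cdot)$ is defined on all of $\mathcal P_2(\mathbb M)$ and is twice continuously differentiable there. No differentiability of $U_0$ is assumed. -/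

import Mathlib

open MeasureTheory Filter Topology
open scoped ENNReal ContDiff

noncomputable section

namespace WassersteinHeat

/-- The Euclidean space `ℝ^d`. -/
abbrev E (d : ℕ) : Type := EuclideanSpace ℝ (Fin d)

/-! ### The Wasserstein space -/

/-- Borel probability measures on `ℝ^d` with finite second moment. -/
structure P2 (d : ℕ) where
  toMeasure : Measure (E d)
  isProbability : IsProbabilityMeasure toMeasure
  finite_moment : ∫⁻ x, ‖x‖ₑ ^ 2 ∂toMeasure < (⊤ : ℝ≥0∞)

attribute [instance] P2.isProbability

variable {d : ℕ}

/-- Couplings of `m` and `ν`. -/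
def couplings (m ν : P2 d) : Set (Measure (E d × E d)) :=
  {γ | γ.map Prod.fst = m.toMeasure ∧ γ.map Prod.snd = ν.toMeasure}

/-- Quadratic transport cost of a plan. -/
def cost (γ : Measure (E d × E d)) : ℝ≥0∞ := ∫⁻ p, ‖p.1 - p.2‖ₑ ^ 2 ∂γ

/-- The quadratic Wasserstein distance. -/
def W2 (m ν : P2 d) : ℝ := Real.sqrt (⨅ γ ∈ couplings m ν, cost γ).toReal

/-- Optimal plans between `m` and `ν`. -/
def optimalPlans (m ν : P2 d) : Set (Measure (E d × E d)) :=
  {γ | γ ∈ couplings m ν ∧ cost γ = ⨅ γ' ∈ couplings m ν, cost γ'}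

/-- The neighbourhood filter of `m` for the distance `W2`: it is generated by the balls
`{ν | W2 m ν < r}`, `r > 0`. -/
def nhdsW (m : P2 d) : Filter (P2 d) := comap (fun ν => W2 m ν) (𝓝 0)

/-! ### First order calculus -/

/-- `L²(m)`, the Hilbert space of square integrable vector fields. -/
abbrev L2 (m : P2 d) : Type := Lp (E d) 2 m.toMeasure

/-- `ζ ∈ L²(m)` is a subgradient of `U` at `m`:
`U[ν] - U[m] ≥ inf_{γ ∈ Γ₀(m,ν)} ∫ ζ(x)·(y - x) γ(dx,dy) + o(W₂(m,ν))`. -/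
def IsSubgradient (U : P2 d → ℝ) (m : P2 d) (ζ : L2 m) : Prop :=
  ∀ η > 0, ∀ᶠ ν in nhdsW m,
    (⨅ γ : optimalPlans m ν, ∫ p, inner ℝ (ζ p.1) (p.2 - p.1) ∂(γ : Measure (E d × E d)))
      - η * W2 m ν ≤ U ν - U m

/-- `ζ` is a supergradient of `U` at `m` if `-ζ` is a subgradient of `-U`. -/
def IsSupergradient (U : P2 d → ℝ) (m : P2 d) (ζ : L2 m) : Prop :=
  IsSubgradient (fun ν => -U ν) m (-ζ)

/-- `U` is differentiable at `m`: it has a subgradient and a supergradient there. -/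
def DifferentiableAtW (U : P2 d → ℝ) (m : P2 d) : Prop :=
  (∃ ζ, IsSubgradient U m ζ) ∧ ∃ ζ, IsSupergradient U m ζ

/-- `g` is the Wasserstein gradient of `U` at `m`: the subgradient of minimal norm. -/
def IsGradientW (U : P2 d → ℝ) (m : P2 d) (g : L2 m) : Prop :=
  IsSubgradient U m g ∧ ∀ ζ, IsSubgradient U m ζ → ‖g‖ ≤ ‖ζ‖

/-- `C_c^∞(ℝ^d; F)`. -/
def IsTest {F : Type*} [NormedAddCommGroup F] [NormedSpace ℝ F] (φ : E d → F) : Prop :=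
  ContDiff ℝ ∞ φ ∧ HasCompactSupport φ

/-- The tangent space `T_m`: the closure in `L²(m)` of the gradients of test functions. -/
def tangentSpace (m : P2 d) : Set (L2 m) :=
  closure {g | ∃ φ : E d → ℝ, IsTest φ ∧ g =ᵐ[m.toMeasure] gradient φ}

/-! ### Second order calculus -/

/-- A concave modulus on `[0, ∞)`. -/
structure IsConcaveModulus (ρ : ℝ → ℝ) : Prop where
  zero : ρ 0 = 0
  nonneg : ∀ r, 0 ≤ r → 0 ≤ ρ r
  continuousOn : ContinuousOn ρ (Set.Ici 0)
  monotoneOn : MonotoneOn ρ (Set.Ici 0)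
  subadditive : ∀ r r', 0 ≤ r → 0 ≤ r' → ρ (r + r') ≤ ρ r + ρ r'
  concaveOn : ConcaveOn ℝ (Set.Ici 0) ρ

/-- `P_γ[m](x, y) = B(x)(y - x) + ∫ C(x, a)(b - a) γ(da, db)`. -/
def linearPart (B : E d → E d →L[ℝ] E d) (C : E d → E d → E d →L[ℝ] E d)
    (γ : Measure (E d × E d)) (x y : E d) : E d :=
  B x (y - x) + ∫ p, C x p.1 (p.2 - p.1) ∂γ

/-- `U` is twice differentiable at `m`, where `G ν` is the continuous version of the Wasserstein
gradient `∇_w U[ν]`, `B` is the matrix field `Ã[m]` and `C` is the matrix field `A_{mm}`,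
normalised by `A_{mm} = π_m(A_{mm})`, that is, the rows of `C(x, ·)` belong to `T_m`. -/
structure IsTwiceDifferentiableAt (U : P2 d → ℝ) (m : P2 d) (G : P2 d → E d → E d)
    (B : E d → E d →L[ℝ] E d) (C : E d → E d → E d →L[ℝ] E d) : Prop where
  differentiable : ∀ᶠ ν in nhdsW m, DifferentiableAtW U ν
  gradient_eq : ∀ᶠ ν in nhdsW m, ∃ g : L2 ν, IsGradientW U ν g ∧ g =ᵐ[ν.toMeasure] G ν
  gradient_continuous : ∀ᶠ ν in nhdsW m, Continuous (G ν)
  gradient_growth : ∃ K : ℝ, ∀ᶠ ν in nhdsW m, ∀ x, ‖G ν x‖ ≤ K * (1 + ‖x‖)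
  measurable_B : Measurable B
  bounded_B : ∃ K : ℝ, ∀ x, ‖B x‖ ≤ K
  measurable_C : Measurable fun p : E d × E d => C p.1 p.2
  bounded_C : ∃ K : ℝ, ∀ x a, ‖C x a‖ ≤ K
  rows_tangent : ∀ x v, ∃ g ∈ tangentSpace m,
    g =ᵐ[m.toMeasure] fun a => ContinuousLinearMap.adjoint (C x a) v
  expansion : ∃ ρ ε₂ : ℝ → ℝ, IsConcaveModulus ρ ∧ (∀ r, 0 ≤ ε₂ r) ∧
    Tendsto ε₂ (𝓝[>] 0) (𝓝 0) ∧
    ∀ ν, ∀ γ ∈ optimalPlans m ν, ∀ x y,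
      ‖G ν y - G m x - linearPart B C γ x y‖ ≤ ‖x - y‖ * ρ ‖x - y‖ + W2 m ν * ε₂ (W2 m ν)

/-- `U` is twice continuously differentiable on the whole Wasserstein space. -/
def IsC2 (U : P2 d → ℝ) : Prop :=
  ∃ (G : P2 d → E d → E d) (B : P2 d → E d → E d →L[ℝ] E d)
    (C : P2 d → E d → E d → E d →L[ℝ] E d),
    (∀ m, IsTwiceDifferentiableAt U m G (B m) (C m)) ∧
    (∀ m x, Tendsto (fun q : P2 d × E d => B q.1 q.2) (nhdsW m ×ˢ 𝓝 x) (𝓝 (B m x))) ∧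
    (∀ m x y, Tendsto (fun q : P2 d × (E d × E d) => C q.1 q.2.1 q.2.2)
      (nhdsW m ×ˢ (𝓝 x ×ˢ 𝓝 y)) (𝓝 (C m x y)))

/-- The derivative `ν ↦ ζ · (U[ν]) = ⟨∇_w U[ν], ζ⟩_ν`, where `G ν` represents `∇_w U[ν]`. -/
def dirDeriv (G : P2 d → E d → E d) (ζ : E d → E d) (ν : P2 d) : ℝ :=
  ∫ x, inner ℝ (G ν x) (ζ x) ∂ν.toMeasure

/-- `h` is the value `ζ₁ · (ζ₂ · (U[m])) - (∇̄_{ζ₁} ζ₂) · (U[m])`, with `∇̄_{ζ₁} ζ₂ = ∇ζ₂ ζ₁`,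
where `G ν` represents `∇_w U[ν]` for `ν` near `m`. -/
def IsBarHessian (m : P2 d) (G : P2 d → E d → E d) (ζ₁ ζ₂ : E d → E d) (h : ℝ) : Prop :=
  ∃ q : L2 m, IsGradientW (dirDeriv G ζ₂) m q ∧
    h = (∫ x, inner ℝ (q x) (ζ₁ x) ∂m.toMeasure) - dirDeriv G (fun x => fderiv ℝ ζ₂ x (ζ₁ x)) m

/-- `H` is the Hessian at `m`: a bounded bilinear form which agrees with the expression above on
gradients of test functions. Only its restriction to `T_m × T_m` is meaningful, and it is
determined there by density; every bounded form on `T_m × T_m` extends to `L²(m) × L²(m)` by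
composition with the orthogonal projection. -/
def IsHessian (m : P2 d) (G : P2 d → E d → E d) (H : L2 m →L[ℝ] L2 m →L[ℝ] ℝ) : Prop :=
  (∀ ζ : E d → E d, IsTest ζ → DifferentiableAtW (dirDeriv G ζ) m) ∧
  ∀ φ₁ φ₂ : E d → ℝ, IsTest φ₁ → IsTest φ₂ → ∀ z₁ z₂ : L2 m,
    z₁ =ᵐ[m.toMeasure] gradient φ₁ → z₂ =ᵐ[m.toMeasure] gradient φ₂ →
    IsBarHessian m G (gradient φ₁) (gradient φ₂) (H z₁ z₂)

/-- The `i`-th constant unit vector field, which is the Wasserstein gradient of the `i`-th moment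
`m ↦ ∫ x_i m(dx)`; it belongs to `T_m`. -/
def unitField (m : P2 d) (i : Fin d) : L2 m :=
  Lp.const 2 m.toMeasure (EuclideanSpace.single i (1 : ℝ))

/-- `U` is twice differentiable at `m` with a Hessian `H`, and
`L = (Δ_{w,ε} U)[m] = ∑_i (Hess U[m](ζ_i, ζ_i) + ε ∫ ⟨Ã[m](x) ζ_i(x), ζ_i(x)⟩ m(dx))`. -/
def HasLaplacianAt (ε : ℝ) (U : P2 d → ℝ) (m : P2 d) (L : ℝ) : Prop :=
  ∃ G B C, IsTwiceDifferentiableAt U m G B C ∧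
    ∃ H, IsHessian m G H ∧
      L = ∑ i : Fin d, (H (unitField m i) (unitField m i) +
        ε * ∫ x, inner ℝ (B x (EuclideanSpace.single i (1 : ℝ)))
          (EuclideanSpace.single i (1 : ℝ)) ∂m.toMeasure)

/-! ### Complex valued functions: real and imaginary parts -/

/-- A complex valued function is `C²` if its real and imaginary parts are. -/
def IsC2Complex (U : P2 d → ℂ) : Prop :=
  IsC2 (fun m => (U m).re) ∧ IsC2 (fun m => (U m).im)

/-- `(Δ_{w,ε} U)[m] = L` for a complex valued function `U`. -/
def HasLaplacianAtComplex (ε : ℝ) (U : P2 d → ℂ) (m : P2 d) (L : ℂ) : Prop :=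
  HasLaplacianAt ε (fun ν => (U ν).re) m L.re ∧ HasLaplacianAt ε (fun ν => (U ν).im) m L.im

/-- `W = (β Δ_{w,ε/β})^r U`, all the intermediate Laplacians existing at every point. -/
def IsLaplacianPower (β ε : ℝ) : ℕ → (P2 d → ℂ) → (P2 d → ℂ) → Prop
  | 0, U, W => W = U
  | r + 1, U, W => ∃ W', IsLaplacianPower β ε r U W' ∧
      ∀ m, ∃ L, HasLaplacianAtComplex (ε / β) W' m L ∧ W m = β * L

/-! ### Fourier expansions -/

/-- The symmetrised exponential
`Φ^k_ξ(x) = (1/k!) ∑_σ exp(-2πi ∑_j ⟨ξ_{σ(j)}, x_j⟩)`. -/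
def expSym (k : ℕ) (ξ x : Fin k → E d) : ℂ :=
  (1 / (k.factorial : ℂ)) * ∑ σ : Equiv.Perm (Fin k),
    Complex.exp (-2 * Real.pi * Complex.I * ((∑ j, inner ℝ (ξ (σ j)) (x j) : ℝ) : ℂ))

/-- `F^k_ξ[m] = (1/k) ∫ Φ^k_ξ(x) m(dx_1) ⋯ m(dx_k)`. -/
def eigenF (k : ℕ) (ξ : Fin k → E d) (m : P2 d) : ℂ :=
  (1 / (k : ℂ)) * ∫ x, expSym k ξ x ∂(Measure.pi fun _ : Fin k => m.toMeasure)

/-- `λ²_{k,ε}(ξ) = 4π² (|∑_j ξ_j|² + ε ∑_j |ξ_j|²)`; `ε = 0` gives `λ²_k`. -/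
def lamSq (ε : ℝ) (k : ℕ) (ξ : Fin k → E d) : ℝ :=
  4 * Real.pi ^ 2 * (‖∑ j, ξ j‖ ^ 2 + ε * ∑ j, ‖ξ j‖ ^ 2)

/-- The class `𝒜^s`: sequences `(a_k)_{k ≥ 1}` of symmetric Borel functions with
`∑_k (1/k!) ∫ |a_k|² (1 + λ_k²)^s dξ < ∞`. -/
structure MemA (s : ℝ) (a : (k : ℕ) → (Fin k → E d) → ℂ) : Prop where
  measurable : ∀ k, 1 ≤ k → Measurable (a k)
  symm : ∀ k, 1 ≤ k → ∀ (σ : Equiv.Perm (Fin k)) ξ, a k (fun j => ξ (σ j)) = a k ξ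
  summable : ∑' n : ℕ, ((n + 1).factorial : ℝ≥0∞)⁻¹ *
    ∫⁻ ξ, ‖a (n + 1) ξ‖ₑ ^ 2 * ENNReal.ofReal ((1 + lamSq 0 (n + 1) ξ) ^ s) < (⊤ : ℝ≥0∞)

/-- The `k`-th term `(1/k!) ∫ a_k(ξ) F^k_ξ[m] dξ`. -/
def term (a : (k : ℕ) → (Fin k → E d) → ℂ) (k : ℕ) (m : P2 d) : ℂ :=
  (1 / (k.factorial : ℂ)) * ∫ ξ, a k ξ * eigenF k ξ m

/-- The sum over `k = 1, …, N`. -/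
def partialSum (a : (k : ℕ) → (Fin k → E d) → ℂ) (N : ℕ) (m : P2 d) : ℂ :=
  ∑ n ∈ Finset.range N, term a (n + 1) m

/-- The sum over all `k ≥ 1`. -/
def fullSum (a : (k : ℕ) → (Fin k → E d) → ℂ) (m : P2 d) : ℂ :=
  ∑' n : ℕ, term a (n + 1) m

/-- `b_k(t, ξ) = a_k(ξ) exp(-β λ²_{k,ε/β}(ξ) t)`. -/
def heatCoeff (β ε t : ℝ) (a : (k : ℕ) → (Fin k → E d) → ℂ) (k : ℕ) (ξ : Fin k → E d) : ℂ :=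
  a k ξ * (Real.exp (-(β * lamSq (ε / β) k ξ * t)) : ℝ)

/-- `V(t, m) = ∑_{k ≥ 1} (1/k!) ∫ b_k(t, ξ) F^k_ξ[m] dξ`. -/
def heatFlow (β ε : ℝ) (a : (k : ℕ) → (Fin k → E d) → ℂ) (t : ℝ) : P2 d → ℂ :=
  fullSum (heatCoeff β ε t a)

end WassersteinHeat

end

noncomputable section

namespace WassersteinHeat

variable {d : ℕ}

/-! ### Couplings and optimal plans -/

/-! Because the product measure factorises, F^k_ξ[m] = (1/k) ∏_j m̂(ξ_j) (`eigenF_eq`). A product of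
Fourier transforms has explicit Wasserstein derivatives: each differentiation brings down a
frequency. Integrating the second derivatives against m restores the factors that were removed, so
the product is an eigenfunction of the Laplacian with eigenvalue -λ² (`Freqs.laplacian_fU`). The
r-th power of βΔ should therefore multiply the coefficients of V by (-βλ²)^r. What has to be
justified is differentiation under the frequency integral and the sum over k.

The series is written as one integral over the disjoint union of the frequency spaces. For a single
tuple, all derivatives, their Lipschitz constants and the Taylor remainders along optimal plans are
bounded by |c| size³, where size is 1 + 4π ∑|ξ_j|; the estimates come from `Approx.prod`. If this
weight is integrable, the bounds integrate (`Freqs.hasUniformDerivs`) and give `HasUniformDerivs`,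
which implies class C² and a formula for the Laplacian.

Integrability is where the heat factor and the bound on a_k meet. With X = βλ², positivity of ε
gives size ≤ k(2 + X/ε) (`size_le`), and exp(-Xt) absorbs every power of X (`pow_mul_exp_le`). Three
derivatives therefore cost only k³, and (1/k!)(1/k) k³ · k!/k^(3+δ) = k^(-1-δ) is summable. Uniform
convergence is the Weierstrass test, already without the heat factor.

It remains to link these expansions to gradients defined as subgradients of minimal norm. A
quadratic expansion along all optimal plans makes its field g a sub- and supergradient. Moving m
along id + s∇φ for small s of both signs, where the optimal plan is unique
(`IsTest.exists_unique_optimal`), shows that any other subgradient differs from g by a field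
orthogonal to T_m. If g is tangent it is thus the minimal one (`HasExpansion.isGradientW`). Applied
again to ν ↦ ζ·(U[ν]), this identifies the Hessian (`HasUniformDerivs.isHessian`). -/

lemma P2.memLp_id (m : P2 d) : MemLp (fun x : E d => x) 2 m.toMeasure := by
  refine ⟨aestronglyMeasurable_id, ?_⟩
  rw [eLpNorm_lt_top_iff_lintegral_rpow_enorm_lt_top (by norm_num) (by norm_num)]
  simpa using m.finite_moment

lemma isProbabilityMeasure_of_mem_couplings {m ν : P2 d} {γ : Measure (E d × E d)}
    (h : γ ∈ couplings m ν) : IsProbabilityMeasure γ := by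
  have : IsProbabilityMeasure (γ.map Prod.fst) := by rw [h.1]; infer_instance
  exact ⟨by
    have := this.measure_univ
    rwa [Measure.map_apply measurable_fst MeasurableSet.univ, Set.preimage_univ] at this⟩

lemma measurePreserving_fst_of_mem_couplings {m ν : P2 d} {γ : Measure (E d × E d)}
    (h : γ ∈ couplings m ν) : MeasurePreserving Prod.fst γ m.toMeasure :=
  ⟨measurable_fst, h.1⟩

lemma measurePreserving_snd_of_mem_couplings {m ν : P2 d} {γ : Measure (E d × E d)}
    (h : γ ∈ couplings m ν) : MeasurePreserving Prod.snd γ ν.toMeasure :=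
  ⟨measurable_snd, h.2⟩

lemma memLp_sub_of_mem_couplings {m ν : P2 d} {γ : Measure (E d × E d)}
    (h : γ ∈ couplings m ν) : MemLp (fun p : E d × E d => p.2 - p.1) 2 γ :=
  (ν.memLp_id.comp_measurePreserving (measurePreserving_snd_of_mem_couplings h)).sub
    (m.memLp_id.comp_measurePreserving (measurePreserving_fst_of_mem_couplings h))

lemma integrable_sq_of_mem_couplings {m ν : P2 d} {γ : Measure (E d × E d)}
    (h : γ ∈ couplings m ν) : Integrable (fun p : E d × E d => ‖p.2 - p.1‖ ^ 2) γ :=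
  (memLp_sub_of_mem_couplings h).integrable_norm_pow (by norm_num)

lemma cost_eq_ofReal {m ν : P2 d} {γ : Measure (E d × E d)}
    (h : γ ∈ couplings m ν) : cost γ = ENNReal.ofReal (∫ p, ‖p.2 - p.1‖ ^ 2 ∂γ) := by
  rw [ofReal_integral_eq_lintegral_ofReal (integrable_sq_of_mem_couplings h)
    (ae_of_all _ fun _ => by positivity)]
  refine lintegral_congr fun p => ?_
  rw [ENNReal.ofReal_pow (norm_nonneg _), ofReal_norm, ← neg_sub, enorm_neg]

/-- Turns the distance, defined through an infimum in `ℝ≥0∞`, into a Bochner integral; every later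
remainder estimate uses it. -/
lemma integral_sq_of_mem_optimalPlans {m ν : P2 d} {γ : Measure (E d × E d)}
    (h : γ ∈ optimalPlans m ν) : ∫ p, ‖p.2 - p.1‖ ^ 2 ∂γ = W2 m ν ^ 2 := by
  rw [W2, ← h.2, Real.sq_sqrt ENNReal.toReal_nonneg, cost_eq_ofReal h.1,
    ENNReal.toReal_ofReal (integral_nonneg fun _ => by positivity)]

lemma W2_nonneg (m ν : P2 d) : 0 ≤ W2 m ν := Real.sqrt_nonneg _

lemma W2_sq_le_of_mem_couplings {m ν : P2 d} {γ : Measure (E d × E d)}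
    (h : γ ∈ couplings m ν) : W2 m ν ^ 2 ≤ ∫ p, ‖p.2 - p.1‖ ^ 2 ∂γ := by
  rw [W2, Real.sq_sqrt ENNReal.toReal_nonneg]
  have h0 : 0 ≤ ∫ p, ‖p.2 - p.1‖ ^ 2 ∂γ := integral_nonneg fun _ => by positivity
  rw [← ENNReal.toReal_ofReal h0, ← cost_eq_ofReal h]
  -- Finiteness of the cost is essential: `toReal` sends `⊤` to 0 and is monotone only below a
  -- finite value.
  refine ENNReal.toReal_mono ?_ (iInf₂_le γ h)
  rw [cost_eq_ofReal h]; exact ENNReal.ofReal_ne_top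

lemma mem_optimalPlans_of_forall_le {m ν : P2 d} {γ : Measure (E d × E d)}
    (h : γ ∈ couplings m ν)
    (hle : ∀ γ' ∈ couplings m ν, ∫ p, ‖p.2 - p.1‖ ^ 2 ∂γ ≤ ∫ p, ‖p.2 - p.1‖ ^ 2 ∂γ') :
    γ ∈ optimalPlans m ν := by
  refine ⟨h, le_antisymm (le_iInf₂ fun γ' h' => ?_) (iInf₂_le γ h)⟩
  rw [cost_eq_ofReal h, cost_eq_ofReal h']
  exact ENNReal.ofReal_le_ofReal (hle γ' h')

lemma integral_le_of_mem_optimalPlans {m ν : P2 d} {γ γ' : Measure (E d × E d)}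
    (h : γ ∈ optimalPlans m ν) (h' : γ' ∈ couplings m ν) :
    ∫ p, ‖p.2 - p.1‖ ^ 2 ∂γ ≤ ∫ p, ‖p.2 - p.1‖ ^ 2 ∂γ' := by
  rw [integral_sq_of_mem_optimalPlans h]
  exact W2_sq_le_of_mem_couplings h'

lemma prod_mem_couplings (m ν : P2 d) : m.toMeasure.prod ν.toMeasure ∈ couplings m ν := by
  constructor
  · simp [Measure.map_fst_prod]
  · simp [Measure.map_snd_prod]

/-- The integrals of the bounded truncations min(f, n) are weakly continuous, and a supremum of
continuous functions is lower semicontinuous. -/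
lemma lowerSemicontinuous_lintegral_probabilityMeasure {X : Type*} [TopologicalSpace X]
    [MeasurableSpace X] [OpensMeasurableSpace X] {f : X → NNReal} (hf : Continuous f) :
    LowerSemicontinuous fun γ : ProbabilityMeasure X => ∫⁻ x, (f x : ℝ≥0∞) ∂(γ : Measure X) := by
  have key : ∀ γ : ProbabilityMeasure X, ∫⁻ x, (f x : ℝ≥0∞) ∂(γ : Measure X) =
      ⨆ n : ℕ, ∫⁻ x, ((min (f x) n : NNReal) : ℝ≥0∞) ∂(γ : Measure X) := by
    intro γ
    rw [← lintegral_iSup]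
    · refine lintegral_congr fun x => le_antisymm ?_ (iSup_le fun n => by
        exact_mod_cast min_le_left _ _)
      obtain ⟨n, hn⟩ := exists_nat_ge (f x)
      exact le_iSup_of_le n (by rw [min_eq_left hn])
    · exact fun n => (hf.min continuous_const).measurable.coe_nnreal_ennreal
    · intro n n' hn x
      have : (n : NNReal) ≤ n' := by exact_mod_cast hn
      exact ENNReal.coe_le_coe.2 (min_le_min_left (f x) this)
  simp_rw [key]
  refine lowerSemicontinuous_iSup fun n => Continuous.lowerSemicontinuous ?_
  let F : BoundedContinuousFunction X NNReal :=
    BoundedContinuousFunction.mkOfBound ⟨fun x => min (f x) n, hf.min continuous_const⟩ n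
      (fun x y => by
        rw [NNReal.dist_eq, abs_le]
        have h1 : ((min (f x) n : NNReal) : ℝ) ≤ n := by exact_mod_cast min_le_right _ _
        have h2 : ((min (f y) n : NNReal) : ℝ) ≤ n := by exact_mod_cast min_le_right _ _
        have h3 := (min (f x) n).coe_nonneg
        have h4 := (min (f y) n).coe_nonneg
        simp only [ContinuousMap.coe_mk]
        constructor <;> linarith)
  rw [continuous_iff_continuousAt]
  intro γ
  exact (ProbabilityMeasure.tendsto_iff_forall_lintegral_tendsto.1 tendsto_id) F

/-- Optimal plans exist. -/
theorem optimalPlans_nonempty (m ν : P2 d) : (optimalPlans m ν).Nonempty := by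
  let S : Set (ProbabilityMeasure (E d × E d)) := {γ | (γ : Measure _) ∈ couplings m ν}
  have hclosed : IsClosed S := by
    let m' : ProbabilityMeasure (E d) := ⟨m.toMeasure, m.isProbability⟩
    let ν' : ProbabilityMeasure (E d) := ⟨ν.toMeasure, ν.isProbability⟩
    have : S = {γ | γ.map (f := Prod.fst) measurable_fst.aemeasurable = m'} ∩
        {γ | γ.map (f := Prod.snd) measurable_snd.aemeasurable = ν'} := by
      ext γ
      refine and_congr ?_ ?_
      · exact (Subtype.ext_iff (a1 := γ.map (f := Prod.fst) measurable_fst.aemeasurable)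
          (a2 := m')).symm
      · exact (Subtype.ext_iff (a1 := γ.map (f := Prod.snd) measurable_snd.aemeasurable)
          (a2 := ν')).symm
    rw [this]
    exact (isClosed_eq (ProbabilityMeasure.continuous_map continuous_fst) continuous_const).inter
      (isClosed_eq (ProbabilityMeasure.continuous_map continuous_snd) continuous_const)
  -- Couplings have fixed marginals, each tight on its own, so the set of couplings is tight; with
  -- closedness, Prokhorov's theorem gives compactness.
  have htight : IsTightMeasureSet {x | ∃ μ ∈ S, (μ : Measure (E d × E d)) = x} := by
    refine IsTightMeasureSet.prodMk ?_ ?_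
    · refine (isTightMeasureSet_singleton (μ := m.toMeasure)).subset ?_
      rintro _ ⟨_, ⟨γ, hγ, rfl⟩, rfl⟩
      exact hγ.1
    · refine (isTightMeasureSet_singleton (μ := ν.toMeasure)).subset ?_
      rintro _ ⟨_, ⟨γ, hγ, rfl⟩, rfl⟩
      exact hγ.2
  have hcomp : IsCompact S := by
    have := isCompact_closure_of_isTightMeasureSet htight
    rwa [hclosed.closure_eq] at this
  have hlsc : LowerSemicontinuous fun γ : ProbabilityMeasure (E d × E d) =>
      cost (γ : Measure (E d × E d)) := by
    have := lowerSemicontinuous_lintegral_probabilityMeasure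
      (X := E d × E d) (f := fun p => ‖p.1 - p.2‖₊ ^ 2) (by fun_prop)
    simpa only [cost, ENNReal.coe_pow, enorm_eq_nnnorm] using this
  obtain ⟨γ, hγ, hmin⟩ := LowerSemicontinuousOn.exists_isMinOn
    ⟨⟨_, isProbabilityMeasure_of_mem_couplings (prod_mem_couplings m ν)⟩, prod_mem_couplings m ν⟩
    hcomp (hlsc.lowerSemicontinuousOn S)
  refine ⟨γ, hγ, le_antisymm (le_iInf₂ fun γ' h' => ?_) (iInf₂_le (γ : Measure (E d × E d)) hγ)⟩
  exact hmin (show (⟨γ', isProbabilityMeasure_of_mem_couplings h'⟩ : ProbabilityMeasure _) ∈ S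
    from h')

/-! ### Displacements along gradients of test functions -/

lemma IsTest.hasGradientAt {φ : E d → ℝ} (h : IsTest φ) (x : E d) :
    HasGradientAt φ (gradient φ x) x :=
  ((h.1.differentiable (by norm_num)) x).hasGradientAt

lemma IsTest.contDiff_gradient {φ : E d → ℝ} (h : IsTest φ) : ContDiff ℝ ∞ (gradient φ) := by
  have : ContDiff ℝ ∞ (fderiv ℝ φ) := h.1.fderiv_right (by norm_num)
  exact (InnerProductSpace.toDual ℝ (E d)).symm.contDiff.comp this

lemma IsTest.hasCompactSupport_gradient {φ : E d → ℝ} (h : IsTest φ) :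
    HasCompactSupport (gradient φ) :=
  (h.2.fderiv ℝ).comp_left (g := (InnerProductSpace.toDual ℝ (E d)).symm) (map_zero _)

lemma IsTest.isTest_gradient {φ : E d → ℝ} (h : IsTest φ) : IsTest (gradient φ) :=
  ⟨h.contDiff_gradient, h.hasCompactSupport_gradient⟩

lemma IsTest.exists_bound {F : Type*} [NormedAddCommGroup F] [NormedSpace ℝ F] {φ : E d → F}
    (h : IsTest φ) : ∃ M, ∀ x, ‖φ x‖ ≤ M :=
  h.2.exists_bound_of_continuous h.1.continuous

lemma IsTest.isTest_fderiv {F : Type*} [NormedAddCommGroup F] [NormedSpace ℝ F] {φ : E d → F}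
    (h : IsTest φ) : IsTest (fderiv ℝ φ) :=
  ⟨h.1.fderiv_right (by norm_num), h.2.fderiv ℝ⟩

/-- Test functions have a quadratic first order Taylor remainder. -/
lemma IsTest.exists_taylor {F : Type*} [NormedAddCommGroup F] [NormedSpace ℝ F] {φ : E d → F}
    (h : IsTest φ) : ∃ L, 0 ≤ L ∧ (∀ x y, ‖φ y - φ x‖ ≤ L * ‖y - x‖) ∧
      ∀ x y, ‖φ y - φ x - fderiv ℝ φ x (y - x)‖ ≤ L * ‖y - x‖ ^ 2 := by
  obtain ⟨L₁, h₁⟩ := h.isTest_fderiv.exists_bound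
  obtain ⟨L₂, h₂⟩ := h.isTest_fderiv.isTest_fderiv.exists_bound
  have hd := h.1.differentiable (by norm_num)
  have hd' := h.isTest_fderiv.1.differentiable (by norm_num)
  have lip : ∀ x y, ‖fderiv ℝ φ y - fderiv ℝ φ x‖ ≤ L₂ * ‖y - x‖ := fun x y =>
    convex_univ.norm_image_sub_le_of_norm_fderiv_le (fun z _ => hd' z) (fun z _ => h₂ z)
      (Set.mem_univ x) (Set.mem_univ y)
  refine ⟨max L₁ L₂, le_max_of_le_left ((norm_nonneg _).trans (h₁ 0)), fun x y => ?_,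
    fun x y => ?_⟩
  · refine (convex_univ.norm_image_sub_le_of_norm_fderiv_le (fun z _ => hd z) (fun z _ => h₁ z)
      (Set.mem_univ x) (Set.mem_univ y)).trans ?_
    gcongr
    exact le_max_left _ _
  -- Mean value inequality for φ minus its linearisation at x, whose derivative on the segment is at
  -- most L₂‖y - x‖.
  · have := (convex_segment x y).norm_image_sub_le_of_norm_fderiv_le' (f := φ) (𝕜 := ℝ)
      (φ := fderiv ℝ φ x) (C := L₂ * ‖y - x‖) (fun z _ => hd z) (fun z hz => ?_)
      (left_mem_segment ℝ x y) (right_mem_segment ℝ x y)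
    · refine this.trans ?_
      rw [mul_assoc, ← sq]
      gcongr
      exact le_max_right _ _
    · refine (lip x z).trans ?_
      have : 0 ≤ L₂ := (norm_nonneg _).trans (h₂ 0)
      gcongr
      exact norm_sub_le_of_mem_segment hz

/-- The push-forward of `m` under a map `T` at bounded distance from the identity. -/
def P2.push (m : P2 d) (T : E d → E d) (hT : Continuous T) (hb : ∃ M, ∀ x, ‖T x - x‖ ≤ M) :
    P2 d where
  toMeasure := m.toMeasure.map T
  isProbability := Measure.isProbabilityMeasure_map hT.aemeasurable
  finite_moment := by
    have h1 : MemLp (fun x => T x - x) 2 m.toMeasure := by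
      obtain ⟨M, hM⟩ := hb
      exact MemLp.of_bound (hT.sub continuous_id).aestronglyMeasurable M (ae_of_all _ hM)
    have h2 : MemLp T 2 m.toMeasure := by
      refine (h1.add m.memLp_id).congr_norm hT.aestronglyMeasurable (ae_of_all _ fun x => ?_)
      simp
    rw [lintegral_map (by fun_prop) hT.measurable]
    have := h2.2
    rw [eLpNorm_lt_top_iff_lintegral_rpow_enorm_lt_top (by norm_num) (by norm_num)] at this
    simpa using this

/-- The plan carried by the graph of `T`. -/
lemma graph_mem_couplings (m : P2 d) {T : E d → E d} (hT : Continuous T)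
    (hb : ∃ M, ∀ x, ‖T x - x‖ ≤ M) :
    m.toMeasure.map (fun x => (x, T x)) ∈ couplings m (m.push T hT hb) := by
  have hm : Measurable fun x => (x, T x) := measurable_id.prodMk hT.measurable
  constructor
  · rw [Measure.map_map measurable_fst hm]
    exact Measure.map_id
  · rw [Measure.map_map measurable_snd hm]
    rfl

/-! ### Small displacements along gradients are uniquely optimal -/

section Displacement

variable {φ : E d → ℝ}

/-- For `φ` a test function and `s` small, `x + s∇φ(x)` is a homeomorphism. -/
lemma IsTest.exists_homeomorph (h : IsTest φ) : ∃ s₀ > 0, ∀ s : ℝ, |s| ≤ s₀ →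
    ∃ T : E d ≃ₜ E d, ∀ x, T x = x + s • gradient φ x := by
  obtain ⟨L, hL, h1, -⟩ := h.isTest_gradient.exists_taylor
  -- For such s the field s∇φ is 1/2-Lipschitz, a contraction perturbing the identity; L + 1 avoids
  -- dividing by zero.
  refine ⟨(2 * (L + 1))⁻¹, by positivity, fun s hs => ?_⟩
  have hap : ApproximatesLinearOn (fun x => x + s • gradient φ x)
      ((ContinuousLinearEquiv.refl ℝ (E d) : E d ≃L[ℝ] E d) : E d →L[ℝ] E d) Set.univ
      (1 / 2 : NNReal) := by
    intro x _ y _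
    have e : x + s • gradient φ x - (y + s • gradient φ y) -
        ((ContinuousLinearEquiv.refl ℝ (E d) : E d ≃L[ℝ] E d) : E d →L[ℝ] E d) (x - y) =
        s • (gradient φ x - gradient φ y) := by
      simp only [ContinuousLinearEquiv.coe_refl, ContinuousLinearMap.coe_id', id_eq, smul_sub]
      abel
    rw [e, norm_smul, Real.norm_eq_abs]
    calc |s| * ‖gradient φ x - gradient φ y‖
        ≤ (2 * (L + 1))⁻¹ * ((L + 1) * ‖x - y‖) := by
          gcongr
          exact (h1 y x).trans (by gcongr; linarith)
      _ = ((1 / 2 : NNReal) : ℝ) * ‖x - y‖ := by push_cast; field_simp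
  -- In dimension 0 the identity has norm 0, so that case is separate; otherwise the inverse norm is
  -- 1.
  have hc : Subsingleton (E d) ∨ (1 / 2 : NNReal) <
      ‖(((ContinuousLinearEquiv.refl ℝ (E d)).symm : E d ≃L[ℝ] E d) : E d →L[ℝ] E d)‖₊⁻¹ := by
    rcases subsingleton_or_nontrivial (E d) with hs | hs
    · exact Or.inl hs
    · right
      have : ‖(((ContinuousLinearEquiv.refl ℝ (E d)).symm : E d ≃L[ℝ] E d) : E d →L[ℝ] E d)‖₊
          = 1 := by
        simp
      rw [this]
      norm_num
  exact ⟨hap.toHomeomorph _ hc, fun x => rfl⟩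

/-- For `φ` a test function and `s` small, the plan carried by the graph of `id + s∇φ` is the
unique optimal plan between its marginals. -/
theorem IsTest.exists_unique_optimal (h : IsTest φ) : ∃ s₀ > 0, ∀ s : ℝ, |s| ≤ s₀ →
    ∀ m : P2 d, ∃ ν : P2 d,
      m.toMeasure.map (fun x => (x, x + s • gradient φ x)) ∈ optimalPlans m ν ∧
      ∀ γ ∈ optimalPlans m ν, ∀ᵐ p ∂γ, p.2 = p.1 + s • gradient φ p.1 := by
  obtain ⟨s₁, hs₁, hT⟩ := h.exists_homeomorph
  obtain ⟨L, hL, -, htay⟩ := h.exists_taylor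
  -- The second bound gives 2|s|L ≤ 1/2, so the Taylor error of 2sφ uses up at most half of ‖x -
  -- z‖².
  refine ⟨min s₁ (4 * (L + 1))⁻¹, by positivity, fun s hs m => ?_⟩
  obtain ⟨T, hT⟩ := hT s (hs.trans (min_le_left _ _))
  have hsL : 2 * |s| * L ≤ 1 / 2 := by
    have := hs.trans (min_le_right _ _)
    calc 2 * |s| * L ≤ 2 * (4 * (L + 1))⁻¹ * (L + 1) := by gcongr; linarith
      _ = 1 / 2 := by field_simp; norm_num
  have hb : ∃ M, ∀ x, ‖T x - x‖ ≤ M := by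
    obtain ⟨M, hM⟩ := h.isTest_gradient.exists_bound
    refine ⟨|s| * M, fun x => ?_⟩
    rw [hT, add_sub_cancel_left, norm_smul, Real.norm_eq_abs]
    gcongr
    exact hM x
  set ν := m.push T T.continuous hb with hν
  have hgraph := graph_mem_couplings m T.continuous hb
  have hTf : (fun x => (x, x + s • gradient φ x)) = fun x => (x, T x) := by
    funext x; rw [hT]
  -- the pointwise inequality
  have hpt : ∀ x y : E d, (1 / 2) * ‖x - T.symm y‖ ^ 2 + ‖y - T.symm y‖ ^ 2
      - 2 * s * (φ x - φ (T.symm y)) ≤ ‖y - x‖ ^ 2 := by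
    intro x y
    obtain ⟨z, rfl⟩ := T.surjective y
    rw [T.symm_apply_apply]
    have h1 := htay z x
    have hg : fderiv ℝ φ z (x - z) = inner ℝ (gradient φ z) (x - z) := by
      rw [(h.hasGradientAt z).hasFDerivAt.fderiv]
      simp
    rw [hg, Real.norm_eq_abs, abs_le] at h1
    have e1 : T z - z = s • gradient φ z := by rw [hT, add_sub_cancel_left]
    have e2 : T z - x = (T z - z) - (x - z) := by abel
    -- The cross term of the expanded square is -2s⟨∇φ(z), x - z⟩, which Taylor's formula replaces
    -- by -2s(φ(x) - φ(z)).
    rw [e2, norm_sub_sq_real (T z - z) (x - z)]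
    have e3 : inner ℝ (T z - z) (x - z) = s * inner ℝ (gradient φ z) (x - z) := by
      rw [e1, real_inner_smul_left]
    rw [e3]
    have h2 : |2 * s * (φ x - φ z - inner ℝ (gradient φ z) (x - z))| ≤
        2 * |s| * (L * ‖x - z‖ ^ 2) := by
      rw [abs_mul, abs_mul, abs_two]
      gcongr
      rw [abs_le]; exact h1
    have h3 : 2 * |s| * (L * ‖x - z‖ ^ 2) ≤ 1 / 2 * ‖x - z‖ ^ 2 := by
      rw [← mul_assoc]
      gcongr
    have := (abs_le.1 (h2.trans h3)).1
    nlinarith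
  have hgcost : ∫ p, ‖p.2 - p.1‖ ^ 2 ∂(m.toMeasure.map fun x => (x, T x)) =
      ∫ x, ‖T x - x‖ ^ 2 ∂m.toMeasure :=
    integral_map (by fun_prop) (by fun_prop)
  obtain ⟨Mφ, hMφ⟩ := h.exists_bound
  have hφi : Integrable φ m.toMeasure :=
    Integrable.of_bound h.1.continuous.aestronglyMeasurable Mφ (ae_of_all _ hMφ)
  -- Under any coupling both p.1 and T⁻¹(p.2) have law m, so the two φ integrals cancel. The excess
  -- cost over the graph plan is then at least half of ∫ |x - T⁻¹y|², which gives optimality of the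
  -- graph and, when the excess vanishes, uniqueness.
  have hkey : ∀ γ ∈ couplings m ν,
      Integrable (fun p : E d × E d => ‖p.1 - T.symm p.2‖ ^ 2) γ ∧
      (1 / 2) * ∫ p, ‖p.1 - T.symm p.2‖ ^ 2 ∂γ + ∫ x, ‖T x - x‖ ^ 2 ∂m.toMeasure ≤
        ∫ p, ‖p.2 - p.1‖ ^ 2 ∂γ := by
    intro γ hγ
    have hprob := isProbabilityMeasure_of_mem_couplings hγ
    have hf := measurePreserving_fst_of_mem_couplings hγ
    have hS : MeasurePreserving (fun p : E d × E d => T.symm p.2) γ m.toMeasure := by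
      refine ⟨T.symm.measurable.comp measurable_snd, ?_⟩
      have := hγ.2
      rw [show (fun p : E d × E d => T.symm p.2) = T.symm ∘ Prod.snd from rfl,
        ← Measure.map_map T.symm.measurable measurable_snd, this]
      change (m.toMeasure.map T).map T.symm = _
      rw [Measure.map_map T.symm.measurable T.measurable, T.symm_comp_self, Measure.map_id]
    have i1 : Integrable (fun p : E d × E d => ‖p.1 - T.symm p.2‖ ^ 2) γ :=
      ((m.memLp_id.comp_measurePreserving hf).sub
        (m.memLp_id.comp_measurePreserving hS)).integrable_norm_pow (by norm_num)
    have i2 : Integrable (fun x => ‖T x - x‖ ^ 2) m.toMeasure := by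
      obtain ⟨M, hM⟩ := hb
      refine Integrable.of_bound (by fun_prop) (M ^ 2) (ae_of_all _ fun x => ?_)
      rw [norm_pow, norm_norm]
      gcongr
      exact hM x
    have i3 : Integrable (fun p : E d × E d => ‖p.2 - T.symm p.2‖ ^ 2) γ := by
      have := hS.integrable_comp_of_integrable i2
      simpa [Function.comp_def] using this
    have i4 : Integrable (fun p : E d × E d => φ p.1) γ := hf.integrable_comp_of_integrable hφi
    have i5 : Integrable (fun p : E d × E d => φ (T.symm p.2)) γ :=
      hS.integrable_comp_of_integrable hφi
    refine ⟨i1, ?_⟩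
    have e3 : ∫ p : E d × E d, ‖p.2 - T.symm p.2‖ ^ 2 ∂γ = ∫ x, ‖T x - x‖ ^ 2 ∂m.toMeasure := by
      rw [← hS.map_eq, integral_map hS.measurable.aemeasurable (by fun_prop)]
      simp
    have e4 : ∫ p : E d × E d, φ p.1 ∂γ = ∫ x, φ x ∂m.toMeasure := by
      rw [← hf.map_eq, integral_map hf.measurable.aemeasurable
        h.1.continuous.aestronglyMeasurable]
    have e5 : ∫ p : E d × E d, φ (T.symm p.2) ∂γ = ∫ x, φ x ∂m.toMeasure := by
      rw [← hS.map_eq, integral_map hS.measurable.aemeasurable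
        h.1.continuous.aestronglyMeasurable]
    have := integral_mono (((i1.const_mul (1 / 2)).add i3).sub ((i4.sub i5).const_mul (2 * s)))
      (integrable_sq_of_mem_couplings hγ) (fun p => hpt p.1 p.2)
    rw [integral_sub' ((i1.const_mul (1 / 2)).add i3) ((i4.sub i5).const_mul (2 * s)),
      integral_add' (i1.const_mul (1 / 2)) i3, integral_const_mul, integral_const_mul,
      integral_sub' i4 i5, e3, e4, e5] at this
    linarith
  refine ⟨ν, ?_, ?_⟩
  · rw [hTf]
    refine mem_optimalPlans_of_forall_le hgraph fun γ' h' => ?_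
    rw [hgcost]
    have := (hkey γ' h').2
    have h0 : 0 ≤ ∫ p : E d × E d, ‖p.1 - T.symm p.2‖ ^ 2 ∂γ' :=
      integral_nonneg fun _ => by positivity
    linarith
  · intro γ hγ
    obtain ⟨hi, hle⟩ := hkey γ hγ.1
    have h1 := integral_le_of_mem_optimalPlans hγ hgraph
    rw [hgcost] at h1
    have h0 : 0 ≤ ∫ p : E d × E d, ‖p.1 - T.symm p.2‖ ^ 2 ∂γ :=
      integral_nonneg fun _ => by positivity
    have h2 : ∫ p : E d × E d, ‖p.1 - T.symm p.2‖ ^ 2 ∂γ = 0 := by linarith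
    rw [integral_eq_zero_iff_of_nonneg (fun _ => by positivity) hi] at h2
    filter_upwards [h2] with p hp
    have : p.1 = T.symm p.2 := by simpa [sub_eq_zero] using hp
    rw [← hT, this, T.apply_symm_apply]

end Displacement

/-! ### The tangent space -/

/-- The vector field `g` belongs to the tangent space `T_m`. -/
def IsTangent (m : P2 d) (g : E d → E d) : Prop := ∃ z ∈ tangentSpace m, z =ᵐ[m.toMeasure] g

/-- The square integrable field `ζ` is orthogonal to all gradients of test functions. -/
def IsSolenoidal (m : P2 d) (ζ : E d → E d) : Prop :=
  ∀ φ : E d → ℝ, IsTest φ → ∫ x, inner ℝ (gradient φ x) (ζ x) ∂m.toMeasure = 0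

/-- The space of gradients of test functions. -/
def testGradients (m : P2 d) : Submodule ℝ (L2 m) where
  carrier := {g | ∃ φ : E d → ℝ, IsTest φ ∧ g =ᵐ[m.toMeasure] gradient φ}
  zero_mem' := by
    refine ⟨fun _ => 0, ⟨contDiff_const, HasCompactSupport.zero⟩, ?_⟩
    filter_upwards [Lp.coeFn_zero (E d) 2 m.toMeasure] with x hx
    rw [hx]
    simp [gradient]
  add_mem' := by
    rintro g₁ g₂ ⟨φ₁, h₁, e₁⟩ ⟨φ₂, h₂, e₂⟩
    refine ⟨φ₁ + φ₂, ⟨h₁.1.add h₂.1, h₁.2.add h₂.2⟩, ?_⟩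
    filter_upwards [Lp.coeFn_add g₁ g₂, e₁, e₂] with x hx hx₁ hx₂
    rw [hx, Pi.add_apply, hx₁, hx₂, gradient, gradient, gradient, ← map_add,
      fderiv_add ((h₁.1.differentiable (by norm_num)) x) ((h₂.1.differentiable (by norm_num)) x)]
  smul_mem' := by
    rintro c g ⟨φ, h, e⟩
    refine ⟨c • φ, ⟨contDiff_const.smul h.1, h.2.smul_left (f := fun _ => c)⟩, ?_⟩
    filter_upwards [Lp.coeFn_smul c g, e] with x hx hx₁
    rw [hx, Pi.smul_apply, hx₁, gradient, gradient,
      fderiv_const_smul ((h.1.differentiable (by norm_num)) x)]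
    simp

lemma tangentSpace_eq (m : P2 d) :
    tangentSpace m = ((testGradients m).topologicalClosure : Set (L2 m)) := rfl

lemma memLp_of_bound (m : P2 d) {F : Type*} [NormedAddCommGroup F] {g : E d → F} {M : ℝ}
    (hg : AEStronglyMeasurable g m.toMeasure)
    (hb : ∀ x, ‖g x‖ ≤ M) : MemLp g 2 m.toMeasure :=
  MemLp.of_bound hg M (ae_of_all _ hb)

lemma inner_L2_eq {m : P2 d} {z ζ : L2 m} {g : E d → E d} (h : z =ᵐ[m.toMeasure] g) :
    inner ℝ z ζ = ∫ x, inner ℝ (g x) (ζ x) ∂m.toMeasure := by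
  rw [L2.inner_def]
  refine integral_congr_ae ?_
  filter_upwards [h] with x hx
  rw [hx]

lemma integrable_inner_of_memLp {X : Type*} [MeasurableSpace X] {μ : Measure X} {f g : X → E d}
    (hf : MemLp f 2 μ) (hg : MemLp g 2 μ) : Integrable (fun x => (inner ℝ (f x) (g x) : ℝ)) μ :=
  (hf.norm.integrable_mul hg.norm).mono' (hf.1.inner hg.1)
    (ae_of_all _ fun _ => norm_inner_le_norm _ _)

/-- A field is tangent iff it is orthogonal to all solenoidal fields. -/
lemma isTangent_iff {m : P2 d} {g : E d → E d} (hg : MemLp g 2 m.toMeasure) :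
    IsTangent m g ↔
      ∀ ζ : L2 m, IsSolenoidal m ζ → ∫ x, inner ℝ (g x) (ζ x) ∂m.toMeasure = 0 := by
  have hsol : ∀ ζ : L2 m, ζ ∈ (testGradients m)ᗮ ↔ IsSolenoidal m ζ := by
    intro ζ
    rw [Submodule.mem_orthogonal]
    constructor
    · intro h φ hφ
      have hm : MemLp (gradient φ) 2 m.toMeasure := by
        obtain ⟨M, hM⟩ := hφ.isTest_gradient.exists_bound
        exact memLp_of_bound m hφ.contDiff_gradient.continuous.aestronglyMeasurable hM
      rw [← inner_L2_eq hm.coeFn_toLp]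
      exact h _ ⟨φ, hφ, hm.coeFn_toLp⟩
    · rintro h z ⟨φ, hφ, hz⟩
      rw [inner_L2_eq hz]
      exact h φ hφ
  -- In a Hilbert space the closure of a subspace is its double orthogonal complement.
  have hmem : IsTangent m g ↔ hg.toLp ∈ (testGradients m)ᗮᗮ := by
    rw [Submodule.orthogonal_orthogonal_eq_closure]
    constructor
    · rintro ⟨z, hz, e⟩
      have : z = hg.toLp := Lp.ext (e.trans hg.coeFn_toLp.symm)
      rwa [tangentSpace_eq, this] at hz
    · exact fun h => ⟨_, h, hg.coeFn_toLp⟩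
  rw [hmem, Submodule.mem_orthogonal]
  refine forall_congr' fun ζ => ?_
  rw [hsol, real_inner_comm, inner_L2_eq hg.coeFn_toLp]

/-- Sums of tangent fields. -/
lemma IsTangent.add {m : P2 d} {g₁ g₂ : E d → E d} (h₁ : IsTangent m g₁) (h₂ : IsTangent m g₂) :
    IsTangent m fun x => g₁ x + g₂ x := by
  obtain ⟨z₁, hz₁, e₁⟩ := h₁
  obtain ⟨z₂, hz₂, e₂⟩ := h₂
  refine ⟨z₁ + z₂, (testGradients m).topologicalClosure.add_mem hz₁ hz₂, ?_⟩
  filter_upwards [Lp.coeFn_add z₁ z₂, e₁, e₂] with x hx hx₁ hx₂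
  rw [hx, Pi.add_apply, hx₁, hx₂]

/-- Integrals of tangent fields. -/
lemma isTangent_integral {Θ : Type*} [MeasurableSpace Θ] {μ : Measure Θ} [SFinite μ] {m : P2 d}
    {h : Θ → E d → E d} {M : Θ → ℝ} (hM : Integrable M μ)
    (hmeas : StronglyMeasurable (Function.uncurry h)) (hb : ∀ θ x, ‖h θ x‖ ≤ M θ)
    (ht : ∀ θ, IsTangent m (h θ)) : IsTangent m fun x => ∫ θ, h θ x ∂μ := by
  have hmx : ∀ x, StronglyMeasurable fun θ => h θ x := fun x =>
    hmeas.comp_measurable (measurable_id.prodMk measurable_const)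
  have hmθ : ∀ θ, StronglyMeasurable (h θ) := fun θ =>
    hmeas.comp_measurable (measurable_const.prodMk measurable_id)
  have hint : ∀ x, Integrable (fun θ => h θ x) μ := fun x =>
    hM.mono' (hmx x).aestronglyMeasurable (ae_of_all _ fun θ => hb θ x)
  have hL : MemLp (fun x => ∫ θ, h θ x ∂μ) 2 m.toMeasure := by
    refine memLp_of_bound m (M := ∫ θ, M θ ∂μ) ?_ fun x => ?_
    · exact (hmeas.integral_prod_left' (f := Function.uncurry h)).aestronglyMeasurable
    · exact norm_integral_le_of_norm_le hM (ae_of_all _ fun θ => hb θ x)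
  rw [isTangent_iff hL]
  -- Testing against a solenoidal field and using Fubini reduces the claim to each θ, with no
  -- L²-valued integral.
  intro ζ hζ
  have hζ1 : Integrable (fun x => ‖ζ x‖) m.toMeasure :=
    ((Lp.memLp ζ).integrable (by norm_num)).norm
  have hprod : Integrable (Function.uncurry fun (x : E d) (θ : Θ) => (inner ℝ (h θ x) (ζ x) : ℝ))
      (m.toMeasure.prod μ) := by
    refine (hζ1.mul_prod hM).mono' ?_ (ae_of_all _ fun p => ?_)
    · refine AEStronglyMeasurable.inner ?_ ?_
      · exact (hmeas.comp_measurable measurable_swap).aestronglyMeasurable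
      · exact (Lp.stronglyMeasurable ζ).comp_measurable measurable_fst |>.aestronglyMeasurable
    · refine (norm_inner_le_norm _ _).trans ?_
      rw [mul_comm]
      exact mul_le_mul_of_nonneg_left (hb _ _) (norm_nonneg _)
  calc ∫ x, inner ℝ (∫ θ, h θ x ∂μ) (ζ x) ∂m.toMeasure
      = ∫ x, ∫ θ, inner ℝ (h θ x) (ζ x) ∂μ ∂m.toMeasure := by
        refine integral_congr_ae (ae_of_all _ fun x => ?_)
        simp only
        rw [real_inner_comm, ← integral_inner (hint x)]
        simp_rw [real_inner_comm]
    _ = ∫ θ, ∫ x, inner ℝ (h θ x) (ζ x) ∂m.toMeasure ∂μ := integral_integral_swap hprod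
    _ = 0 := by
        refine integral_eq_zero_of_ae (ae_of_all _ fun θ => ?_)
        exact (isTangent_iff (memLp_of_bound m (hmθ θ).aestronglyMeasurable (hb θ))).1 (ht θ) ζ hζ

/-- Joint measurability is the Carathéodory property: continuity in space for fixed θ and
measurability in θ for fixed x. -/
lemma isTangent_integral_of_continuous {Θ : Type*} [MeasurableSpace Θ] {μ : Measure Θ} [SFinite μ]
    {m : P2 d} (h : Θ → E d → E d) {M : Θ → ℝ} (hM : Integrable M μ)
    (hcont : ∀ θ, Continuous (h θ)) (hmeas : ∀ x, StronglyMeasurable fun θ => h θ x)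
    (hb : ∀ θ x, ‖h θ x‖ ≤ M θ) (ht : ∀ θ, IsTangent m (h θ)) :
    IsTangent m fun x => ∫ θ, h θ x ∂μ :=
  isTangent_integral hM ((stronglyMeasurable_uncurry_of_continuous_of_stronglyMeasurable
    (u := fun x θ => h θ x) hcont hmeas).comp_measurable measurable_swap) hb ht

lemma IsTest.isTangent (m : P2 d) {φ : E d → ℝ} (h : IsTest φ) : IsTangent m (gradient φ) := by
  obtain ⟨M, hM⟩ := h.isTest_gradient.exists_bound
  have hm := memLp_of_bound m h.contDiff_gradient.continuous.aestronglyMeasurable hM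
  exact ⟨hm.toLp, subset_closure ⟨φ, h, hm.coeFn_toLp⟩, hm.coeFn_toLp⟩

/-- Gradients of bounded smooth functions with bounded derivative are tangent. -/
lemma isTangent_gradient_of_bounded (m : P2 d) {f : E d → ℝ} (hf : ContDiff ℝ ∞ f) {M : ℝ}
    (h0 : ∀ x, |f x| ≤ M) (h1 : ∀ x, ‖gradient f x‖ ≤ M) : IsTangent m (gradient f) := by
  have hM : 0 ≤ M := (abs_nonneg _).trans (h0 0)
  have hd : Differentiable ℝ f := hf.differentiable (by norm_num)
  have hgc : Continuous (gradient f) :=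
    (InnerProductSpace.toDual ℝ (E d)).symm.continuous.comp (hf.continuous_fderiv (by norm_num))
  have hL := memLp_of_bound m hgc.aestronglyMeasurable h1
  rw [isTangent_iff hL]
  intro ζ hζ
  let χ : ContDiffBump (0 : E d) := ⟨1, 2, by norm_num, by norm_num⟩
  have hχ : IsTest (χ : E d → ℝ) := ⟨χ.contDiff, χ.hasCompactSupport⟩
  obtain ⟨K, hK⟩ := hχ.isTest_gradient.exists_bound
  have hK0 : 0 ≤ K := (norm_nonneg _).trans (hK 0)
  let c : ℕ → ℝ := fun n => 1 / ((n : ℝ) + 1)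
  have hc : ∀ n, 0 < c n := fun n => by positivity
  have hc1 : ∀ n, c n ≤ 1 := fun n => by
    rw [div_le_one (by positivity)]; linarith [n.cast_nonneg (α := ℝ)]
  have hc0 : Tendsto c atTop (𝓝 0) := tendsto_one_div_add_atTop_nhds_zero_nat
  -- Cutoff at scale n + 1. The product rule gives χ∇f plus a term carrying the factor c n = 1/(n +
  -- 1), so the gradients are uniformly bounded and converge pointwise to ∇f.
  let φ : ℕ → E d → ℝ := fun n x => χ (c n • x) * f x
  have hφ : ∀ n, IsTest (φ n) := fun n =>
    ⟨(hχ.1.comp (contDiff_const_smul (c n))).mul hf,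
      (hχ.2.comp_homeomorph (Homeomorph.smulOfNeZero (c n) (hc n).ne')).mul_right⟩
  have hgr : ∀ n x, gradient (φ n) x =
      χ (c n • x) • gradient f x + (f x * c n) • gradient χ (c n • x) := by
    intro n x
    have e1 : HasFDerivAt (fun x : E d => c n • x) (c n • ContinuousLinearMap.id ℝ (E d)) x :=
      (hasFDerivAt_id x).const_smul (c n)
    have e2 := ((hχ.hasGradientAt (c n • x)).hasFDerivAt.comp x e1).mul
      (hd x).hasGradientAt.hasFDerivAt
    refine HasGradientAt.gradient (hasGradientAt_iff_hasFDerivAt.2 ?_)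
    refine e2.congr_fderiv ?_
    ext v
    simp
    ring
  have hlim : Tendsto (fun n => ∫ x, inner ℝ (gradient (φ n) x) (ζ x) ∂m.toMeasure) atTop
      (𝓝 (∫ x, inner ℝ (gradient f x) (ζ x) ∂m.toMeasure)) := by
    refine tendsto_integral_of_dominated_convergence (fun x => (M + M * K) * ‖ζ x‖) ?_ ?_ ?_ ?_
    · exact fun n => ((hφ n).contDiff_gradient.continuous.aestronglyMeasurable).inner
        (Lp.aestronglyMeasurable ζ)
    · exact ((Lp.memLp ζ).integrable (by norm_num)).norm.const_mul _
    · refine fun n => ae_of_all _ fun x => (norm_inner_le_norm _ _).trans ?_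
      refine mul_le_mul_of_nonneg_right ?_ (norm_nonneg _)
      rw [hgr]
      refine (norm_add_le _ _).trans (add_le_add ?_ ?_)
      · rw [norm_smul, Real.norm_eq_abs, abs_of_nonneg χ.nonneg]
        calc χ (c n • x) * ‖gradient f x‖ ≤ 1 * M :=
              mul_le_mul χ.le_one (h1 x) (norm_nonneg _) zero_le_one
          _ = M := one_mul M
      · rw [norm_smul, Real.norm_eq_abs, abs_mul, abs_of_pos (hc n)]
        calc |f x| * c n * ‖gradient χ (c n • x)‖ ≤ M * 1 * K := by
              gcongr
              exacts [h0 x, hc1 n, hK _]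
          _ = M * K := by ring
    · refine ae_of_all _ fun x => Tendsto.inner ?_ tendsto_const_nhds
      simp_rw [hgr]
      have hcx : Tendsto (fun n => c n • x) atTop (𝓝 0) := by
        simpa using hc0.smul_const x
      have t1 : Tendsto (fun n => χ (c n • x)) atTop (𝓝 1) := by
        have := (χ.continuous.tendsto 0).comp hcx
        rwa [χ.one_of_mem_closedBall (by simp [χ.rIn_pos.le])] at this
      have t2 : Tendsto (fun n => gradient χ (c n • x)) atTop (𝓝 (gradient χ 0)) :=
        (hχ.contDiff_gradient.continuous.tendsto 0).comp hcx
      simpa using (t1.smul_const (gradient f x)).add ((hc0.const_mul (f x)).smul t2)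
  refine tendsto_nhds_unique hlim ?_
  simp_rw [fun n => hζ (φ n) (hφ n)]
  exact tendsto_const_nhds

/-! ### Differentiability from a quadratic expansion along optimal plans -/

/-- `U` has a first order expansion at `m` along optimal plans, with derivative `g` and a
quadratic remainder. -/
def HasExpansion (U : P2 d → ℝ) (m : P2 d) (g : E d → E d) : Prop :=
  ∃ M : ℝ, ∀ ν, ∀ γ ∈ optimalPlans m ν,
    |U ν - U m - ∫ p, inner ℝ (g p.1) (p.2 - p.1) ∂γ| ≤ M * W2 m ν ^ 2

lemma eventually_nhdsW_lt (m : P2 d) {r : ℝ} (hr : 0 < r) : ∀ᶠ ν in nhdsW m, W2 m ν < r :=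
  (eventually_lt_nhds hr).comap _

lemma HasExpansion.neg {U : P2 d → ℝ} {m : P2 d} {g : E d → E d} (h : HasExpansion U m g) :
    HasExpansion (fun ν => -U ν) m (fun x => -g x) := by
  obtain ⟨M, hM⟩ := h
  refine ⟨M, fun ν γ hγ => ?_⟩
  rw [← abs_neg]
  convert hM ν γ hγ using 2
  simp only [inner_neg_left, integral_neg]
  ring

lemma integral_inner_congr {m ν : P2 d} {γ : Measure (E d × E d)} (hγ : γ ∈ couplings m ν)
    {z g : E d → E d} (h : z =ᵐ[m.toMeasure] g) :
    ∫ p, inner ℝ (z p.1) (p.2 - p.1) ∂γ = ∫ p, inner ℝ (g p.1) (p.2 - p.1) ∂γ := by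
  refine integral_congr_ae ?_
  filter_upwards [(measurePreserving_fst_of_mem_couplings hγ).quasiMeasurePreserving.ae h]
    with p hp
  rw [hp]

/-- A quadratic remainder is o(W₂), and the infimum over optimal plans is at most the value at one
of them. -/
lemma HasExpansion.isSubgradient {U : P2 d → ℝ} {m : P2 d} {g : E d → E d}
    (h : HasExpansion U m g) {z : L2 m} (hz : z =ᵐ[m.toMeasure] g) : IsSubgradient U m z := by
  obtain ⟨M, hM⟩ := h
  intro η hη
  filter_upwards [eventually_nhdsW_lt m (show 0 < η / (|M| + 1) by positivity)] with ν hν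
  obtain ⟨γ, hγ⟩ := optimalPlans_nonempty m ν
  have hW := W2_nonneg m ν
  have hval : ∀ γ ∈ optimalPlans m ν, |U ν - U m - ∫ p, inner ℝ (z p.1) (p.2 - p.1) ∂γ| ≤
      M * W2 m ν ^ 2 := fun γ hγ => by
    rw [integral_inner_congr hγ.1 hz]; exact hM ν γ hγ
  have hle : (⨅ γ : optimalPlans m ν, ∫ p, inner ℝ (z p.1) (p.2 - p.1)
      ∂(γ : Measure (E d × E d))) ≤ ∫ p, inner ℝ (z p.1) (p.2 - p.1) ∂γ := by
    -- A real infimum needs a lower bound to be meaningful; the expansion, valid for all optimal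
    -- plans, supplies it.
    refine ciInf_le ⟨U ν - U m - M * W2 m ν ^ 2, ?_⟩ (⟨γ, hγ⟩ : optimalPlans m ν)
    rintro _ ⟨γ', rfl⟩
    have := (abs_le.1 (hval γ' γ'.2)).2
    simp only
    linarith
  have h1 := (abs_le.1 (hval γ hγ)).1
  have h2 : M * W2 m ν ^ 2 ≤ η * W2 m ν := by
    rw [sq, ← mul_assoc]
    refine mul_le_mul_of_nonneg_right ?_ hW
    rw [lt_div_iff₀ (by positivity)] at hν
    nlinarith [le_abs_self M]
  linarith

lemma HasExpansion.differentiableAtW {U : P2 d → ℝ} {m : P2 d} {g : E d → E d}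
    (h : HasExpansion U m g) (hg : MemLp g 2 m.toMeasure) : DifferentiableAtW U m := by
  refine ⟨⟨hg.toLp, h.isSubgradient hg.coeFn_toLp⟩, ⟨hg.toLp, h.neg.isSubgradient ?_⟩⟩
  filter_upwards [Lp.coeFn_neg hg.toLp, hg.coeFn_toLp] with x h1 h2
  rw [h1, Pi.neg_apply, h2]

lemma abs_one_or {σ : ℝ} (h : |σ| = 1) : σ ^ 2 = 1 := by rw [← sq_abs, h, one_pow]

/-- All subgradients have the same tangential part. -/
lemma HasExpansion.inner_gradient_eq {U : P2 d → ℝ} {m : P2 d} {g : E d → E d}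
    (h : HasExpansion U m g) (hg : AEStronglyMeasurable g m.toMeasure) {ζ : L2 m}
    (hζ : IsSubgradient U m ζ) {φ : E d → ℝ} (hφ : IsTest φ) :
    ∫ x, inner ℝ (ζ x) (gradient φ x) ∂m.toMeasure =
      ∫ x, inner ℝ (g x) (gradient φ x) ∂m.toMeasure := by
  obtain ⟨M, hM⟩ := h
  obtain ⟨s₀, hs₀, hopt⟩ := hφ.exists_unique_optimal
  set N : ℝ := ∫ x, ‖gradient φ x‖ ^ 2 ∂m.toMeasure with hN
  have hN0 : 0 ≤ N := integral_nonneg fun _ => by positivity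
  set A := ∫ x, inner ℝ (ζ x) (gradient φ x) ∂m.toMeasure
  set B := ∫ x, inner ℝ (g x) (gradient φ x) ∂m.toMeasure
  have hgc := hφ.contDiff_gradient.continuous
  -- A subgradient gives only an inequality; using the displacements along ∇φ and -∇φ turns it into
  -- an equality.
  have key : ∀ σ : ℝ, |σ| = 1 → σ * (A - B) ≤ 0 := by
    intro σ hσ
    refine le_of_forall_pos_le_add fun e he => ?_
    rw [zero_add]
    set η := e / (2 * (√N + 1)) with hη
    have hη0 : 0 < η := by positivity
    have hev := hζ η hη0
    rw [nhdsW, eventually_comap] at hev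
    obtain ⟨r, hr, hball⟩ := Metric.eventually_nhds_iff.1 hev
    -- The three bounds ensure that the plan is uniquely optimal, that ν lies in the ball of radius
    -- r, and that the quadratic remainder costs at most e/2 after division by t.
    set t := min s₀ (min (r / (2 * (√N + 1))) (e / (2 * (|M| * N + 1)))) with ht
    have ht0 : 0 < t := by positivity
    obtain ⟨ν, hγ, huniq⟩ := hopt (σ * t) (by
      rw [abs_mul, hσ, one_mul, abs_of_pos ht0]; exact min_le_left _ _) m
    set γ₀ := m.toMeasure.map fun x => (x, x + (σ * t) • gradient φ x)
    have hmap : ∀ {F : E d × E d → ℝ}, AEStronglyMeasurable F γ₀ → ∫ p, F p ∂γ₀ =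
        ∫ x, F (x, x + (σ * t) • gradient φ x) ∂m.toMeasure := fun {F} hF => by
      rw [integral_map (by fun_prop) hF]
    have hW2 : W2 m ν ^ 2 = t ^ 2 * N := by
      rw [← integral_sq_of_mem_optimalPlans hγ, hmap (by fun_prop), hN, ← integral_const_mul]
      refine integral_congr_ae (ae_of_all _ fun x => ?_)
      simp only [add_sub_cancel_left, norm_smul, Real.norm_eq_abs, mul_pow, sq_abs,
        abs_one_or hσ, one_mul]
    have hW : W2 m ν = t * √N := by
      rw [← Real.sqrt_sq (W2_nonneg m ν), hW2, Real.sqrt_mul (by positivity),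
        Real.sqrt_sq ht0.le]
    have hplan : ∀ γ ∈ optimalPlans m ν, ∀ ψ : E d → E d, AEStronglyMeasurable ψ m.toMeasure →
        ∫ p, inner ℝ (ψ p.1) (p.2 - p.1) ∂γ =
          σ * t * ∫ x, inner ℝ (ψ x) (gradient φ x) ∂m.toMeasure := by
      intro γ hγ ψ hψ
      have hfst := measurePreserving_fst_of_mem_couplings hγ.1
      calc ∫ p, inner ℝ (ψ p.1) (p.2 - p.1) ∂γ
          = ∫ p : E d × E d, (fun x => σ * t * inner ℝ (ψ x) (gradient φ x)) p.1 ∂γ := by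
            refine integral_congr_ae ?_
            filter_upwards [huniq γ hγ] with p hp
            rw [hp, add_sub_cancel_left, real_inner_smul_right]
        _ = ∫ x, σ * t * inner ℝ (ψ x) (gradient φ x) ∂m.toMeasure := by
            rw [← hfst.map_eq, integral_map measurable_fst.aemeasurable]
            rw [hfst.map_eq]
            exact (hψ.inner hgc.aestronglyMeasurable).const_mul _
        _ = _ := integral_const_mul _ _
    have hgζ : AEStronglyMeasurable ζ m.toMeasure := Lp.aestronglyMeasurable ζ
    have hlow : σ * t * A - η * W2 m ν ≤ U ν - U m := by
      refine le_trans ?_ (hball (y := W2 m ν) ?_ ν rfl)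
      · refine sub_le_sub_right ?_ _
        -- By uniqueness the integral is the same for all optimal plans, so the infimum in the
        -- subgradient inequality is this common value.
        have : Nonempty (optimalPlans m ν) := ⟨⟨_, hγ⟩⟩
        exact le_ciInf fun γ => (hplan γ γ.2 ζ hgζ).ge
      · rw [Real.dist_eq, sub_zero, abs_of_nonneg (W2_nonneg m ν), hW]
        have : t ≤ r / (2 * (√N + 1)) := (min_le_right _ _).trans (min_le_left _ _)
        calc t * √N ≤ r / (2 * (√N + 1)) * (√N + 1) := by gcongr; linarith
          _ = r / 2 := by field_simp
          _ < r := by linarith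
    have hup : U ν - U m ≤ σ * t * B + M * (t ^ 2 * N) := by
      have := (abs_le.1 (hM ν γ₀ hγ)).2
      rw [hW2, hplan γ₀ hγ g hg] at this
      linarith
    have h1 : σ * t * (A - B) ≤ t * (η * √N + |M| * N * t) := by
      have : M * (t ^ 2 * N) ≤ |M| * (t ^ 2 * N) := by gcongr; exact le_abs_self M
      rw [hW] at hlow
      nlinarith
    have h2 : σ * (A - B) ≤ η * √N + |M| * N * t := by
      refine le_of_mul_le_mul_left ?_ ht0
      linarith
    have h3 : η * √N ≤ e / 2 := by
      calc η * √N ≤ e / (2 * (√N + 1)) * (√N + 1) := by gcongr; linarith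
        _ = e / 2 := by field_simp
    have h4 : |M| * N * t ≤ e / 2 := by
      have : t ≤ e / (2 * (|M| * N + 1)) := (min_le_right _ _).trans (min_le_right _ _)
      calc |M| * N * t ≤ (|M| * N + 1) * (e / (2 * (|M| * N + 1))) := by gcongr; linarith
        _ = e / 2 := by field_simp
    linarith
  have k1 := key 1 abs_one
  have k2 := key (-1) (by simp)
  linarith

/-- A tangent field giving a quadratic expansion is the Wasserstein gradient. -/
theorem HasExpansion.isGradientW {U : P2 d → ℝ} {m : P2 d} {g : E d → E d}
    (h : HasExpansion U m g) (hg : IsTangent m g) {z : L2 m} (hz : z =ᵐ[m.toMeasure] g) :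
    IsGradientW U m z := by
  refine ⟨h.isSubgradient hz, fun ζ hζ => ?_⟩
  have hgm : MemLp g 2 m.toMeasure := (Lp.memLp z).ae_eq hz
  have hsol : IsSolenoidal m (ζ - z : L2 m) := by
    intro φ hφ
    obtain ⟨M, hM⟩ := hφ.isTest_gradient.exists_bound
    have hm := memLp_of_bound m hφ.contDiff_gradient.continuous.aestronglyMeasurable hM
    have h1 := h.inner_gradient_eq hgm.1 hζ hφ
    calc ∫ x, inner ℝ (gradient φ x) ((ζ - z : L2 m) x) ∂m.toMeasure
        = ∫ x, inner ℝ (ζ x) (gradient φ x) - inner ℝ (g x) (gradient φ x) ∂m.toMeasure := by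
          refine integral_congr_ae ?_
          filter_upwards [Lp.coeFn_sub ζ z, hz] with x hx hx'
          rw [hx, Pi.sub_apply, inner_sub_right, hx', real_inner_comm, real_inner_comm (g x)]
      _ = 0 := by
          rw [integral_sub (integrable_inner_of_memLp (Lp.memLp ζ) hm)
            (integrable_inner_of_memLp hgm hm), h1,
            sub_self]
  -- Orthogonality gives ⟨z, ζ⟩ = ‖z‖², and Cauchy–Schwarz then yields ‖z‖ ≤ ‖ζ‖.
  have h0 := (isTangent_iff hgm).1 hg _ hsol
  rw [← inner_L2_eq hz, inner_sub_right, sub_eq_zero, real_inner_self_eq_norm_sq] at h0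
  have := real_inner_le_norm z ζ
  rw [h0] at this
  by_cases hz0 : ‖z‖ = 0
  · rw [hz0]; exact norm_nonneg _
  · exact le_of_mul_le_mul_left (by nlinarith) (lt_of_le_of_ne (norm_nonneg z) (Ne.symm hz0))

/-! ### Functionals with uniform second order expansions -/

lemma W2_self (m : P2 d) : W2 m m = 0 := by
  have h : m.toMeasure.map (fun x => (x, x)) ∈ couplings m m := by
    constructor <;> rw [Measure.map_map (by fun_prop) (by fun_prop)] <;> exact Measure.map_id
  have := W2_sq_le_of_mem_couplings h
  rw [integral_map (by fun_prop) (by fun_prop)] at this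
  simpa using le_antisymm (by simpa using this) (sq_nonneg (W2 m m))

lemma tendsto_W2_nhdsW (m : P2 d) : Tendsto (fun ν => W2 m ν) (nhdsW m) (𝓝 0) := tendsto_comap

/-- `G`, `B`, `C` are the first and second derivatives of `U`, bounded and Lipschitz on the whole
Wasserstein space, and the expansions of `U` and of `G` have uniform quadratic remainders. -/
structure HasUniformDerivs (U : P2 d → ℝ) (G : P2 d → E d → E d)
    (B : P2 d → E d → E d →L[ℝ] E d) (C : P2 d → E d → E d → E d →L[ℝ] E d) (M : ℝ) : Prop where
  norm_G_le : ∀ m x, ‖G m x‖ ≤ M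
  norm_B_le : ∀ m x, ‖B m x‖ ≤ M
  norm_C_le : ∀ m x a, ‖C m x a‖ ≤ M
  lipschitz_G : ∀ m ν x y, ‖G ν y - G m x‖ ≤ M * (‖y - x‖ + W2 m ν)
  lipschitz_B : ∀ m ν x y, ‖B ν y - B m x‖ ≤ M * (‖y - x‖ + W2 m ν)
  lipschitz_C : ∀ m ν x y a b, ‖C ν y b - C m x a‖ ≤ M * (‖y - x‖ + ‖b - a‖ + W2 m ν)
  expansion_U : ∀ m ν, ∀ γ ∈ optimalPlans m ν,
    |U ν - U m - ∫ p, inner ℝ (G m p.1) (p.2 - p.1) ∂γ| ≤ M * W2 m ν ^ 2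
  expansion_G : ∀ m ν, ∀ γ ∈ optimalPlans m ν, ∀ x y,
    ‖G ν y - G m x - linearPart (B m) (C m) γ x y‖ ≤ M * (‖y - x‖ ^ 2 + W2 m ν ^ 2)
  tangent_G : ∀ m, IsTangent m (G m)
  tangent_C : ∀ m x v, IsTangent m fun a => ContinuousLinearMap.adjoint (C m x a) v
  -- When B is the space derivative of G, this field is the gradient of a ↦ ⟨G(a), ζ(a)⟩, the local
  -- part of the gradient of ζ·(U).
  tangent_inner_G : ∀ m (ζ : E d → E d), IsTest ζ → IsTangent m fun a =>
    ContinuousLinearMap.adjoint (B m a) (ζ a) + ContinuousLinearMap.adjoint (fderiv ℝ ζ a) (G m a)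

namespace HasUniformDerivs

variable {U : P2 d → ℝ} {G : P2 d → E d → E d} {B : P2 d → E d → E d →L[ℝ] E d}
  {C : P2 d → E d → E d → E d →L[ℝ] E d} {M : ℝ}

lemma nonneg (h : HasUniformDerivs U G B C M) (m : P2 d) : 0 ≤ M :=
  (norm_nonneg _).trans (h.norm_G_le m 0)

lemma continuous_of_lipschitz {X Y : Type*} [SeminormedAddCommGroup X] [SeminormedAddCommGroup Y]
    {f : X → Y} {K : ℝ} (h : ∀ x y, ‖f y - f x‖ ≤ K * ‖y - x‖) : Continuous f := by
  refine (LipschitzWith.of_dist_le_mul (K := K.toNNReal) fun x y => ?_).continuous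
  rw [dist_eq_norm, dist_eq_norm]
  refine (h y x).trans ?_
  gcongr
  exact Real.le_coe_toNNReal K

lemma continuous_G (h : HasUniformDerivs U G B C M) (m : P2 d) : Continuous (G m) :=
  continuous_of_lipschitz (K := M) fun x y => by simpa [W2_self] using h.lipschitz_G m m x y

lemma continuous_B (h : HasUniformDerivs U G B C M) (m : P2 d) : Continuous (B m) :=
  continuous_of_lipschitz (K := M) fun x y => by simpa [W2_self] using h.lipschitz_B m m x y

lemma continuous_C (h : HasUniformDerivs U G B C M) (m : P2 d) :
    Continuous fun p : E d × E d => C m p.1 p.2 :=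
  continuous_of_lipschitz (K := M * 2) fun p q => by
    refine (h.lipschitz_C m m p.1 q.1 p.2 q.2).trans ?_
    rw [W2_self, add_zero, mul_assoc]
    refine mul_le_mul_of_nonneg_left ?_ (h.nonneg m)
    have h1 : ‖q.1 - p.1‖ ≤ ‖q - p‖ := norm_fst_le (q - p)
    have h2 : ‖q.2 - p.2‖ ≤ ‖q - p‖ := norm_snd_le (q - p)
    linarith

lemma memLp_G (h : HasUniformDerivs U G B C M) (m : P2 d) : MemLp (G m) 2 m.toMeasure :=
  memLp_of_bound m (h.continuous_G m).aestronglyMeasurable (h.norm_G_le m)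

lemma hasExpansion (h : HasUniformDerivs U G B C M) (m : P2 d) : HasExpansion U m (G m) :=
  ⟨M, h.expansion_U m⟩

/-- Functionals with uniform second order expansions are twice differentiable. -/
theorem isTwiceDifferentiableAt (h : HasUniformDerivs U G B C M) (m : P2 d) :
    IsTwiceDifferentiableAt U m G (B m) (C m) where
  differentiable := Eventually.of_forall fun ν =>
    (h.hasExpansion ν).differentiableAtW (h.memLp_G ν)
  gradient_eq := Eventually.of_forall fun ν =>
    ⟨(h.memLp_G ν).toLp, (h.hasExpansion ν).isGradientW (h.tangent_G ν) (h.memLp_G ν).coeFn_toLp,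
      (h.memLp_G ν).coeFn_toLp⟩
  gradient_continuous := Eventually.of_forall h.continuous_G
  gradient_growth := ⟨M, Eventually.of_forall fun ν x => (h.norm_G_le ν x).trans
    (le_mul_of_one_le_right (h.nonneg m) (by linarith [norm_nonneg x]))⟩
  measurable_B := (h.continuous_B m).measurable
  bounded_B := ⟨M, h.norm_B_le m⟩
  measurable_C := (h.continuous_C m).measurable
  bounded_C := ⟨M, h.norm_C_le m⟩
  rows_tangent := h.tangent_C m
  expansion := by
    have hM := h.nonneg m
    -- A quadratic remainder allows linear moduli; the absolute value is there because ε₂ must be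
    -- nonnegative at every real argument.
    refine ⟨fun r => M * r, fun r => M * |r|, ⟨by simp, fun r hr => mul_nonneg hM hr, by fun_prop,
      fun r _ r' _ hr => mul_le_mul_of_nonneg_left hr hM, fun r r' _ _ => (mul_add M r r').le,
      (LinearMap.mulLeft ℝ M).concaveOn (convex_Ici 0)⟩, fun r => by positivity, ?_,
      fun ν γ hγ x y => ?_⟩
    · have : Tendsto (fun r : ℝ => M * |r|) (𝓝 0) (𝓝 (M * |0|)) :=
        (by fun_prop : Continuous fun r : ℝ => M * |r|).tendsto 0
      rw [abs_zero, mul_zero] at this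
      exact this.mono_left nhdsWithin_le_nhds
    · refine (h.expansion_G m ν γ hγ x y).trans (le_of_eq ?_)
      beta_reduce
      rw [abs_of_nonneg (W2_nonneg m ν), norm_sub_rev x y]
      ring

/-- Functionals with uniform second order expansions are of class `C²`. -/
theorem isC2 (h : HasUniformDerivs U G B C M) : IsC2 U := by
  refine ⟨G, B, C, h.isTwiceDifferentiableAt, fun m x => ?_, fun m x a => ?_⟩
  · rw [tendsto_iff_norm_sub_tendsto_zero]
    refine squeeze_zero (fun _ => norm_nonneg _)
      (fun q : P2 d × E d => h.lipschitz_B m q.1 x q.2) ?_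
    have h1 : Tendsto (fun q : P2 d × E d => W2 m q.1) (nhdsW m ×ˢ 𝓝 x) (𝓝 0) :=
      (tendsto_W2_nhdsW m).comp tendsto_fst
    have h2 : Tendsto (fun q : P2 d × E d => ‖q.2 - x‖) (nhdsW m ×ˢ 𝓝 x) (𝓝 0) :=
      (tendsto_iff_norm_sub_tendsto_zero.1 (tendsto_id (x := 𝓝 x))).comp tendsto_snd
    simpa using (h2.add h1).const_mul M
  · rw [tendsto_iff_norm_sub_tendsto_zero]
    refine squeeze_zero (fun _ => norm_nonneg _)
      (fun q : P2 d × (E d × E d) => h.lipschitz_C m q.1 x q.2.1 a q.2.2) ?_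
    have h1 : Tendsto (fun q : P2 d × (E d × E d) => W2 m q.1) (nhdsW m ×ˢ (𝓝 x ×ˢ 𝓝 a)) (𝓝 0) :=
      (tendsto_W2_nhdsW m).comp tendsto_fst
    have h2 : Tendsto (fun q : P2 d × (E d × E d) => ‖q.2.1 - x‖)
        (nhdsW m ×ˢ (𝓝 x ×ˢ 𝓝 a)) (𝓝 0) :=
      (tendsto_iff_norm_sub_tendsto_zero.1 (tendsto_id (x := 𝓝 x))).comp
        (tendsto_fst.comp tendsto_snd)
    have h3 : Tendsto (fun q : P2 d × (E d × E d) => ‖q.2.2 - a‖)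
        (nhdsW m ×ˢ (𝓝 x ×ˢ 𝓝 a)) (𝓝 0) :=
      (tendsto_iff_norm_sub_tendsto_zero.1 (tendsto_id (x := 𝓝 a))).comp
        (tendsto_snd.comp tendsto_snd)
    simpa using ((h2.add h3).add h1).const_mul M

/-! ### The Hessian -/

/-- The Wasserstein gradient of `ν ↦ ζ · (U[ν])`. -/
def dirGradient (m : P2 d) (G : P2 d → E d → E d) (B : P2 d → E d → E d →L[ℝ] E d)
    (C : P2 d → E d → E d → E d →L[ℝ] E d) (ζ : E d → E d) (a : E d) : E d :=
  (ContinuousLinearMap.adjoint (B m a) (ζ a) + ContinuousLinearMap.adjoint (fderiv ℝ ζ a) (G m a)) +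
    ∫ x, ContinuousLinearMap.adjoint (C m x a) (ζ x) ∂m.toMeasure

lemma continuous_adjoint_C (h : HasUniformDerivs U G B C M) (m : P2 d) {ζ : E d → E d}
    (hζ : Continuous ζ) :
    Continuous fun p : E d × E d => ContinuousLinearMap.adjoint (C m p.1 p.2) (ζ p.1) :=
  (ContinuousLinearMap.adjoint.continuous.comp (h.continuous_C m)).clm_apply
    (hζ.comp continuous_fst)

lemma norm_adjoint_C_le (h : HasUniformDerivs U G B C M) (m : P2 d) (x a v : E d) :
    ‖ContinuousLinearMap.adjoint (C m x a) v‖ ≤ M * ‖v‖ := by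
  refine ((ContinuousLinearMap.adjoint (C m x a)).le_opNorm v).trans ?_
  rw [LinearIsometryEquiv.norm_map]
  exact mul_le_mul_of_nonneg_right (h.norm_C_le m x a) (norm_nonneg _)

/-- The local part is tangent by `tangent_inner_G`; the nonlocal part is an average of rows of C,
tangent by `tangent_C`. -/
lemma isTangent_dirGradient (h : HasUniformDerivs U G B C M) (m : P2 d) {ζ : E d → E d}
    (hζ : IsTest ζ) : IsTangent m (dirGradient m G B C ζ) := by
  obtain ⟨K, hK⟩ := hζ.exists_bound
  refine (h.tangent_inner_G m ζ hζ).add ?_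
  refine isTangent_integral (M := fun _ => M * K) (integrable_const _)
    (h.continuous_adjoint_C m hζ.1.continuous).stronglyMeasurable (fun x a => ?_)
    (fun x => h.tangent_C m x (ζ x))
  exact (h.norm_adjoint_C_le m x a _).trans
    (mul_le_mul_of_nonneg_left (hK x) (h.nonneg m))

lemma memLp_dirGradient (h : HasUniformDerivs U G B C M) (m : P2 d) {ζ : E d → E d}
    (hζ : IsTest ζ) : MemLp (dirGradient m G B C ζ) 2 m.toMeasure := by
  obtain ⟨z, -, hz⟩ := h.isTangent_dirGradient m hζ
  exact (Lp.memLp z).ae_eq hz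

/-- The inner product of `dirGradient` with a vector. -/
lemma inner_dirGradient (h : HasUniformDerivs U G B C M) (m : P2 d) {ζ : E d → E d}
    (hζ : IsTest ζ) (a v : E d) : inner ℝ (dirGradient m G B C ζ a) v =
      inner ℝ (ζ a) (B m a v) + inner ℝ (G m a) (fderiv ℝ ζ a v) +
        ∫ x, inner ℝ (ζ x) (C m x a v) ∂m.toMeasure := by
  obtain ⟨K, hK⟩ := hζ.exists_bound
  have hi : Integrable (fun x => ContinuousLinearMap.adjoint (C m x a) (ζ x)) m.toMeasure := by
    refine Integrable.of_bound (C := M * K) ?_ (ae_of_all _ fun x => ?_)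
    · exact ((h.continuous_adjoint_C m hζ.1.continuous).comp
        (continuous_id.prodMk continuous_const)).aestronglyMeasurable
    · exact (h.norm_adjoint_C_le m x a _).trans (mul_le_mul_of_nonneg_left (hK x) (h.nonneg m))
  rw [dirGradient, inner_add_left, inner_add_left, ContinuousLinearMap.adjoint_inner_left,
    ContinuousLinearMap.adjoint_inner_left, real_inner_comm v (∫ x, _ ∂_), ← integral_inner hi]
  congr 1
  refine integral_congr_ae (ae_of_all _ fun x => ?_)
  simp only
  rw [real_inner_comm, ContinuousLinearMap.adjoint_inner_left]

/-- The factor 2 arises because both ∫ |y - x|² dγ, by optimality, and the constant term equal W₂².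
-/
lemma integral_W2_le {m ν : P2 d} {γ : Measure (E d × E d)} (hγ : γ ∈ optimalPlans m ν)
    {f : E d × E d → ℝ} {K : ℝ} (hf : ∀ p, |f p| ≤ K * (‖p.2 - p.1‖ ^ 2 + W2 m ν ^ 2)) :
    |∫ p, f p ∂γ| ≤ 2 * K * W2 m ν ^ 2 := by
  have := isProbabilityMeasure_of_mem_couplings hγ.1
  have hi := integrable_sq_of_mem_couplings hγ.1
  have hi' : Integrable (fun p : E d × E d => K * (‖p.2 - p.1‖ ^ 2 + W2 m ν ^ 2)) γ :=
    (hi.add (integrable_const _)).const_mul K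
  refine (norm_integral_le_of_norm_le hi' (ae_of_all _ fun p => (Real.norm_eq_abs _).le.trans (hf p))).trans (le_of_eq ?_)
  rw [integral_const_mul, integral_add hi (integrable_const _),
    integral_sq_of_mem_optimalPlans hγ]
  simp
  ring

lemma integrable_norm_sub {m ν : P2 d} {γ : Measure (E d × E d)} (hγ : γ ∈ couplings m ν) :
    Integrable (fun p : E d × E d => ‖p.2 - p.1‖) γ := by
  have := isProbabilityMeasure_of_mem_couplings hγ
  exact ((memLp_sub_of_mem_couplings hγ).integrable (by norm_num)).norm

/-- The expansion of `ν ↦ ζ · (U[ν])`. -/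
theorem hasExpansion_dirDeriv (h : HasUniformDerivs U G B C M) (m : P2 d) {ζ : E d → E d}
    (hζ : IsTest ζ) : HasExpansion (dirDeriv G ζ) m (dirGradient m G B C ζ) := by
  obtain ⟨K, hK⟩ := hζ.exists_bound
  obtain ⟨K', hK'⟩ := hζ.isTest_fderiv.exists_bound
  obtain ⟨L, hL, hLip, hTay⟩ := hζ.exists_taylor
  have hM := h.nonneg m
  have hK0 : 0 ≤ K := (norm_nonneg _).trans (hK 0)
  have hζc := hζ.1.continuous
  have hζ' : Continuous (fderiv ℝ ζ) := hζ.isTest_fderiv.1.continuous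
  have hCc := h.continuous_C m
  have hBc := h.continuous_B m
  have hGc := h.continuous_G
  -- The three summands bound the three terms of the Leibniz decomposition `hdec`; the leading 2
  -- comes from `integral_W2_le`.
  refine ⟨2 * (K * M + M * L + 2 * M * L), fun ν γ hγ => ?_⟩
  have hprob := isProbabilityMeasure_of_mem_couplings hγ.1
  have hfst := measurePreserving_fst_of_mem_couplings hγ.1
  have hsnd := measurePreserving_snd_of_mem_couplings hγ.1
  have hi1 := integrable_norm_sub hγ.1
  set W := W2 m ν with hW
  have hW0 : 0 ≤ W := W2_nonneg m ν
  let J : E d → E d := fun x => ∫ p : E d × E d, C m x p.1 (p.2 - p.1) ∂γ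
  have hCcont : Continuous fun q : E d × (E d × E d) => C m q.1 q.2.1 (q.2.2 - q.2.1) :=
    (hCc.comp (continuous_fst.prodMk (continuous_fst.comp continuous_snd))).clm_apply
      (by fun_prop)
  have hCbound : ∀ (x : E d) (p : E d × E d), ‖C m x p.1 (p.2 - p.1)‖ ≤ M * ‖p.2 - p.1‖ :=
    fun x p => ((C m x p.1).le_opNorm _).trans
      (mul_le_mul_of_nonneg_right (h.norm_C_le m x p.1) (norm_nonneg _))
  have hJi : ∀ x, Integrable (fun p : E d × E d => C m x p.1 (p.2 - p.1)) γ := fun x =>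
    (hi1.const_mul M).mono'
      (hCcont.comp (continuous_const.prodMk continuous_id)).aestronglyMeasurable
      (ae_of_all _ (hCbound x))
  have hJm : StronglyMeasurable J :=
    hCcont.stronglyMeasurable.integral_prod_right (f := fun x (p : E d × E d) => C m x p.1 (p.2 - p.1))
  have hJb : ∀ x, ‖J x‖ ≤ M * ∫ p : E d × E d, ‖p.2 - p.1‖ ∂γ := fun x => by
    rw [← integral_const_mul]
    exact norm_integral_le_of_norm_le (hi1.const_mul M) (ae_of_all _ (hCbound x))
  -- the terms of the expansion
  have j1 : Integrable (fun p : E d × E d => (inner ℝ (G ν p.2) (ζ p.2) : ℝ)) γ := by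
    refine Integrable.of_bound (C := M * K) ((hGc ν).comp continuous_snd |>.inner
      (hζc.comp continuous_snd)).aestronglyMeasurable (ae_of_all _ fun p => ?_)
    exact (norm_inner_le_norm _ _).trans (mul_le_mul (h.norm_G_le _ _) (hK _) (norm_nonneg _) hM)
  have j2 : Integrable (fun p : E d × E d => (inner ℝ (G m p.1) (ζ p.1) : ℝ)) γ := by
    refine Integrable.of_bound (C := M * K) ((hGc m).comp continuous_fst |>.inner
      (hζc.comp continuous_fst)).aestronglyMeasurable (ae_of_all _ fun p => ?_)
    exact (norm_inner_le_norm _ _).trans (mul_le_mul (h.norm_G_le _ _) (hK _) (norm_nonneg _) hM)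
  have j3 : Integrable (fun p : E d × E d => (inner ℝ (ζ p.1) (B m p.1 (p.2 - p.1)) : ℝ)) γ := by
    refine (hi1.const_mul (K * M)).mono' (Continuous.aestronglyMeasurable (by fun_prop))
      (ae_of_all _ fun p => (norm_inner_le_norm _ _).trans ?_)
    rw [mul_assoc]
    exact mul_le_mul (hK _) (((B m p.1).le_opNorm _).trans
      (mul_le_mul_of_nonneg_right (h.norm_B_le m _) (norm_nonneg _))) (norm_nonneg _) hK0
  have j4 : Integrable
      (fun p : E d × E d => (inner ℝ (G m p.1) (fderiv ℝ ζ p.1 (p.2 - p.1)) : ℝ)) γ := by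
    refine (hi1.const_mul (M * K')).mono'
      (Continuous.aestronglyMeasurable (((hGc m).comp continuous_fst).inner
        ((hζ'.comp continuous_fst).clm_apply (by fun_prop))))
      (ae_of_all _ fun p => (norm_inner_le_norm _ _).trans ?_)
    rw [mul_assoc]
    exact mul_le_mul (h.norm_G_le _ _) (((fderiv ℝ ζ p.1).le_opNorm _).trans
      (mul_le_mul_of_nonneg_right (hK' _) (norm_nonneg _))) (norm_nonneg _) hM
  have j5m : Integrable (fun x => (inner ℝ (ζ x) (J x) : ℝ)) m.toMeasure := by
    refine Integrable.of_bound (C := K * (M * ∫ p : E d × E d, ‖p.2 - p.1‖ ∂γ))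
      (hζc.aestronglyMeasurable.inner hJm.aestronglyMeasurable) (ae_of_all _ fun x => ?_)
    exact (norm_inner_le_norm _ _).trans (mul_le_mul (hK _) (hJb _) (norm_nonneg _) hK0)
  have j5 : Integrable (fun p : E d × E d => (inner ℝ (ζ p.1) (J p.1) : ℝ)) γ :=
    hfst.integrable_comp_of_integrable j5m
  have hprod : Integrable (Function.uncurry fun (p : E d × E d) (x : E d) =>
      (inner ℝ (ζ x) (C m x p.1 (p.2 - p.1)) : ℝ)) (γ.prod m.toMeasure) := by
    refine ((hi1.mul_prod (integrable_const (K * M) : Integrable _ m.toMeasure))).mono' ?_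
      (ae_of_all _ fun q => ?_)
    · exact ((hζc.comp continuous_snd).inner
        (hCcont.comp (continuous_snd.prodMk continuous_fst))).aestronglyMeasurable
    · refine (norm_inner_le_norm _ _).trans ?_
      refine (mul_le_mul (hK _) (hCbound _ _) (norm_nonneg _) hK0).trans (le_of_eq ?_)
      ring
  -- Fubini moves the plan integral inside, and the free point x of law m is read as the first
  -- coordinate under γ.
  have e5 : ∫ p, ∫ x, (inner ℝ (ζ x) (C m x p.1 (p.2 - p.1)) : ℝ) ∂m.toMeasure ∂γ =
      ∫ p : E d × E d, inner ℝ (ζ p.1) (J p.1) ∂γ := by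
    rw [integral_integral_swap hprod]
    have : ∫ p : E d × E d, (inner ℝ (ζ p.1) (J p.1) : ℝ) ∂γ =
        ∫ x, inner ℝ (ζ x) (J x) ∂m.toMeasure := by
      rw [← hfst.map_eq, integral_map hfst.measurable.aemeasurable]
      exact hζc.aestronglyMeasurable.inner hJm.aestronglyMeasurable
    rw [this]
    exact integral_congr_ae (ae_of_all _ fun x => integral_inner (hJi x) (ζ x))
  have j6 : Integrable (fun p : E d × E d =>
      ∫ x, (inner ℝ (ζ x) (C m x p.1 (p.2 - p.1)) : ℝ) ∂m.toMeasure) γ := hprod.integral_prod_left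
  have eD1 : dirDeriv G ζ ν = ∫ p : E d × E d, inner ℝ (G ν p.2) (ζ p.2) ∂γ := by
    rw [dirDeriv, ← hsnd.map_eq, integral_map hsnd.measurable.aemeasurable]
    exact ((hGc ν).inner hζc).aestronglyMeasurable
  have eD2 : dirDeriv G ζ m = ∫ p : E d × E d, inner ℝ (G m p.1) (ζ p.1) ∂γ := by
    rw [dirDeriv, ← hfst.map_eq, integral_map hfst.measurable.aemeasurable]
    exact ((hGc m).inner hζc).aestronglyMeasurable
  have j34 : Integrable (fun p : E d × E d => (inner ℝ (ζ p.1) (B m p.1 (p.2 - p.1)) : ℝ) +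
      inner ℝ (G m p.1) (fderiv ℝ ζ p.1 (p.2 - p.1))) γ := j3.add j4
  have eq : ∫ p : E d × E d, inner ℝ (dirGradient m G B C ζ p.1) (p.2 - p.1) ∂γ =
      ∫ p : E d × E d, (inner ℝ (ζ p.1) (B m p.1 (p.2 - p.1)) : ℝ) ∂γ +
      ∫ p : E d × E d, (inner ℝ (G m p.1) (fderiv ℝ ζ p.1 (p.2 - p.1)) : ℝ) ∂γ +
      ∫ p : E d × E d, (inner ℝ (ζ p.1) (J p.1) : ℝ) ∂γ := by
    simp_rw [h.inner_dirGradient m hζ]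
    rw [← e5, ← integral_add j3 j4, ← integral_add j34 j6]
  have etot : dirDeriv G ζ ν - dirDeriv G ζ m -
      ∫ p, inner ℝ (dirGradient m G B C ζ p.1) (p.2 - p.1) ∂γ =
      ∫ p : E d × E d, (inner ℝ (G ν p.2) (ζ p.2) - inner ℝ (G m p.1) (ζ p.1) -
        (inner ℝ (ζ p.1) (B m p.1 (p.2 - p.1)) + inner ℝ (G m p.1) (fderiv ℝ ζ p.1 (p.2 - p.1)) +
          inner ℝ (ζ p.1) (J p.1)) : ℝ) ∂γ := by
    have j12 : Integrable (fun p : E d × E d =>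
        (inner ℝ (G ν p.2) (ζ p.2) : ℝ) - inner ℝ (G m p.1) (ζ p.1)) γ := j1.sub j2
    have j345 : Integrable (fun p : E d × E d => (inner ℝ (ζ p.1) (B m p.1 (p.2 - p.1)) : ℝ) +
        inner ℝ (G m p.1) (fderiv ℝ ζ p.1 (p.2 - p.1)) + inner ℝ (ζ p.1) (J p.1)) γ := j34.add j5
    rw [eD1, eD2, eq, ← integral_sub j1 j2, ← integral_add j3 j4, ← integral_add j34 j5,
      ← integral_sub j12 j345]
  rw [etot]
  refine integral_W2_le hγ fun p => ?_
  obtain ⟨x, y⟩ := p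
  simp only
  -- Discrete Leibniz rule: the remainder of G against ζ, G against the remainder of ζ, and the
  -- product of the two increments.
  have hdec : (inner ℝ (G ν y) (ζ y) - inner ℝ (G m x) (ζ x) -
      (inner ℝ (ζ x) (B m x (y - x)) + inner ℝ (G m x) (fderiv ℝ ζ x (y - x)) +
        inner ℝ (ζ x) (J x)) : ℝ) =
      inner ℝ (G ν y - G m x - linearPart (B m) (C m) γ x y) (ζ x) +
      inner ℝ (G m x) (ζ y - ζ x - fderiv ℝ ζ x (y - x)) +
      inner ℝ (G ν y - G m x) (ζ y - ζ x) := by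
    change _ = inner ℝ (G ν y - G m x - (B m x (y - x) + J x)) (ζ x) + _ + _
    simp only [inner_sub_left, inner_sub_right, inner_add_left]
    rw [real_inner_comm (ζ x) (B m x _), real_inner_comm (ζ x) (J x)]
    ring
  rw [hdec]
  set t := ‖y - x‖ with ht
  have ht0 : 0 ≤ t := norm_nonneg _
  have b1 : |inner ℝ (G ν y - G m x - linearPart (B m) (C m) γ x y) (ζ x)| ≤
      M * (t ^ 2 + W ^ 2) * K :=
    (abs_real_inner_le_norm _ _).trans
      (mul_le_mul (h.expansion_G m ν γ hγ x y) (hK x) (norm_nonneg _) (by positivity))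
  have b2 : |inner ℝ (G m x) (ζ y - ζ x - fderiv ℝ ζ x (y - x))| ≤ M * (L * t ^ 2) :=
    (abs_real_inner_le_norm _ _).trans
      (mul_le_mul (h.norm_G_le m x) (hTay x y) (norm_nonneg _) hM)
  have b3 : |inner ℝ (G ν y - G m x) (ζ y - ζ x)| ≤ M * (t + W) * (L * t) :=
    (abs_real_inner_le_norm _ _).trans
      (mul_le_mul (h.lipschitz_G m ν x y) (hLip x y) (norm_nonneg _) (by positivity))
  have b4 : M * (t + W) * (L * t) ≤ 2 * M * L * (t ^ 2 + W ^ 2) := by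
    have : (t + W) * t ≤ 2 * (t ^ 2 + W ^ 2) := by nlinarith [sq_nonneg (t - W)]
    calc M * (t + W) * (L * t) = M * L * ((t + W) * t) := by ring
      _ ≤ M * L * (2 * (t ^ 2 + W ^ 2)) := by gcongr
      _ = _ := by ring
  have b5 : M * (L * t ^ 2) ≤ M * L * (t ^ 2 + W ^ 2) := by
    rw [← mul_assoc]
    gcongr
    nlinarith
  calc _ ≤ M * (t ^ 2 + W ^ 2) * K + M * (L * t ^ 2) + M * (t + W) * (L * t) :=
        (abs_add_three _ _ _).trans (by gcongr)
    _ ≤ _ := by linarith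

/-! ### Bounded operators on L²(m) that represent the Hessian -/

section Operator

variable (m : P2 d)

lemma memLp_mulB (h : HasUniformDerivs U G B C M) (z : L2 m) :
    MemLp (fun x => B m x (z x)) 2 m.toMeasure := by
  have hmeas : AEStronglyMeasurable (fun x => B m x (z x)) m.toMeasure :=
    (ContinuousLinearMap.id ℝ (E d →L[ℝ] E d)).aestronglyMeasurable_comp₂
      (h.continuous_B m).aestronglyMeasurable (Lp.aestronglyMeasurable z)
  exact (Lp.memLp z).of_le_mul hmeas (ae_of_all _ fun x => ((B m x).le_opNorm _).trans
    (mul_le_mul_of_nonneg_right (h.norm_B_le m x) (norm_nonneg _)))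

lemma stronglyMeasurable_C_apply (h : HasUniformDerivs U G B C M) (z : L2 m) :
    StronglyMeasurable fun p : E d × E d => C m p.1 p.2 (z p.2) :=
  isBoundedBilinearMap_apply.continuous.comp_stronglyMeasurable
    ((h.continuous_C m).stronglyMeasurable.prodMk
      ((Lp.stronglyMeasurable z).comp_measurable measurable_snd))

lemma norm_C_apply_le (h : HasUniformDerivs U G B C M) (x a v : E d) :
    ‖C m x a v‖ ≤ M * ‖v‖ :=
  ((C m x a).le_opNorm _).trans (mul_le_mul_of_nonneg_right (h.norm_C_le m x a) (norm_nonneg _))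

lemma integrable_norm_L2 (z : L2 m) : Integrable (fun x => ‖z x‖) m.toMeasure :=
  ((Lp.memLp z).integrable (by norm_num)).norm

lemma integral_norm_L2_le (z : L2 m) : ∫ x, ‖z x‖ ∂m.toMeasure ≤ ‖z‖ := by
  have h1 := integral_norm_eq_lintegral_enorm (Lp.aestronglyMeasurable z)
  rw [h1, ← eLpNorm_one_eq_lintegral_enorm, Lp.norm_def]
  refine ENNReal.toReal_mono (Lp.eLpNorm_ne_top z) ?_
  exact eLpNorm_le_eLpNorm_of_exponent_le (by norm_num) (Lp.aestronglyMeasurable z)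

lemma integrable_C_apply (h : HasUniformDerivs U G B C M) (z : L2 m) (x : E d) :
    Integrable (fun a => C m x a (z a)) m.toMeasure :=
  ((integrable_norm_L2 m z).const_mul M).mono'
    ((h.stronglyMeasurable_C_apply m z).comp_measurable
      (measurable_const.prodMk measurable_id)).aestronglyMeasurable
    (ae_of_all _ fun a => h.norm_C_apply_le m x a _)

lemma norm_integral_C_le (h : HasUniformDerivs U G B C M) (z : L2 m) (x : E d) :
    ‖∫ a, C m x a (z a) ∂m.toMeasure‖ ≤ M * ‖z‖ := by
  refine (norm_integral_le_of_norm_le ((integrable_norm_L2 m z).const_mul M)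
    (ae_of_all _ fun a => h.norm_C_apply_le m x a _)).trans ?_
  rw [integral_const_mul]
  exact mul_le_mul_of_nonneg_left (integral_norm_L2_le m z) (h.nonneg m)

lemma memLp_integral_C (h : HasUniformDerivs U G B C M) (z : L2 m) :
    MemLp (fun x => ∫ a, C m x a (z a) ∂m.toMeasure) 2 m.toMeasure :=
  memLp_of_bound m ((h.stronglyMeasurable_C_apply m z).integral_prod_right
    (f := fun x a => C m x a (z a))).aestronglyMeasurable (h.norm_integral_C_le m z)

/-- The operator `z ↦ B z` on `L²(m)`. -/
def opB (h : HasUniformDerivs U G B C M) : L2 m →L[ℝ] L2 m :=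
  LinearMap.mkContinuous
    { toFun := fun z => (h.memLp_mulB m z).toLp
      map_add' := fun z z' => by
        refine Lp.ext ?_
        filter_upwards [(h.memLp_mulB m (z + z')).coeFn_toLp, (h.memLp_mulB m z).coeFn_toLp,
          (h.memLp_mulB m z').coeFn_toLp, Lp.coeFn_add z z',
          Lp.coeFn_add (h.memLp_mulB m z).toLp (h.memLp_mulB m z').toLp] with x h1 h2 h3 h4 h5
        rw [h1, h5, Pi.add_apply, h2, h3, h4, Pi.add_apply, map_add]
      map_smul' := fun c z => by
        refine Lp.ext ?_
        filter_upwards [(h.memLp_mulB m (c • z)).coeFn_toLp, (h.memLp_mulB m z).coeFn_toLp,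
          Lp.coeFn_smul c z, Lp.coeFn_smul c (h.memLp_mulB m z).toLp] with x h1 h2 h3 h4
        rw [h1, RingHom.id_apply, h4, Pi.smul_apply, h2, h3, Pi.smul_apply, map_smul] } M
    fun z => by
      refine Lp.norm_le_mul_norm_of_ae_le_mul ?_
      filter_upwards [(h.memLp_mulB m z).coeFn_toLp] with x hx
      change ‖((h.memLp_mulB m z).toLp _ : L2 m) x‖ ≤ _
      rw [hx]
      exact ((B m x).le_opNorm _).trans
        (mul_le_mul_of_nonneg_right (h.norm_B_le m x) (norm_nonneg _))

/-- The integral operator with kernel `C` on `L²(m)`. -/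
def opC (h : HasUniformDerivs U G B C M) : L2 m →L[ℝ] L2 m :=
  LinearMap.mkContinuous
    { toFun := fun z => (h.memLp_integral_C m z).toLp
      map_add' := fun z z' => by
        refine Lp.ext ?_
        filter_upwards [(h.memLp_integral_C m (z + z')).coeFn_toLp,
          (h.memLp_integral_C m z).coeFn_toLp, (h.memLp_integral_C m z').coeFn_toLp,
          Lp.coeFn_add (h.memLp_integral_C m z).toLp (h.memLp_integral_C m z').toLp]
          with x h1 h2 h3 h5
        rw [h1, h5, Pi.add_apply, h2, h3, ← integral_add (h.integrable_C_apply m z x)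
          (h.integrable_C_apply m z' x)]
        refine integral_congr_ae ?_
        filter_upwards [Lp.coeFn_add z z'] with a ha
        rw [ha, Pi.add_apply, map_add]
      map_smul' := fun c z => by
        refine Lp.ext ?_
        filter_upwards [(h.memLp_integral_C m (c • z)).coeFn_toLp,
          (h.memLp_integral_C m z).coeFn_toLp,
          Lp.coeFn_smul c (h.memLp_integral_C m z).toLp] with x h1 h2 h4
        rw [h1, RingHom.id_apply, h4, Pi.smul_apply, h2, ← integral_smul]
        refine integral_congr_ae ?_
        filter_upwards [Lp.coeFn_smul c z] with a ha
        rw [ha, Pi.smul_apply, map_smul] } M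
    fun z => by
      have h0 : 0 ≤ M * ‖z‖ := mul_nonneg (h.nonneg m) (norm_nonneg _)
      have := Lp.norm_le_of_ae_bound (f := (h.memLp_integral_C m z).toLp) h0 (by
        filter_upwards [(h.memLp_integral_C m z).coeFn_toLp] with x hx
        rw [hx]
        exact h.norm_integral_C_le m z x)
      -- The supremum bound passes to the L² norm without loss because m has mass 1.
      simpa [measureUnivNNReal] using this

/-- The Hessian as a bounded bilinear form on `L²(m)`. -/
def hessian (h : HasUniformDerivs U G B C M) : L2 m →L[ℝ] L2 m →L[ℝ] ℝ :=
  (innerSL ℝ).comp (h.opB m + h.opC m)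

/-- Used twice: with gradients of test functions to identify the Hessian, and with constant unit
fields, which are not test gradients, to compute the Laplacian. -/
lemma hessian_apply (h : HasUniformDerivs U G B C M) {z₁ z₂ : L2 m} {ζ₁ ζ₂ : E d → E d}
    (e₁ : z₁ =ᵐ[m.toMeasure] ζ₁) (e₂ : z₂ =ᵐ[m.toMeasure] ζ₂) :
    h.hessian m z₁ z₂ = ∫ x, inner ℝ (ζ₂ x) (B m x (ζ₁ x)) ∂m.toMeasure +
      ∫ x, ∫ a, inner ℝ (ζ₂ x) (C m x a (ζ₁ a)) ∂m.toMeasure ∂m.toMeasure := by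
  change inner ℝ ((h.memLp_mulB m z₁).toLp + (h.memLp_integral_C m z₁).toLp) z₂ = _
  rw [inner_add_left, inner_L2_eq (h.memLp_mulB m z₁).coeFn_toLp,
    inner_L2_eq (h.memLp_integral_C m z₁).coeFn_toLp]
  congr 1
  · refine integral_congr_ae ?_
    filter_upwards [e₁, e₂] with x h1 h2
    rw [h1, h2, real_inner_comm]
  · refine integral_congr_ae ?_
    filter_upwards [e₂] with x h2
    rw [h2, real_inner_comm, ← integral_inner (h.integrable_C_apply m z₁ x)]
    refine integral_congr_ae ?_
    filter_upwards [e₁] with a h1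
    rw [h1]

/-- The bilinear form `hessian` is the Hessian of `U`. -/
theorem isHessian (h : HasUniformDerivs U G B C M) : IsHessian m G (h.hessian m) := by
  refine ⟨fun ζ hζ => (h.hasExpansion_dirDeriv m hζ).differentiableAtW (h.memLp_dirGradient m hζ),
    fun φ₁ φ₂ h₁ h₂ z₁ z₂ e₁ e₂ => ?_⟩
  have hq := h.memLp_dirGradient m h₂.isTest_gradient
  refine ⟨hq.toLp, (h.hasExpansion_dirDeriv m h₂.isTest_gradient).isGradientW
    (h.isTangent_dirGradient m h₂.isTest_gradient) hq.coeFn_toLp, ?_⟩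
  set ζ₁ := gradient φ₁
  set ζ₂ := gradient φ₂
  have t₁ : IsTest ζ₁ := h₁.isTest_gradient
  have t₂ : IsTest ζ₂ := h₂.isTest_gradient
  have c₁ := t₁.1.continuous
  have c₂ := t₂.1.continuous
  have c₂' : Continuous (fderiv ℝ ζ₂) := t₂.isTest_fderiv.1.continuous
  obtain ⟨K₁, hK₁⟩ := t₁.exists_bound
  obtain ⟨K₂, hK₂⟩ := t₂.exists_bound
  obtain ⟨K₃, hK₃⟩ := t₂.isTest_fderiv.exists_bound
  have hM := h.nonneg m
  have p₁ : 0 ≤ K₁ := (norm_nonneg _).trans (hK₁ 0)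
  have p₂ : 0 ≤ K₂ := (norm_nonneg _).trans (hK₂ 0)
  have p₃ : 0 ≤ K₃ := (norm_nonneg _).trans (hK₃ 0)
  have hBc := h.continuous_B m
  have hGc := h.continuous_G m
  have hCc : Continuous fun p : E d × E d => C m p.2 p.1 (ζ₁ p.1) :=
    ((h.continuous_C m).comp continuous_swap).clm_apply (by fun_prop)
  have i1 : Integrable (fun x => (inner ℝ (ζ₂ x) (B m x (ζ₁ x)) : ℝ)) m.toMeasure := by
    refine Integrable.of_bound (C := K₂ * (M * K₁))
      (Continuous.aestronglyMeasurable (by fun_prop)) (ae_of_all _ fun x => ?_)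
    refine (norm_inner_le_norm _ _).trans (mul_le_mul (hK₂ x) ?_ (norm_nonneg _) p₂)
    exact ((B m x).le_opNorm _).trans
      (mul_le_mul (h.norm_B_le m x) (hK₁ x) (norm_nonneg _) hM)
  have i2 : Integrable (fun x => (inner ℝ (G m x) (fderiv ℝ ζ₂ x (ζ₁ x)) : ℝ)) m.toMeasure := by
    refine Integrable.of_bound (C := M * (K₃ * K₁))
      (Continuous.aestronglyMeasurable (hGc.inner (c₂'.clm_apply c₁))) (ae_of_all _ fun x => ?_)
    refine (norm_inner_le_norm _ _).trans (mul_le_mul (h.norm_G_le m x) ?_ (norm_nonneg _) hM)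
    exact ((fderiv ℝ ζ₂ x).le_opNorm _).trans (mul_le_mul (hK₃ x) (hK₁ x) (norm_nonneg _) p₃)
  have hprod : Integrable (Function.uncurry fun a x =>
      (inner ℝ (ζ₂ x) (C m x a (ζ₁ a)) : ℝ)) (m.toMeasure.prod m.toMeasure) := by
    refine Integrable.of_bound (C := K₂ * (M * K₁))
      (Continuous.aestronglyMeasurable ((c₂.comp continuous_snd).inner hCc))
      (ae_of_all _ fun p => ?_)
    refine (norm_inner_le_norm _ _).trans (mul_le_mul (hK₂ _) ?_ (norm_nonneg _) p₂)
    exact (h.norm_C_apply_le m _ _ _).trans (mul_le_mul_of_nonneg_left (hK₁ _) hM)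
  -- Of the three terms, the middle one is (∇ζ₂ ζ₁)·(U[m]), exactly what the definition of the
  -- Hessian subtracts.
  have hval : ∫ x, inner ℝ ((hq.toLp _ : L2 m) x) (ζ₁ x) ∂m.toMeasure =
      ∫ x, (inner ℝ (ζ₂ x) (B m x (ζ₁ x)) : ℝ) ∂m.toMeasure +
      ∫ x, (inner ℝ (G m x) (fderiv ℝ ζ₂ x (ζ₁ x)) : ℝ) ∂m.toMeasure +
      ∫ a, ∫ x, (inner ℝ (ζ₂ x) (C m x a (ζ₁ a)) : ℝ) ∂m.toMeasure ∂m.toMeasure := by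
    have i12 : Integrable (fun x => (inner ℝ (ζ₂ x) (B m x (ζ₁ x)) : ℝ) +
        inner ℝ (G m x) (fderiv ℝ ζ₂ x (ζ₁ x))) m.toMeasure := i1.add i2
    have i3 : Integrable (fun a => ∫ x, (inner ℝ (ζ₂ x) (C m x a (ζ₁ a)) : ℝ) ∂m.toMeasure)
        m.toMeasure := hprod.integral_prod_left
    rw [← integral_add i1 i2, ← integral_add i12 i3]
    refine integral_congr_ae ?_
    filter_upwards [hq.coeFn_toLp] with x hx
    rw [hx, h.inner_dirGradient m t₂]
  rw [hval, h.hessian_apply m e₁ e₂, dirDeriv, integral_integral_swap hprod]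
  ring

end Operator

/-- The Laplacian of a functional with uniform second order expansions. -/
theorem hasLaplacianAt (h : HasUniformDerivs U G B C M) (η : ℝ) (m : P2 d) :
    HasLaplacianAt η U m (∑ i : Fin d,
      (∫ x, ∫ a, inner ℝ (EuclideanSpace.single i (1 : ℝ))
        (C m x a (EuclideanSpace.single i (1 : ℝ))) ∂m.toMeasure ∂m.toMeasure +
      (1 + η) * ∫ x, inner ℝ (EuclideanSpace.single i (1 : ℝ))
        (B m x (EuclideanSpace.single i (1 : ℝ))) ∂m.toMeasure)) := by
  refine ⟨G, B m, C m, h.isTwiceDifferentiableAt m, h.hessian m, h.isHessian m, ?_⟩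
  refine Finset.sum_congr rfl fun i _ => ?_
  have e : unitField m i =ᵐ[m.toMeasure] fun _ => EuclideanSpace.single i (1 : ℝ) :=
    Lp.coeFn_const ..
  rw [h.hessian_apply m e e]
  -- B enters once through the Hessian and once with weight η, hence the factor 1 + η.
  simp_rw [real_inner_comm (EuclideanSpace.single i (1 : ℝ)) (B m _ _)]
  ring

end HasUniformDerivs

/-! ### Plane waves and Fourier transforms of measures -/

/-- The constant `-2πi`. -/
def freq : ℂ := -2 * Real.pi * Complex.I

lemma norm_freq : ‖freq‖ = 2 * Real.pi := by
  simp [freq, abs_of_pos Real.pi_pos]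

lemma freq_mul_freq : freq * freq = ((-(4 * Real.pi ^ 2) : ℝ) : ℂ) := by
  rw [freq]
  push_cast
  linear_combination (4 * (Real.pi : ℂ) ^ 2) * Complex.I_mul_I

/-- The plane wave `exp(-2πi⟨η, x⟩)`. -/
def wave (η x : E d) : ℂ := Complex.exp (freq * ((inner ℝ η x : ℝ) : ℂ))

/-- The derivative of a plane wave in the direction `v`. -/
def dwave (η x v : E d) : ℂ := ((inner ℝ η v : ℝ) : ℂ) * (freq * wave η x)

/-- The Fourier transform of a measure. -/
def hat (m : P2 d) (η : E d) : ℂ := ∫ x, wave η x ∂m.toMeasure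

lemma freq_mul_ofReal (t : ℝ) :
    freq * (t : ℂ) = Complex.I * ((-2 * Real.pi * t : ℝ) : ℂ) := by
  rw [freq]; push_cast; ring

lemma norm_wave (η x : E d) : ‖wave η x‖ = 1 := by
  rw [wave, freq_mul_ofReal, Complex.norm_exp_I_mul_ofReal]

@[fun_prop]
lemma _root_.Continuous.wave {X : Type*} [TopologicalSpace X] {f g : X → E d}
    (hf : Continuous f) (hg : Continuous g) : Continuous fun x => wave (f x) (g x) := by
  unfold WassersteinHeat.wave; fun_prop

lemma contDiff_wave (η : E d) : ContDiff ℝ ∞ (wave η) := by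
  unfold wave
  have : ContDiff ℝ ∞ fun x : E d => ((inner ℝ η x : ℝ) : ℂ) :=
    Complex.ofRealCLM.contDiff.comp (contDiff_const.inner ℝ contDiff_id)
  exact (contDiff_const.mul this).cexp

lemma wave_sub (η x y : E d) :
    wave η y = wave η x * Complex.exp (freq * ((inner ℝ η (y - x) : ℝ) : ℂ)) := by
  rw [wave, wave, ← Complex.exp_add, inner_sub_right]
  push_cast
  ring_nf

lemma norm_freq_mul_inner_le (η v : E d) :
    ‖freq * ((inner ℝ η v : ℝ) : ℂ)‖ ≤ 2 * Real.pi * ‖η‖ * ‖v‖ := by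
  rw [norm_mul, norm_freq, mul_assoc (2 * Real.pi), Complex.norm_real]
  exact mul_le_mul_of_nonneg_left (norm_inner_le_norm _ _) (by positivity)

lemma norm_exp_sub_one_le (t : ℝ) :
    ‖Complex.exp (freq * (t : ℂ)) - 1‖ ≤ ‖freq * (t : ℂ)‖ := by
  rw [freq_mul_ofReal]
  refine (Real.norm_exp_I_mul_ofReal_sub_one_le).trans (le_of_eq ?_)
  rw [norm_mul Complex.I, Complex.norm_I, one_mul, Complex.norm_real]

/-- The exponent z is purely imaginary, so |exp z - 1| ≤ |z| holds globally. For |z| ≤ 1 the power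
series gives |z|²; for |z| ≥ 1 the trivial bound 2|z| is at most 2|z|². -/
lemma norm_exp_sub_one_sub_le (t : ℝ) :
    ‖Complex.exp (freq * (t : ℂ)) - 1 - freq * (t : ℂ)‖ ≤ 2 * ‖freq * (t : ℂ)‖ ^ 2 := by
  rcases le_total ‖freq * (t : ℂ)‖ 1 with h | h
  · refine (Complex.norm_exp_sub_one_sub_id_le h).trans ?_
    linarith [sq_nonneg ‖freq * (t : ℂ)‖]
  · refine (norm_sub_le _ _).trans ?_
    have := norm_exp_sub_one_le t
    nlinarith

/-- The constant 4π, larger than the 2π that the argument gives, lets one radius serve both orders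
of `Approx`: the second order error 2(2π)² is below (4π)². -/
lemma norm_wave_sub_le (η x y : E d) :
    ‖wave η y - wave η x‖ ≤ 4 * Real.pi * ‖η‖ * ‖y - x‖ := by
  have h : wave η y - wave η x =
      wave η x * (Complex.exp (freq * ((inner ℝ η (y - x) : ℝ) : ℂ)) - 1) := by
    rw [wave_sub η x y]; ring
  rw [h, norm_mul, norm_wave, one_mul]
  refine (norm_exp_sub_one_le _).trans ((norm_freq_mul_inner_le η _).trans ?_)
  have : 0 ≤ Real.pi * ‖η‖ * ‖y - x‖ := by positivity
  linarith

lemma norm_dwave_le (η x v : E d) : ‖dwave η x v‖ ≤ 2 * Real.pi * ‖η‖ * ‖v‖ := by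
  rw [dwave, ← mul_assoc, mul_comm _ freq, norm_mul, norm_wave, mul_one]
  exact norm_freq_mul_inner_le η v

lemma norm_wave_sub_sub_le (η x y : E d) :
    ‖wave η y - wave η x - dwave η x (y - x)‖ ≤ (4 * Real.pi * ‖η‖ * ‖y - x‖) ^ 2 := by
  have h : wave η y - wave η x - dwave η x (y - x) =
      wave η x * (Complex.exp (freq * ((inner ℝ η (y - x) : ℝ) : ℂ)) - 1 -
        freq * ((inner ℝ η (y - x) : ℝ) : ℂ)) := by
    rw [wave_sub η x y, dwave]; ring
  rw [h, norm_mul, norm_wave, one_mul]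
  refine (norm_exp_sub_one_sub_le _).trans ?_
  have := pow_le_pow_left₀ (norm_nonneg _) (norm_freq_mul_inner_le η (y - x)) 2
  have h0 : 0 ≤ (Real.pi * ‖η‖ * ‖y - x‖) ^ 2 := by positivity
  nlinarith

lemma integrable_wave (m : P2 d) (η : E d) : Integrable (wave η) m.toMeasure :=
  Integrable.of_bound (C := 1) (by fun_prop : Continuous fun x => wave η x).aestronglyMeasurable
    (ae_of_all _ fun x => (norm_wave η x).le)

lemma norm_hat_le (m : P2 d) (η : E d) : ‖hat m η‖ ≤ 1 := by
  have := norm_integral_le_of_norm_le_const (μ := m.toMeasure) (f := wave η) (C := 1)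
    (ae_of_all _ fun x => (norm_wave η x).le)
  simpa [hat] using this

lemma continuous_hat (m : P2 d) : Continuous (hat m) := by
  refine continuous_of_dominated (bound := fun _ => 1) (fun η => ?_) (fun η => ?_)
    (integrable_const _) ?_
  · exact (integrable_wave m η).aestronglyMeasurable
  · exact ae_of_all _ fun x => (norm_wave η x).le
  · exact ae_of_all _ fun x => by fun_prop

@[fun_prop]
lemma _root_.Continuous.hat {X : Type*} [TopologicalSpace X] {f : X → E d} (m : P2 d)
    (hf : Continuous f) : Continuous fun x => hat m (f x) :=
  (continuous_hat m).comp hf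

/-- The derivative of the Fourier transform along a plan. -/
def dhat (γ : Measure (E d × E d)) (η : E d) : ℂ := ∫ p, dwave η p.1 (p.2 - p.1) ∂γ

lemma integrable_dwave {m ν : P2 d} {γ : Measure (E d × E d)} (hγ : γ ∈ couplings m ν)
    (η : E d) : Integrable (fun p : E d × E d => dwave η p.1 (p.2 - p.1)) γ := by
  refine ((HasUniformDerivs.integrable_norm_sub hγ).const_mul (2 * Real.pi * ‖η‖)).mono' ?_
    (ae_of_all _ fun p => norm_dwave_le η _ _)
  unfold dwave
  exact Continuous.aestronglyMeasurable (by fun_prop)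

/-- Jensen's inequality, in the form that the variance of |y - x| under γ is nonnegative. -/
lemma integral_norm_sub_le {m ν : P2 d} {γ : Measure (E d × E d)} (hγ : γ ∈ optimalPlans m ν) :
    ∫ p, ‖p.2 - p.1‖ ∂γ ≤ W2 m ν := by
  have := isProbabilityMeasure_of_mem_couplings hγ.1
  have i1 := HasUniformDerivs.integrable_norm_sub hγ.1
  have i2 := integrable_sq_of_mem_couplings hγ.1
  refine abs_le_of_sq_le_sq' ?_ (W2_nonneg m ν) |>.2
  set I := ∫ p : E d × E d, ‖p.2 - p.1‖ ∂γ with hI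
  have h0 : 0 ≤ ∫ p : E d × E d, (‖p.2 - p.1‖ ^ 2 - (2 * I) * ‖p.2 - p.1‖) + I ^ 2 ∂γ :=
    integral_nonneg fun p => by
      have : (‖p.2 - p.1‖ ^ 2 - (2 * I) * ‖p.2 - p.1‖) + I ^ 2 = (‖p.2 - p.1‖ - I) ^ 2 := by ring
      rw [this]
      positivity
  have i3 : Integrable (fun p : E d × E d => ‖p.2 - p.1‖ ^ 2 - (2 * I) * ‖p.2 - p.1‖) γ :=
    i2.sub (i1.const_mul _)
  rw [integral_add i3 (integrable_const _), integral_sub i2 (i1.const_mul _),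
    integral_const_mul, ← hI, integral_sq_of_mem_optimalPlans hγ] at h0
  simp at h0
  linarith

/-! ### First order approximations of products -/

/-- `z` and `w` lie in the unit disc, and `z` is within `r` of `w` and within `r²` of `w + δ`. -/
structure Approx (z w δ : ℂ) (r : ℝ) : Prop where
  left : ‖z‖ ≤ 1
  right : ‖w‖ ≤ 1
  zeroth : ‖z - w‖ ≤ r
  first : ‖z - w - δ‖ ≤ r ^ 2

lemma Approx.nonneg {z w δ : ℂ} {r : ℝ} (h : Approx z w δ r) : 0 ≤ r :=
  (norm_nonneg _).trans h.zeroth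

lemma Approx.mono {z w δ : ℂ} {r r' : ℝ} (h : Approx z w δ r) (hr : r ≤ r') :
    Approx z w δ r' :=
  ⟨h.left, h.right, h.zeroth.trans hr, h.first.trans (pow_le_pow_left₀ h.nonneg hr 2)⟩

/-- The radii add because r² + r'² + rr' ≤ (r + r')²; the disc bounds keep the other factors from
enlarging the errors. -/
lemma Approx.mul {z w δ z' w' δ' : ℂ} {r r' : ℝ} (h : Approx z w δ r) (h' : Approx z' w' δ' r') :
    Approx (z * z') (w * w') (δ * w' + w * δ') (r + r') := by
  have h0 := h.nonneg
  have h0' := h'.nonneg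
  refine ⟨?_, ?_, ?_, ?_⟩
  · rw [norm_mul]; exact mul_le_one₀ h.left (norm_nonneg _) h'.left
  · rw [norm_mul]; exact mul_le_one₀ h.right (norm_nonneg _) h'.right
  · have e : z * z' - w * w' = (z - w) * z' + w * (z' - w') := by ring
    rw [e]
    refine (norm_add_le _ _).trans (add_le_add ?_ ?_) <;> rw [norm_mul]
    · exact (mul_le_of_le_one_right (norm_nonneg _) h'.left).trans h.zeroth
    · exact (mul_le_of_le_one_left (norm_nonneg _) h.right).trans h'.zeroth
  · have e : z * z' - w * w' - (δ * w' + w * δ') =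
        (z - w - δ) * w' + w * (z' - w' - δ') + (z - w) * (z' - w') := by ring
    rw [e]
    have b1 : ‖(z - w - δ) * w'‖ ≤ r ^ 2 := by
      rw [norm_mul]; exact (mul_le_of_le_one_right (norm_nonneg _) h'.right).trans h.first
    have b2 : ‖w * (z' - w' - δ')‖ ≤ r' ^ 2 := by
      rw [norm_mul]; exact (mul_le_of_le_one_left (norm_nonneg _) h.right).trans h'.first
    have b3 : ‖(z - w) * (z' - w')‖ ≤ r * r' := by
      rw [norm_mul]; exact mul_le_mul h.zeroth h'.zeroth (norm_nonneg _) h0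
    refine (norm_add₃_le).trans ?_
    nlinarith

/-- No constant depends on the number of factors, which keeps the cost in k polynomial. -/
lemma Approx.prod {ι : Type*} [DecidableEq ι] (s : Finset ι) {z w δ : ι → ℂ} {r : ι → ℝ}
    (h : ∀ i ∈ s, Approx (z i) (w i) (δ i) (r i)) :
    Approx (∏ i ∈ s, z i) (∏ i ∈ s, w i) (∑ i ∈ s, δ i * ∏ l ∈ s.erase i, w l) (∑ i ∈ s, r i) := by
  induction s using Finset.induction_on with
  | empty => exact ⟨by simp, by simp, by simp, by simp⟩
  | insert a s ha ih =>
    have h1 := (h a (Finset.mem_insert_self a s)).mul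
      (ih fun i hi => h i (Finset.mem_insert_of_mem hi))
    have e : ∑ i ∈ insert a s, δ i * ∏ l ∈ (insert a s).erase i, w l =
        δ a * ∏ i ∈ s, w i + w a * ∑ i ∈ s, δ i * ∏ l ∈ s.erase i, w l := by
      rw [Finset.sum_insert ha, Finset.erase_insert ha, Finset.mul_sum]
      congr 1
      refine Finset.sum_congr rfl fun i hi => ?_
      have hai : a ≠ i := fun h => ha (h ▸ hi)
      rw [Finset.erase_insert_of_ne hai, Finset.prod_insert
        (fun h => ha (Finset.mem_of_mem_erase h))]
      ring
    rwa [e, Finset.prod_insert ha, Finset.prod_insert ha, Finset.sum_insert ha]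

lemma approx_wave (η x y : E d) :
    Approx (wave η y) (wave η x) (dwave η x (y - x)) (4 * Real.pi * ‖η‖ * ‖y - x‖) :=
  ⟨(norm_wave η y).le, (norm_wave η x).le, norm_wave_sub_le η x y, norm_wave_sub_sub_le η x y⟩

/-- The plane wave estimates are averaged over γ; optimality turns the moments of |y - x| into
powers of W₂. -/
lemma approx_hat {m ν : P2 d} {γ : Measure (E d × E d)} (hγ : γ ∈ optimalPlans m ν) (η : E d) :
    Approx (hat ν η) (hat m η) (dhat γ η) (4 * Real.pi * ‖η‖ * W2 m ν) := by
  have hfst := measurePreserving_fst_of_mem_couplings hγ.1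
  have hsnd := measurePreserving_snd_of_mem_couplings hγ.1
  have i1 : Integrable (fun p : E d × E d => wave η p.1) γ :=
    hfst.integrable_comp_of_integrable (integrable_wave m η)
  have i2 : Integrable (fun p : E d × E d => wave η p.2) γ :=
    hsnd.integrable_comp_of_integrable (integrable_wave ν η)
  have e1 : hat m η = ∫ p : E d × E d, wave η p.1 ∂γ := by
    rw [hat, ← hfst.map_eq, integral_map hfst.measurable.aemeasurable]
    exact (by fun_prop : Continuous fun x => wave η x).aestronglyMeasurable
  have e2 : hat ν η = ∫ p : E d × E d, wave η p.2 ∂γ := by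
    rw [hat, ← hsnd.map_eq, integral_map hsnd.measurable.aemeasurable]
    exact (by fun_prop : Continuous fun x => wave η x).aestronglyMeasurable
  have i12 : Integrable (fun p : E d × E d => wave η p.2 - wave η p.1) γ := i2.sub i1
  refine ⟨norm_hat_le ν η, norm_hat_le m η, ?_, ?_⟩
  · rw [e1, e2, ← integral_sub i2 i1]
    refine (norm_integral_le_of_norm_le ((HasUniformDerivs.integrable_norm_sub hγ.1).const_mul _)
      (ae_of_all _ fun p => norm_wave_sub_le η p.1 p.2)).trans ?_
    rw [integral_const_mul]
    exact mul_le_mul_of_nonneg_left (integral_norm_sub_le hγ) (by positivity)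
  · rw [e1, e2, dhat, ← integral_sub i2 i1, ← integral_sub i12 (integrable_dwave hγ.1 η)]
    refine (norm_integral_le_of_norm_le ((integrable_sq_of_mem_couplings hγ.1).const_mul
      ((4 * Real.pi * ‖η‖) ^ 2))
      (ae_of_all _ fun p => (norm_wave_sub_sub_le η p.1 p.2).trans_eq (mul_pow _ _ _))).trans ?_
    rw [integral_const_mul, integral_sq_of_mem_optimalPlans hγ, mul_pow _ (W2 m ν)]

/-! ### The derivatives of products of Fourier transforms -/

/-- Tuples of frequencies. -/
abbrev Freqs (d : ℕ) : Type := Σ n : ℕ, (Fin (n + 1) → E d)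

namespace Freqs

variable (θ : Freqs d)

/-- The size of a tuple of frequencies. -/
def size : ℝ := 1 + 4 * Real.pi * ∑ j, ‖θ.2 j‖

/-- The product of the Fourier transform of `m` at the frequencies of index in `s`. -/
def hatProd (s : Finset (Fin (θ.1 + 1))) (m : P2 d) : ℂ := ∏ l ∈ s, hat m (θ.2 l)

/-- The indices different from `j`. -/
def others (j : Fin (θ.1 + 1)) : Finset (Fin (θ.1 + 1)) := Finset.univ.erase j

/-- The summand 1 makes powers of the size increase with the exponent, so the cube controls all
lower orders. -/
lemma one_le_size : 1 ≤ θ.size := by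
  have : 0 ≤ 4 * Real.pi * ∑ j, ‖θ.2 j‖ := by positivity
  rw [size]; linarith

lemma sum_le_size (s : Finset (Fin (θ.1 + 1))) : ∑ l ∈ s, 4 * Real.pi * ‖θ.2 l‖ ≤ θ.size := by
  rw [← Finset.mul_sum, size]
  have : ∑ l ∈ s, ‖θ.2 l‖ ≤ ∑ l, ‖θ.2 l‖ :=
    Finset.sum_le_sum_of_subset_of_nonneg (Finset.subset_univ s) fun _ _ _ => norm_nonneg _
  have := mul_le_mul_of_nonneg_left this (by positivity : 0 ≤ 4 * Real.pi)
  linarith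

lemma norm_le_size (j : Fin (θ.1 + 1)) : 4 * Real.pi * ‖θ.2 j‖ ≤ θ.size := by
  simpa using θ.sum_le_size {j}

lemma two_pi_sum_le_size : 2 * Real.pi * ∑ j, ‖θ.2 j‖ ≤ θ.size := by
  have : 0 ≤ Real.pi * ∑ j, ‖θ.2 j‖ := by positivity
  rw [size]; linarith

lemma norm_hatProd_le (s : Finset (Fin (θ.1 + 1))) (m : P2 d) : ‖θ.hatProd s m‖ ≤ 1 := by
  rw [hatProd, norm_prod]
  exact Finset.prod_le_one (fun _ _ => norm_nonneg _) fun _ _ => norm_hat_le _ _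

/-- The first variation of `hatProd` along a plan. -/
def dhatProd (s : Finset (Fin (θ.1 + 1))) (m : P2 d) (γ : Measure (E d × E d)) : ℂ :=
  ∑ l ∈ s, dhat γ (θ.2 l) * θ.hatProd (s.erase l) m

lemma approx_hatProd {m ν : P2 d} {γ : Measure (E d × E d)} (hγ : γ ∈ optimalPlans m ν)
    (s : Finset (Fin (θ.1 + 1))) :
    Approx (θ.hatProd s ν) (θ.hatProd s m) (θ.dhatProd s m γ) (θ.size * W2 m ν) := by
  refine (Approx.prod s fun l _ => approx_hat hγ (θ.2 l)).mono ?_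
  rw [← Finset.sum_mul]
  exact mul_le_mul_of_nonneg_right (θ.sum_le_size s) (W2_nonneg m ν)

/-- The common source of the estimates below: its zeroth order part gives Lipschitz bounds for `fG`
and `fB`, and enters the one for `fC`; its first order part gives the expansion of `fG`. -/
lemma approx_wave_mul {m ν : P2 d} {γ : Measure (E d × E d)} (hγ : γ ∈ optimalPlans m ν)
    (s : Finset (Fin (θ.1 + 1))) (j : Fin (θ.1 + 1)) (x y : E d) :
    Approx (wave (θ.2 j) y * θ.hatProd s ν) (wave (θ.2 j) x * θ.hatProd s m)
      (dwave (θ.2 j) x (y - x) * θ.hatProd s m + wave (θ.2 j) x * θ.dhatProd s m γ)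
      (θ.size * (‖y - x‖ + W2 m ν)) := by
  refine ((approx_wave (θ.2 j) x y).mul (θ.approx_hatProd hγ s)).mono ?_
  rw [mul_add]
  gcongr
  exact θ.norm_le_size j

variable (c : ℂ)

/-- The functional `Re (c ∏_j m̂(ξ_j))`. -/
def fU (m : P2 d) : ℝ := (c * θ.hatProd Finset.univ m).re

/-- The gradient of `fU`. -/
def fG (m : P2 d) (x : E d) : E d :=
  ∑ j, (c * freq * (wave (θ.2 j) x * θ.hatProd (θ.others j) m)).re • θ.2 j

/-- The derivative of `fG` in the space variable. -/
def fB (m : P2 d) (x : E d) : E d →L[ℝ] E d :=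
  ∑ j, (c * freq * (freq * wave (θ.2 j) x * θ.hatProd (θ.others j) m)).re •
    InnerProductSpace.rankOne ℝ (θ.2 j) (θ.2 j)

/-- The derivative of `fG` in the measure variable. -/
def fC (m : P2 d) (x a : E d) : E d →L[ℝ] E d :=
  ∑ j, ∑ l ∈ θ.others j, (c * freq * (wave (θ.2 j) x * (freq * wave (θ.2 l) a *
    θ.hatProd ((θ.others j).erase l) m))).re • InnerProductSpace.rankOne ℝ (θ.2 j) (θ.2 l)

/-! ### Bounds, Lipschitz estimates and expansions for one frequency tuple -/

variable {c}

lemma norm_sum_re_smul_le {ι F : Type*} [NormedAddCommGroup F] [NormedSpace ℝ F] (s : Finset ι)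
    (κ : ℂ) {z : ι → ℂ} {v : ι → F} {w : ι → ℝ} {r : ℝ} (hz : ∀ i ∈ s, ‖z i‖ ≤ r)
    (hv : ∀ i ∈ s, ‖v i‖ ≤ w i) :
    ‖∑ i ∈ s, (κ * z i).re • v i‖ ≤ ‖κ‖ * r * ∑ i ∈ s, w i := by
  rw [Finset.mul_sum]
  refine (norm_sum_le _ _).trans (Finset.sum_le_sum fun i hi => ?_)
  rw [norm_smul]
  refine mul_le_mul ?_ (hv i hi) (norm_nonneg _)
    (mul_nonneg (norm_nonneg _) ((norm_nonneg _).trans (hz i hi)))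
  refine (Complex.abs_re_le_norm _).trans ?_
  rw [norm_mul]
  exact mul_le_mul_of_nonneg_left (hz i hi) (norm_nonneg _)

/-- Bound for first order sums. -/
lemma norm_sum_smul_le_size {z : Fin (θ.1 + 1) → ℂ} {r : ℝ} (hz : ∀ j, ‖z j‖ ≤ r) :
    ‖∑ j, (c * freq * z j).re • θ.2 j‖ ≤ ‖c‖ * θ.size * r := by
  have hr : 0 ≤ r := (norm_nonneg _).trans (hz 0)
  refine (norm_sum_re_smul_le Finset.univ (c * freq) (fun j _ => hz j)
    (fun j _ => le_refl ‖θ.2 j‖)).trans ?_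
  rw [norm_mul, norm_freq]
  calc ‖c‖ * (2 * Real.pi) * r * ∑ j, ‖θ.2 j‖ = ‖c‖ * (2 * Real.pi * ∑ j, ‖θ.2 j‖) * r := by ring
    _ ≤ ‖c‖ * θ.size * r := by gcongr; exact θ.two_pi_sum_le_size

lemma sq_sum_le_size : 2 * Real.pi * (2 * Real.pi) * ((∑ j, ‖θ.2 j‖) * ∑ j, ‖θ.2 j‖) ≤
    θ.size ^ 2 := by
  calc _ = (2 * Real.pi * ∑ j, ‖θ.2 j‖) ^ 2 := by ring
    _ ≤ θ.size ^ 2 := by gcongr; exact θ.two_pi_sum_le_size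

/-- Bound for diagonal second order sums. -/
lemma norm_sum_rankOne_diag_le_size {z : Fin (θ.1 + 1) → ℂ} {r : ℝ} (hz : ∀ j, ‖z j‖ ≤ r) :
    ‖∑ j, (c * freq * (freq * z j)).re • InnerProductSpace.rankOne ℝ (θ.2 j) (θ.2 j)‖ ≤
      ‖c‖ * θ.size ^ 2 * r := by
  have hr : 0 ≤ r := (norm_nonneg _).trans (hz 0)
  have hz' : ∀ j ∈ Finset.univ, ‖freq * z j‖ ≤ 2 * Real.pi * r := fun j _ => by
    rw [norm_mul, norm_freq]; gcongr; exact hz j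
  refine (norm_sum_re_smul_le Finset.univ (c * freq) hz'
    (fun j _ => (InnerProductSpace.norm_rankOne (θ.2 j) (θ.2 j)).le)).trans ?_
  have h : ∑ j, ‖θ.2 j‖ * ‖θ.2 j‖ ≤ (∑ j, ‖θ.2 j‖) * ∑ j, ‖θ.2 j‖ := by
    rw [Finset.sum_mul]
    refine Finset.sum_le_sum fun j _ => mul_le_mul_of_nonneg_left ?_ (norm_nonneg _)
    exact Finset.single_le_sum (f := fun j => ‖θ.2 j‖) (fun _ _ => norm_nonneg _)
      (Finset.mem_univ j)
  rw [norm_mul, norm_freq]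
  calc ‖c‖ * (2 * Real.pi) * (2 * Real.pi * r) * ∑ j, ‖θ.2 j‖ * ‖θ.2 j‖
      ≤ ‖c‖ * (2 * Real.pi) * (2 * Real.pi * r) * ((∑ j, ‖θ.2 j‖) * ∑ j, ‖θ.2 j‖) := by gcongr
    _ = ‖c‖ * (2 * Real.pi * (2 * Real.pi) * ((∑ j, ‖θ.2 j‖) * ∑ j, ‖θ.2 j‖)) * r := by ring
    _ ≤ ‖c‖ * θ.size ^ 2 * r := by gcongr; exact θ.sq_sum_le_size

/-- Bound for off-diagonal second order sums. -/
lemma norm_sum_rankOne_le_size {z : Fin (θ.1 + 1) → Fin (θ.1 + 1) → ℂ} {r : ℝ}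
    (hz : ∀ j l, ‖z j l‖ ≤ r) :
    ‖∑ j, ∑ l ∈ θ.others j, (c * freq * (freq * z j l)).re •
      InnerProductSpace.rankOne ℝ (θ.2 j) (θ.2 l)‖ ≤ ‖c‖ * θ.size ^ 2 * r := by
  have hr : 0 ≤ r := (norm_nonneg _).trans (hz 0 0)
  have hin : ∀ j, ‖∑ l ∈ θ.others j, (c * freq * (freq * z j l)).re •
      InnerProductSpace.rankOne ℝ (θ.2 j) (θ.2 l)‖ ≤
      ‖c‖ * (2 * Real.pi) * (2 * Real.pi * r) * (‖θ.2 j‖ * ∑ l, ‖θ.2 l‖) := fun j => by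
    have hz' : ∀ l ∈ θ.others j, ‖freq * z j l‖ ≤ 2 * Real.pi * r := fun l _ => by
      rw [norm_mul, norm_freq]; gcongr; exact hz j l
    refine (norm_sum_re_smul_le (θ.others j) (c * freq) hz'
      (fun l _ => (InnerProductSpace.norm_rankOne (θ.2 j) (θ.2 l)).le)).trans ?_
    have hsub : ∑ l ∈ θ.others j, ‖θ.2 l‖ ≤ ∑ l, ‖θ.2 l‖ :=
      Finset.sum_le_sum_of_subset_of_nonneg (Finset.subset_univ _) fun _ _ _ => norm_nonneg _
    rw [norm_mul, norm_freq, ← Finset.mul_sum]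
    gcongr
  refine (norm_sum_le_of_le _ fun j _ => hin j).trans ?_
  rw [← Finset.mul_sum, ← Finset.sum_mul]
  calc ‖c‖ * (2 * Real.pi) * (2 * Real.pi * r) * ((∑ j, ‖θ.2 j‖) * ∑ j, ‖θ.2 j‖)
      = ‖c‖ * (2 * Real.pi * (2 * Real.pi) * ((∑ j, ‖θ.2 j‖) * ∑ j, ‖θ.2 j‖)) * r := by ring
    _ ≤ ‖c‖ * θ.size ^ 2 * r := by gcongr; exact θ.sq_sum_le_size

lemma norm_wave_mul_hatProd_le (s : Finset (Fin (θ.1 + 1))) (η x : E d) (m : P2 d) :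
    ‖wave η x * θ.hatProd s m‖ ≤ 1 := by
  rw [norm_mul, norm_wave, one_mul]
  exact θ.norm_hatProd_le s m

lemma norm_fG_le (m : P2 d) (x : E d) : ‖θ.fG c m x‖ ≤ ‖c‖ * θ.size := by
  exact (θ.norm_sum_smul_le_size (c := c) (r := 1)
    (fun j => θ.norm_wave_mul_hatProd_le (θ.others j) (θ.2 j) x m)).trans_eq (mul_one _)

lemma norm_fB_le (m : P2 d) (x : E d) : ‖θ.fB c m x‖ ≤ ‖c‖ * θ.size ^ 2 := by
  simpa [fB, mul_assoc] using θ.norm_sum_rankOne_diag_le_size (c := c) (r := 1)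
    (fun j => θ.norm_wave_mul_hatProd_le (θ.others j) (θ.2 j) x m)

lemma fC_eq (m : P2 d) (x a : E d) : θ.fC c m x a =
    ∑ j, ∑ l ∈ θ.others j, (c * freq * (freq * (wave (θ.2 j) x * (wave (θ.2 l) a *
      θ.hatProd ((θ.others j).erase l) m)))).re • InnerProductSpace.rankOne ℝ (θ.2 j) (θ.2 l) := by
  refine Finset.sum_congr rfl fun j _ => Finset.sum_congr rfl fun l _ => ?_
  congr 2
  ring

lemma norm_fC_le (m : P2 d) (x a : E d) : ‖θ.fC c m x a‖ ≤ ‖c‖ * θ.size ^ 2 := by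
  rw [fC_eq]
  refine (θ.norm_sum_rankOne_le_size (c := c) (r := 1) fun j l => ?_).trans_eq (mul_one _)
  rw [norm_mul, norm_wave, one_mul]
  exact θ.norm_wave_mul_hatProd_le _ _ _ _

lemma fG_sub_le (m ν : P2 d) (x y : E d) :
    ‖θ.fG c ν y - θ.fG c m x‖ ≤ ‖c‖ * θ.size ^ 2 * (‖y - x‖ + W2 m ν) := by
  -- The plan is auxiliary: the zeroth order estimate does not involve it.
  obtain ⟨γ, hγ⟩ := optimalPlans_nonempty m ν
  have := θ.norm_sum_smul_le_size (c := c)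
    (fun j => (θ.approx_wave_mul hγ (θ.others j) j x y).zeroth)
  rw [fG, fG, ← Finset.sum_sub_distrib]
  simp_rw [← sub_smul, ← Complex.sub_re, ← mul_sub]
  exact this.trans_eq (by ring)

lemma fB_sub_le (m ν : P2 d) (x y : E d) :
    ‖θ.fB c ν y - θ.fB c m x‖ ≤ ‖c‖ * θ.size ^ 3 * (‖y - x‖ + W2 m ν) := by
  obtain ⟨γ, hγ⟩ := optimalPlans_nonempty m ν
  have := θ.norm_sum_rankOne_diag_le_size (c := c)
    (fun j => (θ.approx_wave_mul hγ (θ.others j) j x y).zeroth)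
  rw [fB, fB, ← Finset.sum_sub_distrib]
  refine le_trans (le_of_eq (congrArg norm (Finset.sum_congr rfl fun j _ => ?_)))
    (this.trans_eq (by ring))
  refine (sub_smul _ _ _).symm.trans ?_
  rw [← Complex.sub_re]
  congr 2
  ring

lemma fC_sub_le (m ν : P2 d) (x y a b : E d) :
    ‖θ.fC c ν y b - θ.fC c m x a‖ ≤ ‖c‖ * θ.size ^ 3 * (‖y - x‖ + ‖b - a‖ + W2 m ν) := by
  obtain ⟨γ, hγ⟩ := optimalPlans_nonempty m ν
  have hap : ∀ j l, ‖wave (θ.2 j) y * (wave (θ.2 l) b * θ.hatProd ((θ.others j).erase l) ν) -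
      wave (θ.2 j) x * (wave (θ.2 l) a * θ.hatProd ((θ.others j).erase l) m)‖ ≤
      θ.size * (‖y - x‖ + ‖b - a‖ + W2 m ν) := fun j l => by
    have := ((approx_wave (θ.2 j) x y).mul
      (θ.approx_wave_mul hγ ((θ.others j).erase l) l a b)).zeroth
    refine this.trans ?_
    have h1 := mul_le_mul_of_nonneg_right (θ.norm_le_size j) (norm_nonneg (y - x))
    linarith
  have := θ.norm_sum_rankOne_le_size (c := c) hap
  rw [fC_eq, fC_eq, ← Finset.sum_sub_distrib]
  refine le_trans (le_of_eq (congrArg norm (Finset.sum_congr rfl fun j _ => ?_)))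
    (this.trans_eq (by ring))
  rw [← Finset.sum_sub_distrib]
  refine Finset.sum_congr rfl fun l _ => ?_
  refine (sub_smul _ _ _).symm.trans ?_
  rw [← Complex.sub_re]
  congr 2
  ring

lemma re_mul_inner_smul (κ : ℂ) (w : ℂ) (η ξ x v : E d) :
    ((κ * (freq * wave η x * w)).re • InnerProductSpace.rankOne ℝ ξ η) v =
      (κ * (dwave η x v * w)).re • ξ := by
  rw [smul_apply, InnerProductSpace.rankOne_apply, smul_smul, dwave]
  congr 1
  rw [show κ * (((inner ℝ η v : ℝ) : ℂ) * (freq * wave η x) * w) =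
    ((inner ℝ η v : ℝ) : ℂ) * (κ * (freq * wave η x * w)) by ring, Complex.re_ofReal_mul]
  ring

lemma fB_apply (m : P2 d) (x v : E d) : θ.fB c m x v =
    ∑ j, (c * freq * (dwave (θ.2 j) x v * θ.hatProd (θ.others j) m)).re • θ.2 j := by
  rw [fB, sum_apply]
  exact Finset.sum_congr rfl fun j _ => re_mul_inner_smul _ _ _ _ _ _

lemma fC_apply (m : P2 d) (x a v : E d) : θ.fC c m x a v =
    ∑ j, ∑ l ∈ θ.others j, (c * freq * (wave (θ.2 j) x * (dwave (θ.2 l) a v *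
      θ.hatProd ((θ.others j).erase l) m))).re • θ.2 j := by
  rw [fC, sum_apply]
  refine Finset.sum_congr rfl fun j _ => ?_
  rw [sum_apply]
  refine Finset.sum_congr rfl fun l _ => ?_
  have := re_mul_inner_smul (c * freq * wave (θ.2 j) x) (θ.hatProd ((θ.others j).erase l) m)
    (θ.2 l) (θ.2 j) a v
  rw [← mul_assoc (c * freq), ← mul_assoc (c * freq)]
  exact this

lemma integral_re_mul {X : Type*} [MeasurableSpace X] {μ : Measure X} {f : X → ℂ}
    (hf : Integrable f μ) (κ : ℂ) : ∫ x, (κ * f x).re ∂μ = (κ * ∫ x, f x ∂μ).re := by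
  rw [← integral_const_mul]
  exact integral_re (hf.const_mul κ)

lemma integrable_re_mul {X : Type*} [MeasurableSpace X] {μ : Measure X} {f : X → ℂ}
    (hf : Integrable f μ) (κ : ℂ) : Integrable (fun x => (κ * f x).re) μ :=
  (hf.const_mul κ).re

/-- Integration along γ turns `dwave` into `dhat`, and the sum over l ≠ j assembles the first
variation of the product of the other factors. -/
lemma integral_fC_apply {m ν : P2 d} {γ : Measure (E d × E d)} (hγ : γ ∈ couplings m ν)
    (x : E d) : ∫ p, θ.fC c m x p.1 (p.2 - p.1) ∂γ =
    ∑ j, (c * freq * (wave (θ.2 j) x * θ.dhatProd (θ.others j) m γ)).re • θ.2 j := by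
  simp_rw [fC_apply]
  have e : ∀ (j l : Fin (θ.1 + 1)) (p : E d × E d), (c * freq * (wave (θ.2 j) x *
      (dwave (θ.2 l) p.1 (p.2 - p.1) * θ.hatProd ((θ.others j).erase l) m))) =
      (c * freq * (wave (θ.2 j) x * θ.hatProd ((θ.others j).erase l) m)) *
        dwave (θ.2 l) p.1 (p.2 - p.1) := fun j l p => by ring
  simp_rw [e]
  have hi : ∀ j l, Integrable (fun p : E d × E d =>
      ((c * freq * (wave (θ.2 j) x * θ.hatProd ((θ.others j).erase l) m)) *
        dwave (θ.2 l) p.1 (p.2 - p.1)).re • θ.2 j) γ := fun j l =>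
    (integrable_re_mul (integrable_dwave hγ _) _).smul_const _
  rw [integral_finsetSum _ fun j _ => integrable_finsetSum _ fun l _ => hi j l]
  refine Finset.sum_congr rfl fun j _ => ?_
  rw [integral_finsetSum _ fun l _ => hi j l]
  simp_rw [integral_smul_const, integral_re_mul (integrable_dwave hγ _)]
  rw [← Finset.sum_smul, ← Complex.re_sum, dhatProd, Finset.mul_sum, Finset.mul_sum]
  congr 2
  refine Finset.sum_congr rfl fun l _ => ?_
  rw [dhat]
  ring

/-- The j-th summand of the linear part is exactly the first variation in `approx_wave_mul`. The
cube of the size is one factor from the prefactor ξ_j and two from the squared radius. -/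
lemma fG_expansion {m ν : P2 d} {γ : Measure (E d × E d)} (hγ : γ ∈ optimalPlans m ν)
    (x y : E d) : ‖θ.fG c ν y - θ.fG c m x -
      (θ.fB c m x (y - x) + ∫ p, θ.fC c m x p.1 (p.2 - p.1) ∂γ)‖ ≤
      ‖c‖ * θ.size ^ 3 * (2 * (‖y - x‖ ^ 2 + W2 m ν ^ 2)) := by
  rw [integral_fC_apply θ hγ.1, fB_apply, fG, fG, ← Finset.sum_sub_distrib,
    ← Finset.sum_add_distrib, ← Finset.sum_sub_distrib]
  simp_rw [← add_smul, ← sub_smul, ← Complex.sub_re, ← Complex.add_re, ← Complex.sub_re,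
    ← mul_add, ← mul_sub]
  refine (θ.norm_sum_smul_le_size (c := c)
    (fun j => (θ.approx_wave_mul hγ (θ.others j) j x y).first)).trans ?_
  have h : (‖y - x‖ + W2 m ν) ^ 2 ≤ 2 * (‖y - x‖ ^ 2 + W2 m ν ^ 2) := by
    nlinarith [sq_nonneg (‖y - x‖ - W2 m ν)]
  have hs : 0 ≤ θ.size := zero_le_one.trans θ.one_le_size
  calc ‖c‖ * θ.size * (θ.size * (‖y - x‖ + W2 m ν)) ^ 2
      = ‖c‖ * θ.size ^ 3 * (‖y - x‖ + W2 m ν) ^ 2 := by ring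
    _ ≤ _ := by gcongr

lemma fU_expansion {m ν : P2 d} {γ : Measure (E d × E d)} (hγ : γ ∈ optimalPlans m ν) :
    |θ.fU c ν - θ.fU c m - ∫ p, inner ℝ (θ.fG c m p.1) (p.2 - p.1) ∂γ| ≤
      ‖c‖ * θ.size ^ 2 * W2 m ν ^ 2 := by
  have e : ∫ p, inner ℝ (θ.fG c m p.1) (p.2 - p.1) ∂γ =
      (c * θ.dhatProd Finset.univ m γ).re := by
    have e1 : ∀ p : E d × E d, inner ℝ (θ.fG c m p.1) (p.2 - p.1) =
        ∑ j, ((c * θ.hatProd (θ.others j) m) * dwave (θ.2 j) p.1 (p.2 - p.1)).re := fun p => by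
      rw [fG, sum_inner]
      refine Finset.sum_congr rfl fun j _ => ?_
      rw [real_inner_smul_left, dwave, mul_comm (Complex.re _), ← Complex.re_ofReal_mul]
      congr 1
      ring
    simp_rw [e1]
    rw [integral_finsetSum _ fun j _ => integrable_re_mul (integrable_dwave hγ.1 _) _]
    simp_rw [integral_re_mul (integrable_dwave hγ.1 _)]
    rw [← Complex.re_sum, dhatProd, Finset.mul_sum]
    congr 1
    refine Finset.sum_congr rfl fun l _ => ?_
    rw [dhat, others]
    ring
  rw [e, fU, fU, ← Complex.sub_re, ← Complex.sub_re, ← mul_sub, ← mul_sub]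
  refine (Complex.abs_re_le_norm _).trans ?_
  rw [norm_mul, mul_assoc, ← mul_pow]
  exact mul_le_mul_of_nonneg_left (θ.approx_hatProd hγ Finset.univ).first (norm_nonneg _)

/-! ### Tangency -/

lemma hasFDerivAt_re_wave (κ : ℂ) (η x : E d) :
    HasFDerivAt (fun x => (κ * wave η x).re) ((κ * freq * wave η x).re • innerSL ℝ η) x := by
  have e1 : HasFDerivAt (fun x : E d => freq * ((inner ℝ η x : ℝ) : ℂ))
      (freq • Complex.ofRealCLM.comp (innerSL ℝ η)) x :=
    (Complex.ofRealCLM.hasFDerivAt.comp x (innerSL ℝ η).hasFDerivAt).const_mul freq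
  have e2 := Complex.reCLM.hasFDerivAt.comp x ((e1.cexp).const_mul κ)
  refine e2.congr_fderiv ?_
  ext v
  simp only [ContinuousLinearMap.comp_apply, smul_apply, smul_eq_mul,
    Complex.reCLM_apply, innerSL_apply_apply, Complex.ofRealCLM_apply, wave]
  rw [mul_comm (Complex.re _), ← Complex.re_ofReal_mul]
  congr 1
  ring

/-- Plane wave fields along their frequency are tangent. -/
lemma isTangent_wave (m : P2 d) (κ : ℂ) (η : E d) :
    IsTangent m fun x => (κ * wave η x).re • η := by
  have hf0 : freq ≠ 0 := by
    rw [← norm_ne_zero_iff, norm_freq]; positivity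
  -- Dividing by -2πi gives a bounded potential; it is not compactly supported, so tangency needs
  -- the cutoff argument.
  have hgr : ∀ x, HasGradientAt (fun x => (κ / freq * wave η x).re)
      ((κ * wave η x).re • η) x := fun x => by
    rw [hasGradientAt_iff_hasFDerivAt]
    refine (hasFDerivAt_re_wave (κ / freq) η x).congr_fderiv ?_
    ext v
    rw [div_mul_cancel₀ _ hf0]
    simp
  have hg : (fun x => (κ * wave η x).re • η) = gradient fun x => (κ / freq * wave η x).re :=
    funext fun x => (hgr x).gradient.symm
  rw [hg]
  refine isTangent_gradient_of_bounded m (M := max ‖κ / freq‖ (‖κ‖ * ‖η‖)) ?_ (fun x => ?_)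
    fun x => ?_
  · exact Complex.reCLM.contDiff.comp (contDiff_const.mul (contDiff_wave η))
  · refine (Complex.abs_re_le_norm _).trans ?_
    rw [norm_mul, norm_wave, mul_one]
    exact le_max_left _ _
  · rw [(hgr x).gradient, norm_smul]
    refine le_trans ?_ (le_max_right _ _)
    refine mul_le_mul_of_nonneg_right ((Complex.abs_re_le_norm _).trans ?_) (norm_nonneg _)
    rw [norm_mul, norm_wave, mul_one]

lemma isTangent_zero (m : P2 d) : IsTangent m fun _ => 0 :=
  ⟨0, (testGradients m).topologicalClosure.zero_mem, Lp.coeFn_zero ..⟩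

lemma isTangent_sum {ι : Type*} (s : Finset ι) {m : P2 d} {g : ι → E d → E d}
    (h : ∀ i ∈ s, IsTangent m (g i)) : IsTangent m fun x => ∑ i ∈ s, g i x := by
  classical
  induction s using Finset.induction_on with
  | empty => simpa using isTangent_zero m
  | insert a s ha ih =>
    simp_rw [Finset.sum_insert ha]
    exact (h a (Finset.mem_insert_self a s)).add
      (ih fun i hi => h i (Finset.mem_insert_of_mem hi))

lemma isTangent_fG (m m' : P2 d) : IsTangent m (θ.fG c m') := by
  refine isTangent_sum Finset.univ fun j _ => ?_
  have := isTangent_wave m (c * freq * θ.hatProd (θ.others j) m') (θ.2 j)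
  refine (congrArg (IsTangent m) (funext fun x => ?_)).mp this
  congr 2
  ring

/-- The adjoint of the rank one operator points along ξ_l, the frequency of the wave in a, so each
summand is a plane wave field along its own frequency. -/
lemma isTangent_fC (m : P2 d) (x v : E d) :
    IsTangent m fun a => ContinuousLinearMap.adjoint (θ.fC c m x a) v := by
  simp only [fC, map_sum, sum_apply]
  refine isTangent_sum Finset.univ fun j _ => isTangent_sum _ fun l _ => ?_
  have := isTangent_wave m (((inner ℝ (θ.2 j) v : ℝ) : ℂ) * (c * freq * (wave (θ.2 j) x *
    (freq * θ.hatProd ((θ.others j).erase l) m)))) (θ.2 l)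
  refine (congrArg (IsTangent m) (funext fun a => ?_)).mp this
  rw [LinearIsometryEquiv.map_smulₛₗ, InnerProductSpace.adjoint_rankOne,
    smul_apply, InnerProductSpace.rankOne_apply, smul_smul, mul_assoc,
    Complex.re_ofReal_mul, conj_trivial, mul_comm (Complex.re _)]
  congr 3
  ring

lemma hasFDerivAt_fG (m : P2 d) (x : E d) : HasFDerivAt (θ.fG c m) (θ.fB c m x) x := by
  refine HasFDerivAt.fun_sum fun j _ => ?_
  have h1 := (hasFDerivAt_re_wave (c * freq * θ.hatProd (θ.others j) m) (θ.2 j) x).smul_const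
    (θ.2 j)
  have h2 : (fun x => (c * freq * θ.hatProd (θ.others j) m * wave (θ.2 j) x).re • θ.2 j) =
      fun x => (c * freq * (wave (θ.2 j) x * θ.hatProd (θ.others j) m)).re • θ.2 j := by
    funext x
    congr 2
    ring
  rw [h2] at h1
  refine h1.congr_fderiv ?_
  ext1 v
  rw [smul_apply, InnerProductSpace.rankOne_apply,
    ContinuousLinearMap.smulRight_apply, smul_apply, innerSL_apply_apply,
    smul_smul, smul_eq_mul]
  congr 3
  ring

lemma contDiff_fG (m : P2 d) : ContDiff ℝ ∞ (θ.fG c m) := by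
  refine ContDiff.sum fun j _ => ?_
  have h1 : ContDiff ℝ ∞ fun x =>
      (c * freq * (wave (θ.2 j) x * θ.hatProd (θ.others j) m)).re :=
    Complex.reCLM.contDiff.comp (contDiff_const.mul ((contDiff_wave _).mul contDiff_const))
  exact h1.smul contDiff_const

/-- The field is the gradient of ⟨fG, ζ⟩, which is smooth and inherits compact support from ζ. -/
lemma isTangent_inner_fG (m : P2 d) {ζ : E d → E d} (hζ : IsTest ζ) : IsTangent m fun a =>
    ContinuousLinearMap.adjoint (θ.fB c m a) (ζ a) +
      ContinuousLinearMap.adjoint (fderiv ℝ ζ a) (θ.fG c m a) := by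
  have ht : IsTest fun a => (inner ℝ (θ.fG c m a) (ζ a) : ℝ) := by
    refine ⟨(θ.contDiff_fG m).inner ℝ hζ.1, hζ.2.mono fun a ha => ?_⟩
    rw [Function.mem_support] at ha ⊢
    exact fun h => ha (by rw [h, inner_zero_right])
  have hg : ∀ a, HasGradientAt (fun a => (inner ℝ (θ.fG c m a) (ζ a) : ℝ))
      (ContinuousLinearMap.adjoint (θ.fB c m a) (ζ a) +
        ContinuousLinearMap.adjoint (fderiv ℝ ζ a) (θ.fG c m a)) a := fun a => by
    rw [hasGradientAt_iff_hasFDerivAt]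
    refine ((θ.hasFDerivAt_fG m a).inner ℝ
      ((hζ.1.differentiable (by norm_num)) a).hasFDerivAt).congr_fderiv ?_
    ext v
    simp only [ContinuousLinearMap.comp_apply, ContinuousLinearMap.prod_apply,
      fderivInnerCLM_apply, InnerProductSpace.toDual_apply_apply, inner_add_left,
      ContinuousLinearMap.adjoint_inner_left]
    rw [real_inner_comm (ζ a)]
    ring
  have := ht.isTangent m
  rwa [funext fun a => (hg a).gradient] at this

end Freqs

/-! ### Superpositions of products of Fourier transforms -/

/-- The disjoint union carries the final σ-algebra, so measurability may be checked for each number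
of frequencies separately. -/
lemma measurable_of_sigma {ι : Type*} {X : ι → Type*} [∀ i, MeasurableSpace (X i)] {Y : Type*}
    [MeasurableSpace Y] {f : (Σ i, X i) → Y} (h : ∀ i, Measurable fun x => f ⟨i, x⟩) :
    Measurable f := fun s hs => by
  rw [show (Sigma.instMeasurableSpace : MeasurableSpace (Σ i, X i)) =
    ⨅ i, MeasurableSpace.map (Sigma.mk i) inferInstance from rfl]
  exact MeasurableSpace.measurableSet_iInf.2 fun i => h i hs

lemma measurable_sigmaMk {ι : Type*} {X : ι → Type*} [∀ i, MeasurableSpace (X i)] (i : ι) :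
    Measurable (Sigma.mk i : X i → Σ i, X i) := fun _ hs =>
  MeasurableSpace.measurableSet_iInf.1 hs i

namespace Freqs

variable (μ : Measure (Freqs d)) (c : Freqs d → ℂ)

/-- The superposition of the functionals `fU`. -/
def sumU (m : P2 d) : ℝ := ∫ θ, θ.fU (c θ) m ∂μ

/-- The superposition of the gradients `fG`. -/
def sumG (m : P2 d) (x : E d) : E d := ∫ θ, θ.fG (c θ) m x ∂μ

/-- The superposition of the derivatives `fB`. -/
def sumB (m : P2 d) (x : E d) : E d →L[ℝ] E d := ∫ θ, θ.fB (c θ) m x ∂μ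

/-- The superposition of the derivatives `fC`. -/
def sumC (m : P2 d) (x a : E d) : E d →L[ℝ] E d := ∫ θ, θ.fC (c θ) m x a ∂μ

/-- The weight controlling all derivatives up to the third order. -/
def weight (θ : Freqs d) : ℝ := ‖c θ‖ * θ.size ^ 3

variable {μ c}

lemma weight_nonneg (θ : Freqs d) : 0 ≤ weight c θ :=
  mul_nonneg (norm_nonneg _) (pow_nonneg (zero_le_one.trans θ.one_le_size) 3)

lemma norm_mul_size_pow_le (θ : Freqs d) {k : ℕ} (hk : k ≤ 3) :
    ‖c θ‖ * θ.size ^ k ≤ weight c θ :=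
  mul_le_mul_of_nonneg_left (pow_le_pow_right₀ θ.one_le_size hk) (norm_nonneg _)

lemma continuous_prod_hat {ι : Type*} (s : Finset ι) (m : P2 d) :
    Continuous fun ξ : ι → E d => ∏ l ∈ s, hat m (ξ l) :=
  continuous_finsetProd s fun l _ => (continuous_apply l).hat m

lemma continuous_rankOne {ι : Type*} (j l : ι) :
    Continuous fun ξ : ι → E d => InnerProductSpace.rankOne ℝ (ξ j) (ξ l) := by
  have h := (InnerProductSpace.rankOne ℝ (E := E d) (F := E d)).continuous.comp
    (continuous_apply (A := fun _ : ι => E d) j)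
  exact h.clm_apply (continuous_apply l)

/-! ### Measurability in the frequency tuple -/

section Measurability

lemma stronglyMeasurable_fU (hc : Measurable c) (m : P2 d) : StronglyMeasurable fun θ => fU θ (c θ) m := by
  refine (measurable_of_sigma fun n => ?_).stronglyMeasurable
  have h1 : Measurable fun ξ : Fin (n + 1) → E d => c ⟨n, ξ⟩ := hc.comp (measurable_sigmaMk n)
  have h2 : Continuous fun ξ : Fin (n + 1) → E d => ∏ l, hat m (ξ l) :=
    continuous_prod_hat _ m
  change Measurable fun ξ : Fin (n + 1) → E d => (c ⟨n, ξ⟩ * ∏ l, hat m (ξ l)).re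
  exact Complex.measurable_re.comp (h1.mul h2.measurable)

lemma stronglyMeasurable_fG (hc : Measurable c) (m : P2 d) (x : E d) :
    StronglyMeasurable fun θ => fG θ (c θ) m x := by
  refine (measurable_of_sigma fun n => ?_).stronglyMeasurable
  have h1 : Measurable fun ξ : Fin (n + 1) → E d => c ⟨n, ξ⟩ := hc.comp (measurable_sigmaMk n)
  change Measurable fun ξ : Fin (n + 1) → E d => ∑ j : Fin (n + 1), (c ⟨n, ξ⟩ * freq *
    (wave (ξ j) x * ∏ l ∈ Finset.univ.erase j, hat m (ξ l))).re • ξ j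
  refine Finset.measurable_fun_sum Finset.univ fun j _ => ?_
  have h2 := continuous_prod_hat (Finset.univ.erase j) m
  have h3 : Continuous fun ξ : Fin (n + 1) → E d => wave (ξ j) x :=
    (continuous_apply j).wave continuous_const
  exact (Complex.measurable_re.comp ((h1.mul_const freq).mul (h3.mul h2).measurable)).smul
    (measurable_pi_apply j)

lemma stronglyMeasurable_fB (hc : Measurable c) (m : P2 d) (x : E d) :
    StronglyMeasurable fun θ => fB θ (c θ) m x := by
  refine (measurable_of_sigma fun n => ?_).stronglyMeasurable
  have h1 : Measurable fun ξ : Fin (n + 1) → E d => c ⟨n, ξ⟩ := hc.comp (measurable_sigmaMk n)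
  change Measurable fun ξ : Fin (n + 1) → E d => ∑ j : Fin (n + 1), (c ⟨n, ξ⟩ * freq *
    (freq * wave (ξ j) x * ∏ l ∈ Finset.univ.erase j, hat m (ξ l))).re •
      InnerProductSpace.rankOne ℝ (ξ j) (ξ j)
  refine Finset.measurable_fun_sum Finset.univ fun j _ => ?_
  have h2 := continuous_prod_hat (Finset.univ.erase j) m
  have h3 : Continuous fun ξ : Fin (n + 1) → E d => wave (ξ j) x :=
    (continuous_apply j).wave continuous_const
  exact (Complex.measurable_re.comp ((h1.mul_const freq).mul
    ((h3.const_mul freq).mul h2).measurable)).smul (continuous_rankOne j j).measurable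

lemma stronglyMeasurable_fC (hc : Measurable c) (m : P2 d) (x a : E d) :
    StronglyMeasurable fun θ => fC θ (c θ) m x a := by
  refine (measurable_of_sigma fun n => ?_).stronglyMeasurable
  have h1 : Measurable fun ξ : Fin (n + 1) → E d => c ⟨n, ξ⟩ := hc.comp (measurable_sigmaMk n)
  change Measurable fun ξ : Fin (n + 1) → E d => ∑ j : Fin (n + 1),
    ∑ l ∈ Finset.univ.erase j, (c ⟨n, ξ⟩ * freq * (wave (ξ j) x * (freq * wave (ξ l) a *
      ∏ i ∈ (Finset.univ.erase j).erase l, hat m (ξ i)))).re •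
      InnerProductSpace.rankOne ℝ (ξ j) (ξ l)
  refine Finset.measurable_fun_sum Finset.univ fun j _ =>
    Finset.measurable_fun_sum (Finset.univ.erase j) fun l _ => ?_
  have h2 := continuous_prod_hat ((Finset.univ.erase j).erase l) m
  have h3 : ∀ (i : Fin (n + 1)) y, Continuous fun ξ : Fin (n + 1) → E d => wave (ξ i) y :=
    fun i y => (continuous_apply i).wave continuous_const
  exact (Complex.measurable_re.comp ((h1.mul_const freq).mul
    ((h3 j x).mul (((h3 l a).const_mul freq).mul h2)).measurable)).smul
      (continuous_rankOne j l).measurable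

end Measurability

lemma continuous_fG (θ : Freqs d) (z : ℂ) (m : P2 d) : Continuous (θ.fG z m) := by
  unfold fG; fun_prop

lemma continuous_fB (θ : Freqs d) (z : ℂ) (m : P2 d) : Continuous (θ.fB z m) := by
  unfold fB; fun_prop

lemma continuous_fC (θ : Freqs d) (z : ℂ) (m : P2 d) :
    Continuous fun p : E d × E d => θ.fC z m p.1 p.2 := by
  unfold fC; fun_prop

/-! ### Integration of the estimates over frequencies -/

section Integrated

lemma integrable_of_weight {F : Type*} [NormedAddCommGroup F] {f : Freqs d → F}
    (hi : Integrable (weight c) μ) (hf : StronglyMeasurable f) {K : ℝ}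
    (hb : ∀ θ, ‖f θ‖ ≤ weight c θ * K) : Integrable f μ :=
  (hi.mul_const K).mono' hf.aestronglyMeasurable (ae_of_all _ hb)

lemma norm_integral_le_of_weight {F : Type*} [NormedAddCommGroup F] [NormedSpace ℝ F]
    {f : Freqs d → F} (hi : Integrable (weight c) μ) {K : ℝ}
    (hb : ∀ θ, ‖f θ‖ ≤ weight c θ * K) : ‖∫ θ, f θ ∂μ‖ ≤ (∫ θ, weight c θ ∂μ) * K := by
  rw [← integral_mul_const]
  exact norm_integral_le_of_norm_le (hi.mul_const K) (ae_of_all _ hb)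

lemma integrable_fU (hc : Measurable c) (hi : Integrable (weight c) μ)
    (m : P2 d) : Integrable (fun θ => fU θ (c θ) m) μ := by
  refine integrable_of_weight (K := 1) hi (stronglyMeasurable_fU hc m) fun θ => ?_
  rw [mul_one]
  refine le_trans ?_ (norm_mul_size_pow_le (k := 0) θ (by norm_num))
  rw [pow_zero]
  refine (Complex.abs_re_le_norm _).trans ?_
  rw [norm_mul]
  exact mul_le_mul_of_nonneg_left (θ.norm_hatProd_le _ m) (norm_nonneg _)

lemma norm_fG_le_weight (θ : Freqs d) (m : P2 d) (x : E d) :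
    ‖θ.fG (c θ) m x‖ ≤ weight c θ := by
  simpa using (θ.norm_fG_le m x).trans_eq (by rw [pow_one]) |>.trans
    (norm_mul_size_pow_le (k := 1) θ (by norm_num))

lemma norm_fB_le_weight (θ : Freqs d) (m : P2 d) (x : E d) :
    ‖θ.fB (c θ) m x‖ ≤ weight c θ :=
  (θ.norm_fB_le m x).trans (norm_mul_size_pow_le θ (by norm_num))

lemma norm_fC_le_weight (θ : Freqs d) (m : P2 d) (x a : E d) :
    ‖θ.fC (c θ) m x a‖ ≤ weight c θ :=
  (θ.norm_fC_le m x a).trans (norm_mul_size_pow_le θ (by norm_num))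

lemma integrable_fG (hc : Measurable c) (hi : Integrable (weight c) μ)
    (m : P2 d) (x : E d) : Integrable (fun θ => fG θ (c θ) m x) μ :=
  hi.mono' (stronglyMeasurable_fG hc m x).aestronglyMeasurable
    (ae_of_all _ fun θ => norm_fG_le_weight θ m x)

lemma integrable_fB (hc : Measurable c) (hi : Integrable (weight c) μ)
    (m : P2 d) (x : E d) : Integrable (fun θ => fB θ (c θ) m x) μ :=
  hi.mono' (stronglyMeasurable_fB hc m x).aestronglyMeasurable
    (ae_of_all _ fun θ => norm_fB_le_weight θ m x)

lemma integrable_fC (hc : Measurable c) (hi : Integrable (weight c) μ)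
    (m : P2 d) (x a : E d) : Integrable (fun θ => fC θ (c θ) m x a) μ :=
  hi.mono' (stronglyMeasurable_fC hc m x a).aestronglyMeasurable
    (ae_of_all _ fun θ => norm_fC_le_weight θ m x a)

lemma adjoint_integral {f : Freqs d → E d →L[ℝ] E d} (hf : Integrable f μ) (v : E d) :
    ContinuousLinearMap.adjoint (∫ θ, f θ ∂μ) v =
      ∫ θ, ContinuousLinearMap.adjoint (f θ) v ∂μ := by
  have hf' : Integrable (fun θ => ContinuousLinearMap.adjoint (f θ) v) μ := by
    refine (hf.norm.mul_const ‖v‖).mono' ?_ (ae_of_all _ fun θ => ?_)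
    · have : Continuous fun T : E d →L[ℝ] E d => ContinuousLinearMap.adjoint T v :=
        ContinuousLinearMap.adjoint.continuous.clm_apply continuous_const
      exact this.comp_aestronglyMeasurable hf.aestronglyMeasurable
    · refine (ContinuousLinearMap.le_opNorm _ _).trans_eq ?_
      rw [LinearIsometryEquiv.norm_map]
  refine ext_inner_left ℝ fun w => ?_
  rw [ContinuousLinearMap.adjoint_inner_right, ContinuousLinearMap.integral_apply hf,
    ← integral_inner hf', real_inner_comm, ← integral_inner (hf.apply_continuousLinearMap w)]
  refine integral_congr_ae (ae_of_all _ fun θ => ?_)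
  simp only
  rw [ContinuousLinearMap.adjoint_inner_right, real_inner_comm]

/-- Justifies Fubini between plan and frequencies; the dominating function |y - x| · weight is a
product of integrable functions. -/
lemma integrable_prod_inner_fG [SFinite μ] (hc : Measurable c) (hi : Integrable (weight c) μ)
    {m ν : P2 d}
    {γ : Measure (E d × E d)} (hγ : γ ∈ couplings m ν) :
    Integrable (Function.uncurry fun (p : E d × E d) (θ : Freqs d) =>
      (inner ℝ (θ.fG (c θ) m p.1) (p.2 - p.1) : ℝ)) (γ.prod μ) := by
  have := isProbabilityMeasure_of_mem_couplings hγ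
  refine ((HasUniformDerivs.integrable_norm_sub hγ).mul_prod hi).mono' ?_
    (ae_of_all _ fun q => ?_)
  · refine (stronglyMeasurable_uncurry_of_continuous_of_stronglyMeasurable (fun θ => ?_)
      fun p => ?_).aestronglyMeasurable
    · exact ((continuous_fG θ _ m).comp continuous_fst).inner (by fun_prop)
    · exact (stronglyMeasurable_fG hc m p.1).inner stronglyMeasurable_const
  · refine (norm_inner_le_norm _ _).trans ?_
    rw [mul_comm]
    exact mul_le_mul_of_nonneg_left (norm_fG_le_weight _ _ _) (norm_nonneg _)

lemma integrable_prod_fC [SFinite μ] (hc : Measurable c) (hi : Integrable (weight c) μ)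
    {m ν : P2 d}
    {γ : Measure (E d × E d)} (hγ : γ ∈ couplings m ν) (x : E d) :
    Integrable (Function.uncurry fun (p : E d × E d) (θ : Freqs d) =>
      θ.fC (c θ) m x p.1 (p.2 - p.1)) (γ.prod μ) := by
  have := isProbabilityMeasure_of_mem_couplings hγ
  refine ((HasUniformDerivs.integrable_norm_sub hγ).mul_prod hi).mono' ?_
    (ae_of_all _ fun q => ?_)
  · refine (stronglyMeasurable_uncurry_of_continuous_of_stronglyMeasurable (fun θ => ?_)
      fun p => ?_).aestronglyMeasurable
    · exact ((continuous_fC θ _ m).comp (continuous_const.prodMk continuous_fst)).clm_apply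
        (by fun_prop)
    · exact (continuous_eval_const (p.2 - p.1)).comp_stronglyMeasurable
        (stronglyMeasurable_fC hc m x p.1)
  · refine (ContinuousLinearMap.le_opNorm _ _).trans ?_
    rw [mul_comm]
    exact mul_le_mul_of_nonneg_left (norm_fC_le_weight _ _ _ _) (norm_nonneg _)

/-- The remainder is linear in the functional, so after Fubini it is the integral of the remainders
for single tuples. -/
lemma sumU_expansion [SFinite μ] (hc : Measurable c) (hi : Integrable (weight c) μ)
    {m ν : P2 d} {γ : Measure (E d × E d)} (hγ : γ ∈ optimalPlans m ν) :
    |sumU μ c ν - sumU μ c m - ∫ p, inner ℝ (sumG μ c m p.1) (p.2 - p.1) ∂γ| ≤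
      (∫ θ, weight c θ ∂μ) * W2 m ν ^ 2 := by
  have := isProbabilityMeasure_of_mem_couplings hγ.1
  have hp := integrable_prod_inner_fG hc hi hγ.1
  have e : ∫ p, inner ℝ (sumG μ c m p.1) (p.2 - p.1) ∂γ =
      ∫ θ, ∫ p, inner ℝ (θ.fG (c θ) m p.1) (p.2 - p.1) ∂γ ∂μ := by
    rw [← integral_integral_swap hp]
    refine integral_congr_ae (ae_of_all _ fun p => ?_)
    simp only
    rw [sumG, real_inner_comm, ← integral_inner (integrable_fG hc hi m p.1)]
    simp_rw [real_inner_comm]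
  have i3 : Integrable (fun θ => ∫ p, (inner ℝ (θ.fG (c θ) m p.1) (p.2 - p.1) : ℝ) ∂γ) μ :=
    hp.integral_prod_right
  have i12 : Integrable (fun θ => fU θ (c θ) ν - fU θ (c θ) m) μ :=
    (integrable_fU hc hi ν).sub (integrable_fU hc hi m)
  rw [e, sumU, sumU, ← integral_sub (integrable_fU hc hi ν) (integrable_fU hc hi m),
    ← integral_sub i12 i3, ← Real.norm_eq_abs]
  refine norm_integral_le_of_weight hi fun θ => ?_
  refine (θ.fU_expansion hγ).trans ?_
  exact mul_le_mul_of_nonneg_right (norm_mul_size_pow_le θ (by norm_num)) (by positivity)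

lemma sumG_expansion [SFinite μ] (hc : Measurable c) (hi : Integrable (weight c) μ)
    {m ν : P2 d} {γ : Measure (E d × E d)} (hγ : γ ∈ optimalPlans m ν)
    (x y : E d) : ‖sumG μ c ν y - sumG μ c m x - linearPart (sumB μ c m) (sumC μ c m) γ x y‖ ≤
      (∫ θ, weight c θ ∂μ) * (2 * (‖y - x‖ ^ 2 + W2 m ν ^ 2)) := by
  have := isProbabilityMeasure_of_mem_couplings hγ.1
  have hp := integrable_prod_fC hc hi hγ.1 x
  have e : ∫ p, sumC μ c m x p.1 (p.2 - p.1) ∂γ =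
      ∫ θ, ∫ p, θ.fC (c θ) m x p.1 (p.2 - p.1) ∂γ ∂μ := by
    rw [← integral_integral_swap hp]
    refine integral_congr_ae (ae_of_all _ fun p => ?_)
    exact ContinuousLinearMap.integral_apply (integrable_fC hc hi m x p.1) _
  have i4 : Integrable (fun θ => ∫ p, θ.fC (c θ) m x p.1 (p.2 - p.1) ∂γ) μ :=
    hp.integral_prod_right
  have i3 : Integrable (fun θ => θ.fB (c θ) m x (y - x)) μ :=
    (integrable_fB hc hi m x).apply_continuousLinearMap _
  have i12 : Integrable (fun θ => fG θ (c θ) ν y - fG θ (c θ) m x) μ :=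
    (integrable_fG hc hi ν y).sub (integrable_fG hc hi m x)
  have i34 : Integrable (fun θ => θ.fB (c θ) m x (y - x) +
      ∫ p, θ.fC (c θ) m x p.1 (p.2 - p.1) ∂γ) μ := i3.add i4
  rw [linearPart, e, sumB, ContinuousLinearMap.integral_apply (integrable_fB hc hi m x),
    sumG, sumG, ← integral_sub (integrable_fG hc hi ν y) (integrable_fG hc hi m x),
    ← integral_add i3 i4, ← integral_sub i12 i34]
  refine norm_integral_le_of_weight hi fun θ => (θ.fG_expansion hγ x y).trans ?_
  exact mul_le_mul_of_nonneg_right (norm_mul_size_pow_le θ le_rfl) (by positivity)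

lemma isTangent_sumC [SFinite μ] (hc : Measurable c) (hi : Integrable (weight c) μ)
    (m : P2 d) (x v : E d) :
    IsTangent m fun a => ContinuousLinearMap.adjoint (sumC μ c m x a) v := by
  have e : (fun a => ContinuousLinearMap.adjoint (sumC μ c m x a) v) =
      fun a => ∫ θ, ContinuousLinearMap.adjoint (θ.fC (c θ) m x a) v ∂μ :=
    funext fun a => adjoint_integral (integrable_fC hc hi m x a) v
  rw [e]
  have hadj : Continuous fun T : E d →L[ℝ] E d => ContinuousLinearMap.adjoint T v :=
    ContinuousLinearMap.adjoint.continuous.clm_apply continuous_const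
  refine isTangent_integral_of_continuous (fun (θ : Freqs d) a =>
    ContinuousLinearMap.adjoint (θ.fC (c θ) m x a) v) (hi.mul_const ‖v‖) (fun θ => ?_)
    (fun a => ?_) (fun θ a => ?_) fun θ => θ.isTangent_fC m x v
  · have h : Continuous fun a => θ.fC (c θ) m x a := by unfold fC; fun_prop
    exact hadj.comp' h
  · exact hadj.comp_stronglyMeasurable (stronglyMeasurable_fC hc m x a)
  · refine (ContinuousLinearMap.le_opNorm _ _).trans ?_
    rw [LinearIsometryEquiv.norm_map]
    exact mul_le_mul_of_nonneg_right (norm_fC_le_weight _ _ _ _) (norm_nonneg _)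

lemma isTangent_sumG [SFinite μ] (hc : Measurable c) (hi : Integrable (weight c) μ)
    (m : P2 d) : IsTangent m (sumG μ c m) :=
  isTangent_integral_of_continuous (fun (θ : Freqs d) x => θ.fG (c θ) m x) hi
    (fun θ => continuous_fG θ _ m) (stronglyMeasurable_fG hc m)
    (fun θ x => norm_fG_le_weight θ m x) fun θ => θ.isTangent_fG m m

lemma isTangent_inner_sumG [SFinite μ] (hc : Measurable c) (hi : Integrable (weight c) μ)
    (m : P2 d) {ζ : E d → E d} (hζ : IsTest ζ) : IsTangent m fun a =>
    ContinuousLinearMap.adjoint (sumB μ c m a) (ζ a) +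
      ContinuousLinearMap.adjoint (fderiv ℝ ζ a) (sumG μ c m a) := by
  obtain ⟨K, hK⟩ := hζ.exists_bound
  obtain ⟨K', hK'⟩ := hζ.isTest_fderiv.exists_bound
  have hζ' : Continuous (fderiv ℝ ζ) := hζ.isTest_fderiv.1.continuous
  have hadj : ∀ v, Continuous fun T : E d →L[ℝ] E d => ContinuousLinearMap.adjoint T v := fun v =>
    ContinuousLinearMap.adjoint.continuous.clm_apply continuous_const
  have b1 : ∀ (θ : Freqs d) a, ‖ContinuousLinearMap.adjoint (θ.fB (c θ) m a) (ζ a)‖ ≤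
      weight c θ * K := fun θ a => by
    refine (ContinuousLinearMap.le_opNorm _ _).trans ?_
    rw [LinearIsometryEquiv.norm_map]
    exact mul_le_mul (norm_fB_le_weight _ _ _) (hK a) (norm_nonneg _) (weight_nonneg θ)
  have b2 : ∀ (θ : Freqs d) a, ‖ContinuousLinearMap.adjoint (fderiv ℝ ζ a) (θ.fG (c θ) m a)‖ ≤
      weight c θ * K' := fun θ a => by
    refine (ContinuousLinearMap.le_opNorm _ _).trans ?_
    rw [LinearIsometryEquiv.norm_map, mul_comm]
    exact mul_le_mul (norm_fG_le_weight _ _ _) (hK' a) (norm_nonneg _) (weight_nonneg θ)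
  have m1 : ∀ a, StronglyMeasurable fun θ : Freqs d =>
      ContinuousLinearMap.adjoint (θ.fB (c θ) m a) (ζ a) := fun a =>
    (hadj _).comp_stronglyMeasurable (stronglyMeasurable_fB hc m a)
  have m2 : ∀ a, StronglyMeasurable fun θ : Freqs d =>
      ContinuousLinearMap.adjoint (fderiv ℝ ζ a) (θ.fG (c θ) m a) := fun a =>
    (ContinuousLinearMap.continuous _).comp_stronglyMeasurable (stronglyMeasurable_fG hc m a)
  have e : (fun a => ContinuousLinearMap.adjoint (sumB μ c m a) (ζ a) +
      ContinuousLinearMap.adjoint (fderiv ℝ ζ a) (sumG μ c m a)) =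
      fun a => ∫ θ, ContinuousLinearMap.adjoint (θ.fB (c θ) m a) (ζ a) +
        ContinuousLinearMap.adjoint (fderiv ℝ ζ a) (θ.fG (c θ) m a) ∂μ := by
    funext a
    rw [integral_add (integrable_of_weight hi (m1 a) (b1 · a))
      (integrable_of_weight hi (m2 a) (b2 · a)), sumB,
      adjoint_integral (integrable_fB hc hi m a), sumG,
      ContinuousLinearMap.integral_comp_comm _ (integrable_fG hc hi m a)]
  rw [e]
  refine isTangent_integral_of_continuous (fun (θ : Freqs d) a =>
    ContinuousLinearMap.adjoint (θ.fB (c θ) m a) (ζ a) +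
      ContinuousLinearMap.adjoint (fderiv ℝ ζ a) (θ.fG (c θ) m a))
    ((hi.mul_const K).add (hi.mul_const K')) (fun θ => ?_)
    (fun a => (m1 a).add (m2 a)) (fun θ a => ?_) fun θ => θ.isTangent_inner_fG m hζ
  · exact ((ContinuousLinearMap.adjoint.continuous.comp (continuous_fB θ _ m)).clm_apply
      hζ.1.continuous).add ((ContinuousLinearMap.adjoint.continuous.comp hζ').clm_apply
        (continuous_fG θ _ m))
  · exact (norm_add_le _ _).trans (add_le_add (b1 θ a) (b2 θ a))

/-- Superpositions of products of Fourier transforms with three integrable moments have uniform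
second order expansions. -/
theorem hasUniformDerivs [SFinite μ] (hc : Measurable c) (hi : Integrable (weight c) μ) :
    HasUniformDerivs (sumU μ c) (sumG μ c) (sumB μ c) (sumC μ c)
    (2 * ∫ θ, weight c θ ∂μ) := by
  have h0 : 0 ≤ ∫ θ, weight c θ ∂μ := integral_nonneg weight_nonneg
  have hle : ∫ θ, weight c θ ∂μ ≤ 2 * ∫ θ, weight c θ ∂μ := by linarith
  -- Only the expansion of the gradient needs the factor 2; the other bounds are enlarged to share
  -- one constant.
  have hscale : ∀ {r s : ℝ}, 0 ≤ s → r ≤ (∫ θ, weight c θ ∂μ) * s →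
      r ≤ (2 * ∫ θ, weight c θ ∂μ) * s := fun hs hr =>
    hr.trans (mul_le_mul_of_nonneg_right hle hs)
  have hw := W2_nonneg (d := d)
  refine ⟨fun m x => ?_, fun m x => ?_, fun m x a => ?_, fun m ν x y => ?_, fun m ν x y => ?_,
    fun m ν x y a b => ?_, fun m ν γ hγ => ?_, fun m ν γ hγ x y => ?_, isTangent_sumG hc hi,
    isTangent_sumC hc hi, fun m ζ hζ => isTangent_inner_sumG hc hi m hζ⟩
  · exact (norm_integral_le_of_norm_le hi (ae_of_all _ fun θ => norm_fG_le_weight θ m x)).trans hle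
  · exact (norm_integral_le_of_norm_le hi (ae_of_all _ fun θ => norm_fB_le_weight θ m x)).trans hle
  · exact (norm_integral_le_of_norm_le hi
      (ae_of_all _ fun θ => norm_fC_le_weight θ m x a)).trans hle
  · have := hw m ν
    refine hscale (by positivity) ?_
    rw [sumG, sumG, ← integral_sub (integrable_fG hc hi ν y) (integrable_fG hc hi m x)]
    exact norm_integral_le_of_weight hi fun θ => (θ.fG_sub_le m ν x y).trans
      (mul_le_mul_of_nonneg_right (norm_mul_size_pow_le θ (by norm_num)) (by positivity))
  · have := hw m ν
    refine hscale (by positivity) ?_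
    rw [sumB, sumB, ← integral_sub (integrable_fB hc hi ν y) (integrable_fB hc hi m x)]
    exact norm_integral_le_of_weight hi fun θ => θ.fB_sub_le m ν x y
  · have := hw m ν
    refine hscale (by positivity) ?_
    rw [sumC, sumC, ← integral_sub (integrable_fC hc hi ν y b) (integrable_fC hc hi m x a)]
    exact norm_integral_le_of_weight hi fun θ => θ.fC_sub_le m ν x y a b
  · exact hscale (by positivity) (sumU_expansion hc hi hγ)
  · exact (sumG_expansion hc hi hγ x y).trans_eq (by ring)

end Integrated

end Freqs

namespace Freqs

/-! ### The Laplacian of a superposition -/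

section Laplacian

variable {μ : Measure (Freqs d)} [SFinite μ] {c : Freqs d → ℂ}

lemma integral_swap_of_weight {X : Type*} [TopologicalSpace X] [TopologicalSpace.MetrizableSpace X]
    [MeasurableSpace X] [SecondCountableTopology X] [OpensMeasurableSpace X] {P : Measure X}
    [IsProbabilityMeasure P] (hi : Integrable (weight c) μ) {f : X → Freqs d → ℝ} {K : ℝ}
    (hcont : ∀ θ, Continuous fun x => f x θ) (hmeas : ∀ x, StronglyMeasurable (f x))
    (hb : ∀ x θ, ‖f x θ‖ ≤ weight c θ * K) :
    Integrable (fun θ => ∫ x, f x θ ∂P) μ ∧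
      ∫ x, ∫ θ, f x θ ∂μ ∂P = ∫ θ, ∫ x, f x θ ∂P ∂μ := by
  have hp : Integrable (Function.uncurry f) (P.prod μ) := by
    refine ((integrable_const (1 : ℝ)).mul_prod (hi.mul_const K)).mono'
      (stronglyMeasurable_uncurry_of_continuous_of_stronglyMeasurable hcont
        hmeas).aestronglyMeasurable (ae_of_all _ fun q => ?_)
    rw [one_mul]
    exact hb q.1 q.2
  exact ⟨hp.integral_prod_right, integral_integral_swap hp⟩

/-- Isolates the dependence on x in one plane wave, ready to be integrated against m. -/
lemma inner_fB (θ : Freqs d) (z : ℂ) (m : P2 d) (x e : E d) : inner ℝ e (θ.fB z m x e) =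
    ∑ j, (inner ℝ e (θ.2 j) * inner ℝ (θ.2 j) e : ℝ) *
      ((z * freq * freq * θ.hatProd (θ.others j) m) * wave (θ.2 j) x).re := by
  rw [fB_apply, inner_sum]
  refine Finset.sum_congr rfl fun j _ => ?_
  rw [real_inner_smul_right, dwave, mul_comm, ← Complex.re_ofReal_mul, ← Complex.re_ofReal_mul]
  congr 1
  push_cast
  ring

lemma inner_fC (θ : Freqs d) (z : ℂ) (m : P2 d) (x a e : E d) : inner ℝ e (θ.fC z m x a e) =
    ∑ j, ∑ l ∈ θ.others j, (inner ℝ e (θ.2 j) * inner ℝ (θ.2 l) e : ℝ) *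
      ((z * freq * freq * θ.hatProd ((θ.others j).erase l) m) *
        (wave (θ.2 j) x * wave (θ.2 l) a)).re := by
  rw [fC_apply, inner_sum]
  refine Finset.sum_congr rfl fun j _ => ?_
  rw [inner_sum]
  refine Finset.sum_congr rfl fun l _ => ?_
  rw [real_inner_smul_right, dwave, mul_comm, ← Complex.re_ofReal_mul, ← Complex.re_ofReal_mul]
  congr 1
  push_cast
  ring

lemma re_freq_sq (θ : Freqs d) (z : ℂ) (m : P2 d) :
    (z * freq * freq * θ.hatProd Finset.univ m).re = -(4 * Real.pi ^ 2) * θ.fU z m := by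
  rw [fU, ← Complex.re_ofReal_mul, ← freq_mul_freq]
  congr 1
  ring

lemma hat_mul_hatProd (θ : Freqs d) (m : P2 d) (s : Finset (Fin (θ.1 + 1))) {j : Fin (θ.1 + 1)}
    (hj : j ∈ s) : hat m (θ.2 j) * θ.hatProd (s.erase j) m = θ.hatProd s m :=
  Finset.mul_prod_erase s (fun l => hat m (θ.2 l)) hj

/-- The integral of the j-th wave is m̂(ξ_j), the factor missing from `hatProd`, so each summand
becomes a multiple of the original functional; the two derivatives contribute (-2πi)² = -4π². -/
lemma integral_inner_fB (θ : Freqs d) (z : ℂ) (m : P2 d) (e : E d) :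
    ∫ x, inner ℝ e (θ.fB z m x e) ∂m.toMeasure =
      ∑ j, (inner ℝ e (θ.2 j) * inner ℝ (θ.2 j) e : ℝ) * (-(4 * Real.pi ^ 2) * θ.fU z m) := by
  simp_rw [inner_fB]
  rw [integral_finsetSum _ fun j _ => (integrable_re_mul (integrable_wave m _) _).const_mul _]
  refine Finset.sum_congr rfl fun j _ => ?_
  rw [integral_const_mul, integral_re_mul (integrable_wave m _), ← re_freq_sq,
    ← θ.hat_mul_hatProd m Finset.univ (Finset.mem_univ j)]
  congr 2
  change _ * hat m (θ.2 j) = _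
  rw [others]
  ring

/-- Here two independent points restore the two missing factors m̂(ξ_j) and m̂(ξ_l). -/
lemma integral_inner_fC (θ : Freqs d) (z : ℂ) (m : P2 d) (e : E d) :
    ∫ p : E d × E d, inner ℝ e (θ.fC z m p.1 p.2 e) ∂(m.toMeasure.prod m.toMeasure) =
      ∑ j, ∑ l ∈ θ.others j, (inner ℝ e (θ.2 j) * inner ℝ (θ.2 l) e : ℝ) *
        (-(4 * Real.pi ^ 2) * θ.fU z m) := by
  simp_rw [inner_fC]
  have hi : ∀ j l, Integrable (fun p : E d × E d => wave (θ.2 j) p.1 * wave (θ.2 l) p.2)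
      (m.toMeasure.prod m.toMeasure) := fun j l =>
    (integrable_wave m _).mul_prod (integrable_wave m _)
  rw [integral_finsetSum _ fun j _ => integrable_finsetSum _ fun l _ =>
    (integrable_re_mul (hi j l) _).const_mul _]
  refine Finset.sum_congr rfl fun j _ => ?_
  rw [integral_finsetSum _ fun l _ => (integrable_re_mul (hi j l) _).const_mul _]
  refine Finset.sum_congr rfl fun l hl => ?_
  rw [integral_const_mul, integral_re_mul (hi j l), integral_prod_mul, ← re_freq_sq,
    ← θ.hat_mul_hatProd m Finset.univ (Finset.mem_univ j),
    ← θ.hat_mul_hatProd m (Finset.univ.erase j) hl]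
  congr 2
  change _ * (hat m (θ.2 j) * hat m (θ.2 l)) = _
  rw [others]
  ring

lemma sum_inner_single_mul (x y : E d) : ∑ i : Fin d,
    (inner ℝ (EuclideanSpace.single i (1 : ℝ)) x * inner ℝ y (EuclideanSpace.single i (1 : ℝ)) : ℝ)
      = inner ℝ y x := by
  rw [← (EuclideanSpace.basisFun (Fin d) ℝ).sum_inner_mul_inner y x]
  refine Finset.sum_congr rfl fun i _ => ?_
  rw [EuclideanSpace.basisFun_apply, mul_comm]

/-- The exponentials are eigenfunctions of the Laplacian. -/
lemma laplacian_fU (θ : Freqs d) (z : ℂ) (m : P2 d) (η : ℝ) : ∑ i : Fin d,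
    (∫ p : E d × E d, inner ℝ (EuclideanSpace.single i (1 : ℝ))
        (θ.fC z m p.1 p.2 (EuclideanSpace.single i (1 : ℝ))) ∂(m.toMeasure.prod m.toMeasure) +
      (1 + η) * ∫ x, inner ℝ (EuclideanSpace.single i (1 : ℝ))
        (θ.fB z m x (EuclideanSpace.single i (1 : ℝ))) ∂m.toMeasure) =
      -lamSq η (θ.1 + 1) θ.2 * θ.fU z m := by
  simp_rw [integral_inner_fB, integral_inner_fC, Finset.sum_add_distrib, ← Finset.mul_sum]
  simp_rw [← Finset.sum_mul]
  have h1 : ∑ i : Fin d, ∑ j, ∑ l ∈ θ.others j, (inner ℝ (EuclideanSpace.single i (1 : ℝ)) (θ.2 j) *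
      inner ℝ (θ.2 l) (EuclideanSpace.single i (1 : ℝ)) : ℝ) =
      ∑ j, ∑ l ∈ θ.others j, inner ℝ (θ.2 l) (θ.2 j) := by
    rw [Finset.sum_comm]
    refine Finset.sum_congr rfl fun j _ => ?_
    rw [Finset.sum_comm]
    exact Finset.sum_congr rfl fun l _ => sum_inner_single_mul _ _
  have h2 : ∑ i : Fin d, ∑ j, (inner ℝ (EuclideanSpace.single i (1 : ℝ)) (θ.2 j) *
      inner ℝ (θ.2 j) (EuclideanSpace.single i (1 : ℝ)) : ℝ) = ∑ j, inner ℝ (θ.2 j) (θ.2 j) := by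
    rw [Finset.sum_comm]
    exact Finset.sum_congr rfl fun j _ => sum_inner_single_mul _ _
  -- The off-diagonal sum is |∑ξ_j|² - ∑|ξ_j|²; added to (1 + η)∑|ξ_j|² from the diagonal it leaves
  -- the eigenvalue.
  have h : ∑ j, ∑ l ∈ θ.others j, (inner ℝ (θ.2 l) (θ.2 j) : ℝ) =
      ‖∑ j, θ.2 j‖ ^ 2 - ∑ j, ‖θ.2 j‖ ^ 2 := by
    rw [← real_inner_self_eq_norm_sq, inner_sum, ← Finset.sum_sub_distrib]
    refine Finset.sum_congr rfl fun j _ => ?_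
    rw [sum_inner, ← real_inner_self_eq_norm_sq, others,
      Finset.sum_erase_eq_sub (Finset.mem_univ j)]
  rw [h1, h2, h, lamSq]
  simp_rw [real_inner_self_eq_norm_sq]
  ring

/-- The Laplacian of a superposition of exponentials. -/
theorem hasLaplacianAt_sumU (hc : Measurable c) (hi : Integrable (weight c) μ) (η : ℝ) (m : P2 d) :
    HasLaplacianAt η (sumU μ c) m
      (∫ θ, -lamSq η (θ.1 + 1) θ.2 * θ.fU (c θ) m ∂μ) := by
  -- The general formula gives existence; what remains is to exchange the integrals over m and over
  -- frequencies.
  convert (hasUniformDerivs hc hi).hasLaplacianAt η m using 1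
  simp_rw [← laplacian_fU]
  have hn : ∀ i : Fin d, ‖EuclideanSpace.single i (1 : ℝ)‖ = 1 := fun i => by simp
  have hB : ∀ i : Fin d, Integrable (fun θ : Freqs d => ∫ x, (inner ℝ
        (EuclideanSpace.single i (1 : ℝ))
        (θ.fB (c θ) m x (EuclideanSpace.single i (1 : ℝ))) : ℝ) ∂m.toMeasure) μ ∧
      ∫ x, (inner ℝ (EuclideanSpace.single i (1 : ℝ))
        (sumB μ c m x (EuclideanSpace.single i (1 : ℝ))) : ℝ) ∂m.toMeasure =
      ∫ θ, ∫ x, inner ℝ (EuclideanSpace.single i (1 : ℝ))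
        (fB θ (c θ) m x (EuclideanSpace.single i (1 : ℝ))) ∂m.toMeasure ∂μ := fun i => by
    set e : E d := EuclideanSpace.single i (1 : ℝ)
    have := integral_swap_of_weight (P := m.toMeasure) (K := 1) hi
      (f := fun x θ => inner ℝ e (fB θ (c θ) m x e))
      (fun θ => continuous_const.inner ((continuous_fB θ _ m).clm_apply continuous_const))
      (fun x => stronglyMeasurable_const.inner
        ((continuous_eval_const e).comp_stronglyMeasurable (stronglyMeasurable_fB hc m x)))
      fun x θ => ?_
    · refine ⟨this.1, this.2 ▸ integral_congr_ae (ae_of_all _ fun x => ?_)⟩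
      simp only
      rw [sumB, ContinuousLinearMap.integral_apply (integrable_fB hc hi m x),
        integral_inner ((integrable_fB hc hi m x).apply_continuousLinearMap e)]
    · refine (norm_inner_le_norm _ _).trans ?_
      rw [hn, one_mul, mul_one]
      refine (ContinuousLinearMap.le_opNorm _ _).trans ?_
      rw [hn, mul_one]
      exact norm_fB_le_weight θ m x
  have hC : ∀ i : Fin d, Integrable (fun θ : Freqs d => ∫ p : E d × E d, (inner ℝ
        (EuclideanSpace.single i (1 : ℝ))
        (θ.fC (c θ) m p.1 p.2 (EuclideanSpace.single i (1 : ℝ))) : ℝ)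
          ∂(m.toMeasure.prod m.toMeasure)) μ ∧
      ∫ x, ∫ a, (inner ℝ (EuclideanSpace.single i (1 : ℝ))
        (sumC μ c m x a (EuclideanSpace.single i (1 : ℝ))) : ℝ) ∂m.toMeasure ∂m.toMeasure =
      ∫ θ, ∫ p : E d × E d, inner ℝ (EuclideanSpace.single i (1 : ℝ))
        (fC θ (c θ) m p.1 p.2 (EuclideanSpace.single i (1 : ℝ)))
          ∂(m.toMeasure.prod m.toMeasure) ∂μ := fun i => by
    set e : E d := EuclideanSpace.single i (1 : ℝ)
    have hcontC : Continuous fun p : E d × E d => sumC μ c m p.1 p.2 :=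
      (hasUniformDerivs hc hi).continuous_C m
    have := integral_swap_of_weight (P := m.toMeasure.prod m.toMeasure) (K := 1) hi
      (f := fun p θ => inner ℝ e (fC θ (c θ) m p.1 p.2 e))
      (fun θ => continuous_const.inner ((continuous_fC θ _ m).clm_apply continuous_const))
      (fun p => stronglyMeasurable_const.inner
        ((continuous_eval_const e).comp_stronglyMeasurable (stronglyMeasurable_fC hc m p.1 p.2)))
      fun p θ => ?_
    · refine ⟨this.1, ?_⟩
      rw [← this.2, ← integral_prod (f := fun p : E d × E d =>
        (inner ℝ e (sumC μ c m p.1 p.2 e) : ℝ))]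
      · refine integral_congr_ae (ae_of_all _ fun p => ?_)
        simp only
        rw [sumC, ContinuousLinearMap.integral_apply (integrable_fC hc hi m p.1 p.2),
          integral_inner ((integrable_fC hc hi m p.1 p.2).apply_continuousLinearMap e)]
      · refine Integrable.of_bound (C := 2 * ∫ θ, weight c θ ∂μ) (continuous_const.inner
          (hcontC.clm_apply continuous_const)).aestronglyMeasurable (ae_of_all _ fun p => ?_)
        refine (norm_inner_le_norm _ _).trans ?_
        rw [hn, one_mul]
        refine (ContinuousLinearMap.le_opNorm _ _).trans ?_
        rw [hn, mul_one]
        exact (hasUniformDerivs hc hi).norm_C_le m p.1 p.2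
    · refine (norm_inner_le_norm _ _).trans ?_
      rw [hn, one_mul, mul_one]
      refine (ContinuousLinearMap.le_opNorm _ _).trans ?_
      rw [hn, mul_one]
      exact norm_fC_le_weight θ m p.1 p.2
  rw [integral_finsetSum _ fun i _ => by exact (hC i).1.add ((hB i).1.const_mul _)]
  refine Finset.sum_congr rfl fun i _ => ?_
  rw [integral_add (hC i).1 ((hB i).1.const_mul _), integral_const_mul, (hB i).2, (hC i).2]

end Laplacian

/-! ### Fourier series on the Wasserstein space -/

variable (d) in
/-- The Lebesgue measure on tuples of frequencies. -/
def lebesgue : Measure (Freqs d) :=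
  Measure.sum fun n => (volume : Measure (Fin (n + 1) → E d)).map (Sigma.mk n)

instance : SFinite (lebesgue d) := by unfold lebesgue; infer_instance

/-- The coefficient of `∏_j m̂(ξ_j)` in `z` times the series with coefficients `b`. -/
def coef (z : ℂ) (b : (k : ℕ) → (Fin k → E d) → ℂ) (θ : Freqs d) : ℂ :=
  z * (1 / ((θ.1 + 1).factorial : ℂ) * (1 / ((θ.1 + 1 : ℕ) : ℂ)) * b (θ.1 + 1) θ.2)

end Freqs

/-! ### Series in F^k_ξ as superpositions of products of Fourier transforms -/

open Freqs

lemma expSym_eq (k : ℕ) (ξ x : Fin k → E d) : expSym k ξ x =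
    (1 / (k.factorial : ℂ)) * ∑ σ : Equiv.Perm (Fin k), ∏ j, wave (ξ (σ j)) (x j) := by
  rw [expSym]
  congr 1
  refine Finset.sum_congr rfl fun σ _ => ?_
  simp_rw [wave]
  rw [← Complex.exp_sum, ← Finset.mul_sum]
  congr 1
  rw [freq]
  push_cast
  rfl

/-- Each permuted exponential integrates to the same product, its factors being merely reordered, so
the symmetrisation averages k! equal numbers. -/
lemma eigenF_eq (k : ℕ) (ξ : Fin k → E d) (m : P2 d) :
    eigenF k ξ m = (1 / (k : ℂ)) * ∏ j, hat m (ξ j) := by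
  have hi : ∀ σ : Equiv.Perm (Fin k), Integrable (fun x : Fin k → E d =>
      ∏ j, wave (ξ (σ j)) (x j)) (Measure.pi fun _ => m.toMeasure) := fun σ => by
    refine Integrable.of_bound (C := 1) (Continuous.aestronglyMeasurable ?_)
      (ae_of_all _ fun x => ?_)
    · exact continuous_finsetProd _ fun j _ => continuous_const.wave (continuous_apply j)
    · rw [norm_prod]
      simp [norm_wave]
  have h : ∀ σ : Equiv.Perm (Fin k), ∫ x : Fin k → E d, ∏ j, wave (ξ (σ j)) (x j)
      ∂(Measure.pi fun _ => m.toMeasure) = ∏ j, hat m (ξ j) := fun σ => by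
    rw [integral_fintype_prod_eq_prod (fun j x => wave (ξ (σ j)) x)]
    exact Equiv.prod_comp σ fun j => hat m (ξ j)
  rw [eigenF]
  congr 1
  simp_rw [expSym_eq]
  rw [integral_const_mul, integral_finsetSum _ fun σ _ => hi σ]
  simp_rw [h]
  have : (k.factorial : ℂ) ≠ 0 := by exact_mod_cast k.factorial_ne_zero
  simp [Fintype.card_perm]
  field_simp

lemma norm_eigenF_le (k : ℕ) (ξ : Fin k → E d) (m : P2 d) : ‖eigenF k ξ m‖ ≤ 1 / k := by
  rw [eigenF_eq, norm_mul, norm_prod]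
  have h : ∏ j, ‖hat m (ξ j)‖ ≤ 1 :=
    Finset.prod_le_one (fun _ _ => norm_nonneg _) fun _ _ => norm_hat_le _ _
  refine (mul_le_of_le_one_right (norm_nonneg _) h).trans_eq ?_
  simp

namespace Freqs

variable {b : (k : ℕ) → (Fin k → E d) → ℂ}

lemma measurable_coef (z : ℂ) (hb : ∀ k, 1 ≤ k → Measurable (b k)) : Measurable (coef z b) :=
  measurable_of_sigma fun n => by
    change Measurable fun ξ : Fin (n + 1) → E d =>
      z * (1 / ((n + 1).factorial : ℂ) * (1 / ((n + 1 : ℕ) : ℂ)) * b (n + 1) ξ)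
    exact ((hb (n + 1) (by omega)).const_mul _).const_mul _

lemma norm_coef (z : ℂ) (θ : Freqs d) : ‖coef z b θ‖ =
    ‖z‖ * (((θ.1 + 1).factorial : ℝ)⁻¹ * ((θ.1 + 1 : ℕ) : ℝ)⁻¹ * ‖b (θ.1 + 1) θ.2‖) := by
  rw [coef, norm_mul, norm_mul, norm_mul]
  simp only [one_div, norm_inv, Complex.norm_natCast]

/-- The values of a series are integrals over tuples of frequencies. -/
lemma sumU_coef (z : ℂ) (hb : ∀ k, 1 ≤ k → Measurable (b k))
    (hi : Integrable (weight (coef z b)) (lebesgue d)) (m : P2 d) :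
    sumU (lebesgue d) (coef z b) m = (z * fullSum b m).re := by
  have hm : Measurable fun θ : Freqs d => coef z b θ * θ.hatProd Finset.univ m := by
    refine (measurable_coef z hb).mul (measurable_of_sigma fun n => ?_)
    exact (continuous_prod_hat (Finset.univ : Finset (Fin (n + 1))) m).measurable
  have hint : Integrable (fun θ : Freqs d => coef z b θ * θ.hatProd Finset.univ m)
      (lebesgue d) := by
    refine hi.mono' hm.aestronglyMeasurable (ae_of_all _ fun θ => ?_)
    rw [norm_mul]
    refine (mul_le_of_le_one_right (norm_nonneg _) (θ.norm_hatProd_le _ m)).trans ?_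
    simpa using norm_mul_size_pow_le (c := coef z b) (k := 0) θ (by norm_num)
  -- The measure is a sum over n, so the integral is a series; index n carries the term of degree n
  -- + 1.
  have hs := hasSum_integral_measure hint
  have hterm : ∀ n : ℕ, ∫ θ : Freqs d, coef z b θ * hatProd θ Finset.univ m
      ∂((volume : Measure (Fin (n + 1) → E d)).map (Sigma.mk n)) = z * term b (n + 1) m := by
    intro n
    rw [integral_map (measurable_sigmaMk n).aemeasurable hm.aestronglyMeasurable, term,
      ← integral_const_mul, ← integral_const_mul]
    refine integral_congr_ae (ae_of_all _ fun ξ => ?_)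
    simp only
    rw [eigenF_eq, coef, hatProd]
    ring
  simp_rw [hterm] at hs
  change ∫ θ, (coef z b θ * θ.hatProd Finset.univ m).re ∂(lebesgue d) = _
  rw [fullSum, ← tsum_mul_left, hs.tsum_eq]
  exact integral_re hint

end Freqs

/-! ### Integrability of the coefficients -/

/-- The coefficients `b` with three derivatives are controlled by the coefficients `a`. -/
def Dominated (a b : (k : ℕ) → (Fin k → E d) → ℂ) : Prop :=
  ∃ Q : ℝ, 0 ≤ Q ∧ ∀ (n : ℕ) (ξ : Fin (n + 1) → E d),
    ‖b (n + 1) ξ‖ * size ⟨n, ξ⟩ ^ 3 ≤ Q * ((n + 1 : ℕ) : ℝ) ^ 3 * ‖a (n + 1) ξ‖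

/-- Summable control of the `L¹` norms of the coefficients. -/
def SummableL1 (a : (k : ℕ) → (Fin k → E d) → ℂ) (K δ : ℝ) : Prop :=
  ∀ k : ℕ, 1 ≤ k → ∫⁻ ξ, ‖a k ξ‖ₑ ≤ ENNReal.ofReal (K * (k.factorial : ℝ) / (k : ℝ) ^ (3 + δ))

lemma summable_rpow_shift {p : ℝ} (hp : 1 < p) :
    Summable fun n : ℕ => (((n + 1 : ℕ) : ℝ) ^ p)⁻¹ :=
  (summable_nat_add_iff 1).2 (Real.summable_nat_rpow_inv.2 hp)

/-- Power count: 1/k! from the series, 1/k from F^k, k³ from the domination and k!/k^(3+δ) from the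
L¹ bound leave k^(-1-δ). -/
lemma Dominated.integrable_weight {a b : (k : ℕ) → (Fin k → E d) → ℂ} {K δ : ℝ} (hδ : 0 < δ)
    (ha : SummableL1 a K δ) (hb : ∀ k, 1 ≤ k → Measurable (b k)) (h : Dominated a b) (z : ℂ) :
    Integrable (weight (coef z b)) (lebesgue d) := by
  obtain ⟨Q, hQ0, hQ⟩ := h
  have hm : Measurable (weight (coef z b)) := by
    refine (measurable_coef z hb).norm.mul (Measurable.pow_const ?_ 3)
    refine measurable_of_sigma fun n => Continuous.measurable ?_
    change Continuous fun ξ : Fin (n + 1) → E d => 1 + 4 * Real.pi * ∑ j, ‖ξ j‖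
    fun_prop
  refine ⟨hm.aestronglyMeasurable, ?_⟩
  rw [HasFiniteIntegral, lebesgue, lintegral_sum_measure]
  have key : ∀ n : ℕ, ∫⁻ θ, ‖weight (coef z b) θ‖ₑ
      ∂((volume : Measure (Fin (n + 1) → E d)).map (Sigma.mk n)) ≤
      ENNReal.ofReal (‖z‖ * Q * |K| * (((n + 1 : ℕ) : ℝ) ^ (1 + δ))⁻¹) := by
    intro n
    set k : ℝ := ((n + 1 : ℕ) : ℝ) with hk
    have hk0 : 0 < k := by positivity
    set f : ℝ := ((n + 1).factorial : ℝ) with hf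
    have hf0 : 0 < f := by positivity
    set q : ℝ := ‖z‖ * Q * (f⁻¹ * k ^ 2) with hq
    have hq0 : 0 ≤ q := by positivity
    rw [lintegral_map hm.enorm (measurable_sigmaMk n)]
    calc ∫⁻ ξ : Fin (n + 1) → E d, ‖weight (coef z b) ⟨n, ξ⟩‖ₑ
        ≤ ∫⁻ ξ, ENNReal.ofReal q * ‖a (n + 1) ξ‖ₑ := by
          refine lintegral_mono fun ξ => ?_
          rw [← ofReal_norm, ← ofReal_norm, ← ENNReal.ofReal_mul hq0]
          refine ENNReal.ofReal_le_ofReal ?_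
          rw [Real.norm_of_nonneg (weight_nonneg _), weight, norm_coef]
          calc ‖z‖ * (f⁻¹ * k⁻¹ * ‖b (n + 1) ξ‖) * size ⟨n, ξ⟩ ^ 3
              = ‖z‖ * (f⁻¹ * k⁻¹) * (‖b (n + 1) ξ‖ * size ⟨n, ξ⟩ ^ 3) := by ring
            _ ≤ ‖z‖ * (f⁻¹ * k⁻¹) * (Q * k ^ 3 * ‖a (n + 1) ξ‖) := by
                exact mul_le_mul_of_nonneg_left (hQ n ξ) (by positivity)
            _ = q * ‖a (n + 1) ξ‖ := by rw [hq]; field_simp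
      _ = ENNReal.ofReal q * ∫⁻ ξ, ‖a (n + 1) ξ‖ₑ := lintegral_const_mul' _ _ (by simp)
      -- The sign of K is free, and passing to |K| keeps all real majorants nonnegative.
      _ ≤ ENNReal.ofReal q * ENNReal.ofReal (|K| * f / k ^ (3 + δ)) := by
          gcongr
          refine (ha (n + 1) (by omega)).trans (ENNReal.ofReal_le_ofReal ?_)
          have : K * f ≤ |K| * f := mul_le_mul_of_nonneg_right (le_abs_self K) hf0.le
          gcongr
      _ = ENNReal.ofReal (‖z‖ * Q * |K| * (k ^ (1 + δ))⁻¹) := by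
          rw [← ENNReal.ofReal_mul hq0]
          congr 1
          have e : k ^ (3 + δ) = k ^ 2 * k ^ (1 + δ) := by
            rw [← Real.rpow_natCast, ← Real.rpow_add hk0]
            congr 1
            push_cast
            ring
          have : 0 < k ^ (1 + δ) := Real.rpow_pos_of_pos hk0 _
          rw [e, hq]
          field_simp
  refine (ENNReal.tsum_le_tsum key).trans_lt ?_
  have hs : Summable fun n : ℕ => ‖z‖ * Q * |K| * (((n + 1 : ℕ) : ℝ) ^ (1 + δ))⁻¹ :=
    (summable_rpow_shift (by linarith)).mul_left _
  rw [← ENNReal.ofReal_tsum_of_nonneg (fun n => by positivity) hs]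
  exact ENNReal.ofReal_lt_top

/-- The majorant for the Weierstrass test, uniform in m; the bound 1 on F^k suffices here. -/
lemma norm_term_le {a b : (k : ℕ) → (Fin k → E d) → ℂ} {K δ : ℝ} (ha : SummableL1 a K δ)
    (hb : ∀ k ξ, ‖b k ξ‖ ≤ ‖a k ξ‖) (n : ℕ) (m : P2 d) :
    ‖term b (n + 1) m‖ ≤ |K| * (((n + 1 : ℕ) : ℝ) ^ (3 + δ))⁻¹ := by
  set k : ℝ := ((n + 1 : ℕ) : ℝ) with hk
  have hk1 : 1 ≤ k := by rw [hk]; push_cast; linarith [n.cast_nonneg (α := ℝ)]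
  have hk0 : 0 < k := by positivity
  set f : ℝ := ((n + 1).factorial : ℝ) with hf
  have hf0 : 0 < f := by positivity
  have h1 : ‖∫ ξ, b (n + 1) ξ * eigenF (n + 1) ξ m‖ₑ ≤
      ENNReal.ofReal (|K| * f / k ^ (3 + δ)) := by
    refine (enorm_integral_le_lintegral_enorm _).trans ((lintegral_mono fun ξ => ?_).trans
      ((ha (n + 1) (by omega)).trans (ENNReal.ofReal_le_ofReal ?_)))
    · rw [enorm_le_iff_norm_le, norm_mul]
      have h2 : ‖eigenF (n + 1) ξ m‖ ≤ 1 := (norm_eigenF_le _ ξ m).trans (by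
        rw [div_le_one hk0]; exact hk1)
      exact (mul_le_of_le_one_right (norm_nonneg _) h2).trans (hb _ ξ)
    · have : K * f ≤ |K| * f := mul_le_mul_of_nonneg_right (le_abs_self K) hf0.le
      gcongr
  have h2 : ‖∫ ξ, b (n + 1) ξ * eigenF (n + 1) ξ m‖ ≤ |K| * f / k ^ (3 + δ) := by
    rw [← ofReal_norm] at h1
    exact (ENNReal.ofReal_le_ofReal_iff (by positivity)).1 h1
  rw [term, norm_mul]
  have h3 : ‖(1 / ((n + 1).factorial : ℂ))‖ = f⁻¹ := by
    simp only [one_div, norm_inv, Complex.norm_natCast, hf]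
  rw [h3]
  refine (mul_le_mul_of_nonneg_left h2 (by positivity)).trans_eq ?_
  field_simp

lemma tendstoUniformly_partialSum {a b : (k : ℕ) → (Fin k → E d) → ℂ} {K δ : ℝ} (hδ : 0 < δ)
    (ha : SummableL1 a K δ) (hb : ∀ k ξ, ‖b k ξ‖ ≤ ‖a k ξ‖) :
    TendstoUniformly (partialSum b) (fullSum b) atTop :=
  tendstoUniformly_tsum_nat ((summable_rpow_shift (by linarith)).mul_left |K|)
    (norm_term_le ha hb)

/-! ### The heat flow -/

lemma lamSq_nonneg {η : ℝ} (hη : 0 ≤ η) (k : ℕ) (ξ : Fin k → E d) : 0 ≤ lamSq η k ξ := by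
  unfold lamSq; positivity

lemma continuous_lamSq (η : ℝ) (k : ℕ) : Continuous fun ξ : Fin k → E d => lamSq η k ξ := by
  unfold lamSq; fun_prop

/-- The coefficients of `(βΔ)^r` applied to the heat flow. -/
def heatCoeffPow (β ε t : ℝ) (a : (k : ℕ) → (Fin k → E d) → ℂ) (r k : ℕ) (ξ : Fin k → E d) : ℂ :=
  (((-(β * lamSq (ε / β) k ξ)) ^ r : ℝ) : ℂ) * heatCoeff β ε t a k ξ

lemma measurable_heatCoeffPow {β ε t : ℝ} {a : (k : ℕ) → (Fin k → E d) → ℂ}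
    (ha : ∀ k, 1 ≤ k → Measurable (a k)) (r k : ℕ) (hk : 1 ≤ k) :
    Measurable (heatCoeffPow β ε t a r k) := by
  have h := continuous_lamSq (d := d) (ε / β) k
  have h1 : Continuous fun ξ : Fin k → E d => (((-(β * lamSq (ε / β) k ξ)) ^ r : ℝ) : ℂ) := by
    fun_prop
  have h2 : Continuous fun ξ : Fin k → E d =>
      ((Real.exp (-(β * lamSq (ε / β) k ξ * t)) : ℝ) : ℂ) := by fun_prop
  exact h1.measurable.mul ((ha k hk).mul h2.measurable)

/-- Powers are absorbed by exponentials. -/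
lemma pow_mul_exp_le {r : ℕ} {X y t A : ℝ} (hX : 0 ≤ X) (ht : 0 < t) (hA : 0 ≤ A) (hy : 0 ≤ y)
    (hyX : y ≤ 2 + A * X) :
    X ^ r * y ^ 3 * Real.exp (-(X * t)) ≤ ((r + 3) / t) ^ r * (2 + A * ((r + 3) / t)) ^ 3 := by
  -- The exponential is split into r + 3 equal factors, one for each of the r copies of X and the
  -- three copies of y; then u exp(-u) ≤ 1 bounds X e by (r + 3)/t.
  set e := Real.exp (-(X * t / (r + 3))) with he
  have hr : (0 : ℝ) < r + 3 := by positivity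
  have e0 : 0 < e := Real.exp_pos _
  have e1 : e ≤ 1 := Real.exp_le_one_iff.2 (by
    have : 0 ≤ X * t / (r + 3) := by positivity
    linarith)
  have h1 : X * e ≤ (r + 3) / t := by
    have h := Real.add_one_le_exp (X * t / (r + 3))
    have h2 : X * t / (r + 3) * e ≤ 1 := by
      rw [he, Real.exp_neg, ← div_eq_mul_inv, div_le_one (Real.exp_pos _)]
      linarith
    rw [le_div_iff₀ ht]
    rw [div_mul_eq_mul_div, div_le_one hr] at h2
    linarith
  have h3 : y * e ≤ 2 + A * ((r + 3) / t) := by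
    calc y * e ≤ (2 + A * X) * e := by gcongr
      _ = 2 * e + A * (X * e) := by ring
      _ ≤ 2 * 1 + A * ((r + 3) / t) := by gcongr
      _ = _ := by ring
  have h4 : Real.exp (-(X * t)) = e ^ r * e ^ 3 := by
    rw [← pow_add, he, ← Real.exp_nat_mul]
    congr 1
    push_cast
    field_simp
  calc X ^ r * y ^ 3 * Real.exp (-(X * t)) = (X * e) ^ r * (y * e) ^ 3 := by rw [h4]; ring
    _ ≤ _ := by gcongr

/-- With Y = X/ε ≥ 4π²∑|ξ_j|², Cauchy–Schwarz and 4kY ≤ (k + Y)² give 4π∑|ξ_j| ≤ k + Y, and 1 + k +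
Y ≤ k(2 + Y) as k ≥ 1. Positivity of ε is essential: |∑ξ_j|² alone does not control the individual
frequencies. -/
lemma size_le {β ε : ℝ} (hβ : 0 < β) (hε : 0 < ε) (n : ℕ) (ξ : Fin (n + 1) → E d) :
    size ⟨n, ξ⟩ ≤ ((n + 1 : ℕ) : ℝ) * (2 + 1 / ε * (β * lamSq (ε / β) (n + 1) ξ)) := by
  set k : ℝ := ((n + 1 : ℕ) : ℝ) with hk
  have hk1 : 1 ≤ k := by rw [hk]; push_cast; linarith [n.cast_nonneg (α := ℝ)]
  set X := β * lamSq (ε / β) (n + 1) ξ with hX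
  have hX0 : 0 ≤ X := mul_nonneg hβ.le (lamSq_nonneg (by positivity) _ _)
  have h1 : 4 * Real.pi ^ 2 * ∑ j, ‖ξ j‖ ^ 2 ≤ 1 / ε * X := by
    have : X = 4 * Real.pi ^ 2 * (β * ‖∑ j, ξ j‖ ^ 2 + ε * ∑ j, ‖ξ j‖ ^ 2) := by
      rw [hX, lamSq]; field_simp
    rw [one_div, ← div_eq_inv_mul, le_div_iff₀ hε, this]
    have : 0 ≤ 4 * Real.pi ^ 2 * (β * ‖∑ j, ξ j‖ ^ 2) := by positivity
    linarith
  have h2 : (∑ j, ‖ξ j‖) ^ 2 ≤ k * ∑ j, ‖ξ j‖ ^ 2 := by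
    have := sq_sum_le_card_mul_sum_sq (s := Finset.univ) (f := fun j => ‖ξ j‖)
    simpa [hk] using this
  have hY : 0 ≤ 1 / ε * X := by positivity
  have h3 : (4 * Real.pi * ∑ j, ‖ξ j‖) ^ 2 ≤ (k + 1 / ε * X) ^ 2 := by
    calc (4 * Real.pi * ∑ j, ‖ξ j‖) ^ 2 = 16 * Real.pi ^ 2 * (∑ j, ‖ξ j‖) ^ 2 := by ring
      _ ≤ 16 * Real.pi ^ 2 * (k * ∑ j, ‖ξ j‖ ^ 2) := by gcongr
      _ = 4 * k * (4 * Real.pi ^ 2 * ∑ j, ‖ξ j‖ ^ 2) := by ring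
      _ ≤ 4 * k * (1 / ε * X) := by gcongr
      _ ≤ (k + 1 / ε * X) ^ 2 := by nlinarith [sq_nonneg (k - 1 / ε * X)]
  have h4 := abs_le_of_sq_le_sq' h3 (by positivity) |>.2
  change 1 + 4 * Real.pi * ∑ j, ‖ξ j‖ ≤ _
  nlinarith

lemma dominated_heatCoeffPow {β ε t : ℝ} (hβ : 0 < β) (hε : 0 < ε) (ht : 0 < t)
    (a : (k : ℕ) → (Fin k → E d) → ℂ) (r : ℕ) : Dominated a (heatCoeffPow β ε t a r) := by
  refine ⟨((r + 3) / t) ^ r * (2 + 1 / ε * ((r + 3) / t)) ^ 3, by positivity, fun n ξ => ?_⟩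
  set k : ℝ := ((n + 1 : ℕ) : ℝ) with hk
  have hk0 : 0 < k := by positivity
  set X := β * lamSq (ε / β) (n + 1) ξ with hX
  have hX0 : 0 ≤ X := mul_nonneg hβ.le (lamSq_nonneg (by positivity) _ _)
  have hs := size_le hβ hε n ξ
  have hs0 : 0 ≤ size ⟨n, ξ⟩ := zero_le_one.trans (one_le_size _)
  -- Dividing the size by k makes the constant independent of k; the factor k³ reappears in
  -- `Dominated`.
  have hp := pow_mul_exp_le (r := r) (y := size ⟨n, ξ⟩ / k) (A := 1 / ε) hX0 ht (by positivity)
    (by positivity) (by rw [div_le_iff₀ hk0, mul_comm]; exact hs)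
  have hn : ‖heatCoeffPow β ε t a r (n + 1) ξ‖ =
      X ^ r * (‖a (n + 1) ξ‖ * Real.exp (-(X * t))) := by
    rw [heatCoeffPow, heatCoeff, norm_mul, norm_mul, Complex.norm_real, Complex.norm_real,
      norm_pow, norm_neg, Real.norm_of_nonneg hX0, Real.norm_of_nonneg (Real.exp_pos _).le]
  rw [hn]
  calc X ^ r * (‖a (n + 1) ξ‖ * Real.exp (-(X * t))) * size ⟨n, ξ⟩ ^ 3
      = (X ^ r * (size ⟨n, ξ⟩ / k) ^ 3 * Real.exp (-(X * t))) * k ^ 3 * ‖a (n + 1) ξ‖ := by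
        field_simp
    _ ≤ _ := by gcongr

lemma Dominated.const_mul {a b b' : (k : ℕ) → (Fin k → E d) → ℂ} (h : Dominated a b) (z : ℂ)
    (hb : ∀ k ξ, b' k ξ = z * b k ξ) : Dominated a b' := by
  obtain ⟨Q, hQ0, hQ⟩ := h
  refine ⟨‖z‖ * Q, by positivity, fun n ξ => ?_⟩
  rw [hb, norm_mul, mul_assoc, mul_assoc ‖z‖, mul_assoc ‖z‖]
  exact mul_le_mul_of_nonneg_left (hQ n ξ) (norm_nonneg _)

lemma fullSum_const_mul (z : ℂ) (b : (k : ℕ) → (Fin k → E d) → ℂ) (m : P2 d) :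
    fullSum (fun k ξ => z * b k ξ) m = z * fullSum b m := by
  rw [fullSum, fullSum, ← tsum_mul_left]
  refine tsum_congr fun n => ?_
  rw [term, term]
  simp_rw [mul_assoc z]
  rw [integral_const_mul]
  ring

section Series

variable {a b : (k : ℕ) → (Fin k → E d) → ℂ} {K δ : ℝ}

lemma re_neg_I_mul (w : ℂ) : (-Complex.I * w).re = w.im := by simp

/-- Real and imaginary parts are both of the form Re(z ·), with z = 1 and z = -i; this is why `coef`
carries a scalar. -/
lemma isC2Complex_fullSum (hδ : 0 < δ) (ha : SummableL1 a K δ)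
    (hb : ∀ k, 1 ≤ k → Measurable (b k)) (h : Dominated a b) : IsC2Complex (fullSum b) := by
  have key : ∀ z : ℂ, IsC2 fun m => (z * fullSum b m).re := fun z => by
    have hi := h.integrable_weight hδ ha hb z
    have := (hasUniformDerivs (measurable_coef z hb) hi).isC2
    rwa [funext (sumU_coef z hb hi)] at this
  have h1 := key 1
  have h2 := key (-Complex.I)
  simp_rw [one_mul] at h1
  simp_rw [re_neg_I_mul] at h2
  exact ⟨h1, h2⟩

/-- The first domination provides the derivatives; the second is needed to recognise the integral of
eigenvalues times functionals as a series again. -/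
lemma hasLaplacianAtComplex_fullSum (hδ : 0 < δ) (ha : SummableL1 a K δ)
    (hb : ∀ k, 1 ≤ k → Measurable (b k)) (h : Dominated a b) (η : ℝ)
    (h' : Dominated a fun k ξ => ((-lamSq η k ξ : ℝ) : ℂ) * b k ξ) (m : P2 d) :
    HasLaplacianAtComplex η (fullSum b) m
      (fullSum (fun k ξ => ((-lamSq η k ξ : ℝ) : ℂ) * b k ξ) m) := by
  have hb' : ∀ k, 1 ≤ k → Measurable fun ξ => ((-lamSq η k ξ : ℝ) : ℂ) * b k ξ := fun k hk => by
    have := continuous_lamSq (d := d) η k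
    exact (by fun_prop : Continuous fun ξ : Fin k → E d =>
      ((-lamSq η k ξ : ℝ) : ℂ)).measurable.mul (hb k hk)
  have key : ∀ z : ℂ, HasLaplacianAt η (fun m => (z * fullSum b m).re) m
      (z * fullSum (fun k ξ => ((-lamSq η k ξ : ℝ) : ℂ) * b k ξ) m).re := fun z => by
    have hi := h.integrable_weight hδ ha hb z
    have hi' := h'.integrable_weight hδ ha hb' z
    have := hasLaplacianAt_sumU (measurable_coef z hb) hi η m
    rw [funext (sumU_coef z hb hi)] at this
    rw [← sumU_coef z hb' hi']
    convert this using 1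
    refine integral_congr_ae (ae_of_all _ fun θ => ?_)
    simp only [fU]
    rw [← Complex.re_ofReal_mul, coef, coef]
    congr 1
    ring
  have h1 := key 1
  have h2 := key (-Complex.I)
  simp_rw [one_mul] at h1
  simp_rw [re_neg_I_mul] at h2
  exact ⟨h1, h2⟩

end Series

/-- Each application of βΔ multiplies the coefficients by -βλ², and the exponential keeps every
resulting family dominated, so the induction never runs out of regularity. -/
lemma isLaplacianPower_heatFlow {β ε t K δ : ℝ} (hβ : 0 < β) (hε : 0 < ε) (ht : 0 < t)
    (hδ : 0 < δ) {a : (k : ℕ) → (Fin k → E d) → ℂ} (hm : ∀ k, 1 ≤ k → Measurable (a k))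
    (ha : SummableL1 a K δ) (r : ℕ) :
    IsLaplacianPower β ε r (heatFlow β ε a t) (fullSum (heatCoeffPow β ε t a r)) := by
  induction r with
  | zero =>
    change fullSum (heatCoeffPow β ε t a 0) = fullSum (heatCoeff β ε t a)
    congr 1
    funext k ξ
    simp [heatCoeffPow]
  | succ r ih =>
    refine ⟨_, ih, fun m => ?_⟩
    set b := heatCoeffPow β ε t a r
    have hβ' : (β : ℂ) ≠ 0 := by exact_mod_cast hβ.ne'
    have hrel : ∀ k ξ, heatCoeffPow β ε t a (r + 1) k ξ =
        β * (((-lamSq (ε / β) k ξ : ℝ) : ℂ) * b k ξ) := fun k ξ => by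
      simp only [b, heatCoeffPow]
      push_cast
      ring
    refine ⟨fullSum (fun k ξ => ((-lamSq (ε / β) k ξ : ℝ) : ℂ) * b k ξ) m,
      hasLaplacianAtComplex_fullSum hδ ha (measurable_heatCoeffPow hm r)
        (dominated_heatCoeffPow hβ hε ht a r) (ε / β) ?_ m, ?_⟩
    -- The coefficients of Δ without the prefactor are those of the next power divided by β.
    · refine (dominated_heatCoeffPow hβ hε ht a (r + 1)).const_mul (β : ℂ)⁻¹ fun k ξ => ?_
      rw [hrel, inv_mul_cancel_left₀ hβ']
    · rw [← fullSum_const_mul]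
      congr 1
      funext k ξ
      exact hrel k ξ

lemma norm_heatCoeff_le {β ε t : ℝ} (hβ : 0 < β) (hε : 0 < ε) (ht : 0 < t)
    (a : (k : ℕ) → (Fin k → E d) → ℂ) (k : ℕ) (ξ : Fin k → E d) :
    ‖heatCoeff β ε t a k ξ‖ ≤ ‖a k ξ‖ := by
  rw [heatCoeff, norm_mul, Complex.norm_real, Real.norm_of_nonneg (Real.exp_pos _).le]
  refine mul_le_of_le_one_right (norm_nonneg _) (Real.exp_le_one_iff.2 ?_)
  have : 0 ≤ β * lamSq (ε / β) k ξ * t :=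
    mul_nonneg (mul_nonneg hβ.le (lamSq_nonneg (by positivity) _ _)) ht.le
  linarith

end WassersteinHeat

end

/-! ### Conclusion: uniform convergence and regularity of all Laplacian powers -/

theorem mainTheorem9 (d : ℕ) (β ε s δ K : ℝ) (hβ : 0 < β) (hε : 0 < ε) (hs : 0 < s) (hδ : 0 < δ)
    (a : (k : ℕ) → (Fin k → WassersteinHeat.E d) → ℂ)
    (ha : WassersteinHeat.MemA s a)
    (hbound : ∀ k : ℕ, 1 ≤ k →
      ∫⁻ ξ, ‖a k ξ‖ₑ ≤ ENNReal.ofReal (K * (k.factorial : ℝ) / (k : ℝ) ^ (3 + δ))) :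
    TendstoUniformly (WassersteinHeat.partialSum a) (WassersteinHeat.fullSum a) Filter.atTop ∧
    ∀ t : ℝ, 0 < t →
      TendstoUniformly (WassersteinHeat.partialSum (WassersteinHeat.heatCoeff β ε t a))
        (WassersteinHeat.heatFlow β ε a t) Filter.atTop ∧
      ∀ r : ℕ, ∃ W : WassersteinHeat.P2 d → ℂ,
        WassersteinHeat.IsLaplacianPower β ε r (WassersteinHeat.heatFlow β ε a t) W ∧
        WassersteinHeat.IsC2Complex W := by
  have hL : WassersteinHeat.SummableL1 a K δ := hbound
  refine ⟨WassersteinHeat.tendstoUniformly_partialSum hδ hL fun _ _ => le_rfl, fun t ht =>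
    ⟨WassersteinHeat.tendstoUniformly_partialSum hδ hL
      (WassersteinHeat.norm_heatCoeff_le hβ hε ht a), fun r =>
    ⟨_, WassersteinHeat.isLaplacianPower_heatFlow hβ hε ht hδ ha.measurable hL r, ?_⟩⟩⟩
  exact WassersteinHeat.isC2Complex_fullSum hδ hL
    (WassersteinHeat.measurable_heatCoeffPow ha.measurable r)
    (WassersteinHeat.dominated_heatCoeffPow hβ hε ht a r)
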